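/- **Setting.** Let $D, n \ge 1$, let $\mathcal Z^1,\dots,\mathcal Z^D\subset\mathbb R$ be compact and $\mathcal Z=\prod_j\mathcal Z^j$; for $S\subset[D]$ write $z^S$ for the sub-vector of $z$ with indices in $S$ and $\mathcal Z^S=\prod_{k\in S}\mathcal Z^k$. Let $p$ be a probability density on $\mathcal Z$ (with respect to Lebesgue measure), $p_S$ the marginal density of $z^S$, obtained by integrating $p$ over the other coordinates, and let $Z_1,\dots,Z_n$ be an i.i.d. sample from $p$. Let $\mathcal G$ be an acyclic directed mixed graph (ADMG) on $[D]$ for which $1,\dots,D$ is a topological order. The Markov pillow $\mathrm{mp}(j)$ is formed in the subgraph on $\{1,\dots,j\}$: it consists of the vertices connected to $j$ by bi-directed paths ($j$ included) and of all parents of these vertices, with $j$ removed. Put $p_{j,\mathrm{mp}(j)}=p_{\{j\}\cup \mathrm{mp}(j)}$ and $p_{j|\mathrm{mp}(j)}=p_{j,\mathrm{mp}(j)}/p_{\mathrm{mp}(j)}$, and assume that $\mathcal G$ is correctly specified: $p(z)=\prod_{j=1}^D p_{j|\mathrm{mp}(j)}(z^j|z^{\mathrm{mp}(j)})$ for almost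 every $z\in\mathcal Z$. Let $\mathcal F$ be a hypothesis class, $\ell:\mathcal F\times\mathbb R^D\to[0,\infty)$ a loss, measurable in the second argument, and $R(f)=\mathbb E\,\ell(f,Z_1)$. Let $h\in\mathbb R_{>0}^D$, $H_j=\mathrm{diag}(h^{\mathrm{mp}(j)})$, let $K^j:\mathbb R^{|\mathrm{mp}(j)|}\to\mathbb R$ be kernels ($K^j=1$ if $\mathrm{mp}(j)=\emptyset$), and $K^j_H(u)=|\det H_j|^{-1}K^j(H_j^{-1}u)$. The augmented empirical risk is $$\hat R_{\rm aug}(f)=\sum_{(i_1,\dots,i_D)\in[n]^D}\Big(\prod_{j=1}^D\frac{K^j_H(Z_{\boldsymbol i}^{\mathrm{mp}(j)}-Z_{i_j}^{\mathrm{mp}(j)})}{\sum_{k=1}^nK^j_H(Z_{\boldsymbol i}^{\mathrm{mp}(j)}-Z_k^{\mathrm{mp}(j)})}\Big)\,\ell(f,Z_{\boldsymbol i}),\qquad Z_{\boldsymbol i}=(Z^1_{i_1},\dots,Z^D_{i_D}).$$ **Assumptions.** Let $\beta>1$, $L>0$, $k=\lfloor\beta\rfloor$. Let $\Sigma(\beta,L)$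 be the class of $C^k$ functions $f$ on $\mathbb R^d$ with $|D^\alpha f(x)-D^\alpha f(x')|\le L\|x-x'\|^{\beta-k}$ for all $|\alpha|=k$. Assume $B_\ell:=\sup_{f}\sup_{z\in\mathbb R^D}|\ell(f,z)|<\infty$ and, for every $j$: 1. $K^j$ is continuous, strictly positive and bounded, with $B_K:=\max_j\|K^j\|_\infty$; it is of order $k$, that is $\int K^j=1$ and $\int K^j(u)u^\alpha\,du=0$ for $1\le|\alpha|\le k$; and $\int|K^j(u)|\|u\|^\beta du<\infty$. 2. $\epsilon_{\mathrm{mp}(j)}:=\inf_{\mathcal Z^{\mathrm{mp}(j)}}p_{\mathrm{mp}(j)}>0$. 3. $p_{\mathrm{mp}(j)}$ has an extension $\check p_{\mathrm{mp}(j)}\in\Sigma(\beta,L)$ and, for each $x\in\mathcal Z^j$, $p_{j,\mathrm{mp}(j)}(x,\cdot)$ has an extension $\check p_{j,\mathrm{mp}(j)}(x,\cdot)\in\Sigma(\beta,L)$, such that, with $\mathcal O_j=\mathbb R^{|\mathrm{mp}(j)|}\setminus\mathcal Z^{\mathrm{mp}(j)}$, $\check I_{\mathrm{mp}(j)}:=\int_{\mathcal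 O_j}|\check p_{\mathrm{mp}(j)}|<\infty$ and $\check I_{j,\mathrm{mp}(j)}:=\int_{\mathcal Z^j}\int_{\mathcal O_j}|\check p_{j,\mathrm{mp}(j)}(x,u)|\,du\,dx<\infty$. **Quantities.** Let $B_j=|\mathcal Z^j|$ (Lebesgue measure), $\epsilon_{K^j}(H_j)=|\det H_j|\inf_{x,x'\in\mathcal Z^{\mathrm{mp}(j)}}K_H^j(x-x')$ (which is positive), $\phi_{K^j,H_j}=\sup_{x\in\mathcal Z^{\mathrm{mp}(j)},\,x'\in\mathcal O_j}|K^j_H(x-x')|$ (zero if $\mathrm{mp}(j)=\emptyset$), and $$C_{\beta,L}(K^j)=L\int_0^1(1-t)^{k-1}t^{\beta-k}dt\ \sum_{|\alpha|=k}\frac{\|\alpha\|^k}{\alpha!\,k^{k-1}}\ \int|K^j(u)|\,\|u\|^\beta du .$$ Define, with $\|H_j\|_{\rm op}=\max_{k\in\mathrm{mp}(j)}h^k$ (zero if $\mathrm{mp}(j)=\emptyset$), $$C_H=B_\ell\sum_{j=1}^D\frac1{\epsilon_{\mathrm{mp}(j)}}\Big(B_j+\frac{B_K}{\epsilon_{K^j}(H_j)}\Big)C_{\beta,L}(K^j)\|H_j\|_{\rm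 op}^\beta,\qquad C_p=B_\ell\sum_{j=1}^D\frac{\phi_{K^j,H_j}}{\epsilon_{\mathrm{mp}(j)}}\Big(\check I_{j,\mathrm{mp}(j)}+\frac{B_K}{\epsilon_{K^j}(H_j)}\check I_{\mathrm{mp}(j)}\Big),$$ $$C_K=\max_{j}\max\Big\{\frac1{\epsilon_{K^j}(H_j)},\frac{B_K}{\epsilon_{K^j}(H_j)^2}\Big\},\qquad R_{\mathcal F,K}=\sum_{j=1}^D|\det H_j|\,\mathfrak R_{n,p}(\mathcal L^j_{\mathcal F}\otimes\mathcal K_H^j),\qquad R_K=\sum_{j=1}^D|\det H_j|\,\mathfrak R_{n,p}(\mathcal K_H^j).$$ Here $\mathfrak R_{n,p}(\mathcal A)=\mathbb E\,\mathbb E_\sigma\sup_{a\in\mathcal A}\big|\frac1n\sum_{i=1}^n\sigma_ia(X_i)\big|$ is the Rademacher complexity, with independent uniform signs $\sigma_i$ and with $X_i$ the sub-vector of $Z_i$ on which the class is defined; if the supremum is not measurable, the expectation over the sample is an outer expectation, taken for each fixed sign vector and then averaged over the signs. Further, $\mathcal K^j_H=\{K^j_H(z-\cdot):z\in\mathcal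 Z^{\mathrm{mp}(j)}\}$, $\mathcal A\otimes\mathcal B=\{(x,u)\mapsto a(x)b(u): a\in\mathcal A, b\in\mathcal B\}$, and $\mathcal L^j_{\mathcal F}=\{\ell_{f,j}(z^1,\dots,z^{j-1},\cdot):f\in\mathcal F,\ z^i\in\mathcal Z^i\}$ with $$\ell_{f,j}(z^1,\dots,z^j)=\int_{\mathcal Z^{j+1}\times\dots\times\mathcal Z^D}\ell(f,z)\prod_{k>j}p_{k|\mathrm{mp}(k)}(z^k|z^{\mathrm{mp}(k)})\,dz^{j+1}\cdots dz^D.$$ **Theorem.** For every $\delta\in(0,1)$, with probability at least $1-2D\delta$, every minimizer $\hat f$ of $\hat R_{\rm aug}$ over $\mathcal F$ and every minimizer $f^*$ of $R$ over $\mathcal F$ satisfy $$R(\hat f)-R(f^*)\le 2(C_H+C_p)+4C_K\big(R_{\mathcal F,K}+B_\ell R_K\big)+2D\,B_\ell B_K C_K\sqrt{\frac{\log(2/\delta)}{2n}} .$$ -/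

import Mathlib

open MeasureTheory ProbabilityTheory
open scoped ENNReal

noncomputable section

namespace ADMGAug

/-! ### Acyclic directed mixed graphs and Markov pillows -/

/-- An acyclic directed mixed graph: `dir u v` is the uni-directed edge `u → v`, and `bidir` is the
graph of the bi-directed edges. -/
structure ADMG (V : Type*) where
  dir : V → V → Prop
  bidir : SimpleGraph V
  acyclic : ∀ v, ¬ Relation.TransGen dir v v

namespace ADMG

/-- The subgraph composed of the vertices in `s`. -/
def induce {V : Type*} (G : ADMG V) (s : Set V) : ADMG s where
  dir u v := G.dir u v
  bidir := G.bidir.induce s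
  acyclic v hv := G.acyclic v (Relation.TransGen.lift Subtype.val (fun _ _ h => h) _ _ hv)

/-- The district of `v`: the vertices connected to `v` by a bi-directed path (including `v`). -/
def district {V : Type*} (G : ADMG V) (v : V) : Set V := {u | G.bidir.Reachable v u}

/-- The parents of a set of vertices. -/
def parents {V : Type*} (G : ADMG V) (A : Set V) : Set V := {u | ∃ v ∈ A, G.dir u v} \ A

/-- The order of the vertices is a topological order of the graph: there is no directed path from a
vertex to an earlier one. -/
def Concordant {V : Type*} [LinearOrder V] (G : ADMG V) : Prop :=
  ∀ i j : V, i < j → ¬ Relation.TransGen G.dir j i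

/-- The Markov pillow of `v`, as a set: the district of `v` and the parents of the district, without
`v`, all taken in the subgraph of the vertices that precede `v` (`v` included). -/
def pillowSet {V : Type*} [LinearOrder V] (G : ADMG V) (v : V) : Set V :=
  let Gv : ADMG (Set.Iic v) := G.induce (Set.Iic v)
  let v₀ : Set.Iic v := ⟨v, le_refl v⟩
  Subtype.val '' ((Gv.district v₀ ∪ Gv.parents (Gv.district v₀)) \ {v₀})

/-- The Markov pillow `mp(j)` of `j`. -/
def mp {D : ℕ} (G : ADMG (Fin D)) (j : Fin D) : Finset (Fin D) :=
  (Set.toFinite (G.pillowSet j)).toFinset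

end ADMG

/-! ### The data distribution -/

/-- The sub-product of the coordinate spaces with indices in `S`. -/
def box {D : ℕ} (Zsp : Fin D → Set ℝ) (S : Finset (Fin D)) : Set (S → ℝ) :=
  Set.univ.pi fun k : S => Zsp k

/-- The data space, the product of all coordinate spaces. -/
def space {D : ℕ} (Zsp : Fin D → Set ℝ) : Set (Fin D → ℝ) := Set.univ.pi Zsp

/-- The distribution on the data space with density `p`. -/
def law {D : ℕ} (Zsp : Fin D → Set ℝ) (p : (Fin D → ℝ) → ℝ) : Measure (Fin D → ℝ) :=
  (volume.restrict (space Zsp)).withDensity fun z => ENNReal.ofReal (p z)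

/-- Integrate the coordinates with indices in `S` over their coordinate spaces. The result is
a function of the other coordinates only. -/
def integrateOut {D : ℕ} (Zsp : Fin D → Set ℝ) (S : Finset (Fin D)) (f : (Fin D → ℝ) → ℝ)
    (z : Fin D → ℝ) : ℝ :=
  ∫ u : S → ℝ, f (Function.updateFinset z S u) ∂(Measure.pi fun k : S => volume.restrict (Zsp k))

/-- The marginal density of the sub-vector with indices in `S` (it depends on `z` only through the
coordinates in `S`). -/
def marginal {D : ℕ} (Zsp : Fin D → Set ℝ) (p : (Fin D → ℝ) → ℝ) (S : Finset (Fin D))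
    (z : Fin D → ℝ) : ℝ :=
  integrateOut Zsp Sᶜ p z

/-- The conditional density of coordinate `j` given the coordinates in its Markov pillow. -/
def condDensity {D : ℕ} (G : ADMG (Fin D)) (Zsp : Fin D → Set ℝ) (p : (Fin D → ℝ) → ℝ)
    (j : Fin D) (z : Fin D → ℝ) : ℝ :=
  marginal Zsp p (insert j (G.mp j)) z / marginal Zsp p (G.mp j) z

/-- The topological ADMG factorization of the density `p`. -/
def Factorizes {D : ℕ} (G : ADMG (Fin D)) (Zsp : Fin D → Set ℝ) (p : (Fin D → ℝ) → ℝ) : Prop :=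
  ∀ᵐ z ∂(volume.restrict (space Zsp)), p z = ∏ j, condDensity G Zsp p j z

/-! ### The augmented empirical risk -/

/-- The diagonal bandwidth matrix with the entries of `h` indexed by `S`. -/
def bandwidth {D : ℕ} (h : Fin D → ℝ) (S : Finset (Fin D)) : Matrix S S ℝ :=
  Matrix.diagonal fun k : S => h k

/-- The scaled kernel `K_H(u) = |det H|⁻¹ K(H⁻¹ u)`. -/
def scaledKernel {D : ℕ} (h : Fin D → ℝ) (S : Finset (Fin D)) (K : (S → ℝ) → ℝ) (u : S → ℝ) : ℝ :=
  |(bandwidth h S).det|⁻¹ * K (Matrix.mulVec (bandwidth h S)⁻¹ u)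

/-- The weight that the conditional resampling of coordinate `j` gives to the `i`-th data point (zero
if the denominator is zero). -/
def weight {D n : ℕ} (G : ADMG (Fin D)) (K : (j : Fin D) → (G.mp j → ℝ) → ℝ) (h : Fin D → ℝ)
    (data : Fin n → Fin D → ℝ) (j : Fin D) (i : Fin n) (u : G.mp j → ℝ) : ℝ :=
  scaledKernel h (G.mp j) (K j) (u - (G.mp j).restrict (data i)) /
    ∑ k, scaledKernel h (G.mp j) (K j) (u - (G.mp j).restrict (data k))

/-- The augmented data point `(Z^1_{i_1}, …, Z^D_{i_D})`. -/
def augPoint {D n : ℕ} (data : Fin n → Fin D → ℝ) (i : Fin D → Fin n) : Fin D → ℝ :=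
  fun j => data (i j) j

/-- The augmented empirical risk. -/
def augRisk {D n : ℕ} {F : Type*} (G : ADMG (Fin D)) (K : (j : Fin D) → (G.mp j → ℝ) → ℝ)
    (h : Fin D → ℝ) (ℓ : F → (Fin D → ℝ) → ℝ) (data : Fin n → Fin D → ℝ) (f : F) : ℝ :=
  ∑ i : Fin D → Fin n,
    (∏ j, weight G K h data j (i j) ((G.mp j).restrict (augPoint data i))) * ℓ f (augPoint data i)

/-- The risk. -/
def risk {D : ℕ} {F : Type*} (Zsp : Fin D → Set ℝ) (p : (Fin D → ℝ) → ℝ)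
    (ℓ : F → (Fin D → ℝ) → ℝ) (f : F) : ℝ :=
  ∫ z, ℓ f z ∂(law Zsp p)

/-! ### Rademacher complexity -/

/-- The (outer) expectation of a nonnegative function. It is the usual expectation when the function
is measurable; for suprema over uncountable classes measurability is not automatic. -/
def outerExp {X : Type*} [MeasurableSpace X] (q : Measure X) (φ : X → ℝ≥0∞) : ℝ≥0∞ :=
  ⨅ (g : X → ℝ≥0∞) (_ : Measurable g) (_ : φ ≤ g), ∫⁻ x, g x ∂q

/-- The Rademacher complexity of the class `C` for samples of size `m` from `q`. The signs are uniform
on `{±1}^m`, so that their expectation is a finite average. -/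
def rademacher {X : Type*} [MeasurableSpace X] (m : ℕ) (q : Measure X) (C : Set (X → ℝ)) : ℝ :=
  (∑ σ : Fin m → ℤˣ,
    (outerExp (Measure.pi fun _ : Fin m => q) fun x =>
      ⨆ f ∈ C, ENNReal.ofReal |(1 / (m : ℝ)) * ∑ i, ((σ i : ℤ) : ℝ) * f (x i)|).toReal) / 2 ^ m

/-- The loss of `f` with the coordinates after `j` integrated out against their conditional
densities; it depends on `z` only through the coordinates up to `j`. -/
def margLoss {D : ℕ} {F : Type*} (G : ADMG (Fin D)) (Zsp : Fin D → Set ℝ) (p : (Fin D → ℝ) → ℝ)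
    (ℓ : F → (Fin D → ℝ) → ℝ) (j : Fin D) (f : F) : (Fin D → ℝ) → ℝ :=
  integrateOut Zsp (Finset.Ioi j) fun z => ℓ f z * ∏ k ∈ Finset.Ioi j, condDensity G Zsp p k z

/-- The class of the marginalized univariate loss functions. -/
def lossClass {D : ℕ} {F : Type*} (G : ADMG (Fin D)) (Zsp : Fin D → Set ℝ) (p : (Fin D → ℝ) → ℝ)
    (ℓ : F → (Fin D → ℝ) → ℝ) (j : Fin D) : Set (ℝ → ℝ) :=
  {g | ∃ (f : F) (z : Fin D → ℝ), (∀ k < j, z k ∈ Zsp k) ∧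
    g = fun x => margLoss G Zsp p ℓ j f (Function.update z j x)}

/-- The class of the shifted kernel functions. -/
def kernelClass {D : ℕ} (Zsp : Fin D → Set ℝ) (h : Fin D → ℝ) (S : Finset (Fin D))
    (K : (S → ℝ) → ℝ) : Set ((S → ℝ) → ℝ) :=
  {g | ∃ z ∈ box Zsp S, g = fun u => scaledKernel h S K (z - u)}

/-- The class of the products `(x, u) ↦ a x * b u`. -/
def tensor {X Y : Type*} (A : Set (X → ℝ)) (B : Set (Y → ℝ)) : Set (X × Y → ℝ) :=
  {g | ∃ a ∈ A, ∃ b ∈ B, g = fun w => a w.1 * b w.2}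

/-! ### Hölder classes and kernels of a given order -/

/-- The Euclidean norm. -/
def euclNorm {ι : Type*} [Fintype ι] (u : ι → ℝ) : ℝ := ‖(WithLp.toLp 2 u : EuclideanSpace ℝ ι)‖

/-- The `(β, L)`-Hölder class on the whole space. The partial derivatives of order `k = ⌊β⌋` are
listed by sequences of `k` coordinate directions: each multi-index of order `k` comes from such
a sequence, and the order of differentiation is immaterial. -/
def HolderClass {ι : Type*} [Fintype ι] [DecidableEq ι] (β L : ℝ) : Set ((ι → ℝ) → ℝ) :=
  {f | ContDiff ℝ (⌊β⌋₊ : ℕ) f ∧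
    ∀ (a : Fin ⌊β⌋₊ → ι) (x y : ι → ℝ),
      |iteratedFDeriv ℝ ⌊β⌋₊ f x (fun l => Pi.single (a l) 1) -
        iteratedFDeriv ℝ ⌊β⌋₊ f y (fun l => Pi.single (a l) 1)| ≤
      L * euclNorm (x - y) ^ (β - ⌊β⌋₊)}

/-- `K` is a kernel of order `k`. -/
def IsKernelOfOrder {ι : Type*} [Fintype ι] (k : ℕ) (K : (ι → ℝ) → ℝ) : Prop :=
  ∫ u, K u = 1 ∧
    ∀ α : ι → ℕ, 1 ≤ ∑ i, α i → ∑ i, α i ≤ k → ∫ u, K u * ∏ i, u i ^ α i = 0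

/-- The constant `C_{β,L}(K)`, where `α` runs over the multi-indices of order `k = ⌊β⌋`. -/
def holderConst {ι : Type*} [Fintype ι] [DecidableEq ι] (β L : ℝ) (K : (ι → ℝ) → ℝ) : ℝ :=
  L * (∫ t in (0 : ℝ)..1, (1 - t) ^ (⌊β⌋₊ - 1) * t ^ (β - ⌊β⌋₊)) *
    (∑ α ∈ Finset.piAntidiag (Finset.univ : Finset ι) ⌊β⌋₊,
      euclNorm (fun i => (α i : ℝ)) ^ ⌊β⌋₊ /
        ((∏ i, ((α i).factorial : ℝ)) * (⌊β⌋₊ : ℝ) ^ (⌊β⌋₊ - 1))) *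
    ∫ u, |K u| * euclNorm u ^ β

/-! ### The constants of the bound -/

/-- `B_ℓ`, the supremum of the loss. -/
def lossSup {D : ℕ} {F : Type*} (ℓ : F → (Fin D → ℝ) → ℝ) : ℝ :=
  ⨆ w : F × (Fin D → ℝ), |ℓ w.1 w.2|

/-- `B_K`, the maximum of the supremum norms of the kernels. -/
def kernelSup {D : ℕ} (G : ADMG (Fin D)) (K : (j : Fin D) → (G.mp j → ℝ) → ℝ) : ℝ :=
  ⨆ j, ⨆ u, |K j u|

/-- `ε_mp`, the infimum of the marginal density of the sub-vector with indices in `S`. -/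
def densityInf {D : ℕ} (Zsp : Fin D → Set ℝ) (p : (Fin D → ℝ) → ℝ) (S : Finset (Fin D)) : ℝ :=
  sInf (marginal Zsp p S '' space Zsp)

/-- `ε_K(H)`. -/
def kernelInf {D : ℕ} (Zsp : Fin D → Set ℝ) (h : Fin D → ℝ) (S : Finset (Fin D))
    (K : (S → ℝ) → ℝ) : ℝ :=
  |(bandwidth h S).det| *
    sInf {y | ∃ x ∈ box Zsp S, ∃ x' ∈ box Zsp S, y = scaledKernel h S K (x - x')}

/-- `φ_{K,H}`, the supremum of the scaled kernel between a point of the space and a point outside. -/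
def kernelTail {D : ℕ} (Zsp : Fin D → Set ℝ) (h : Fin D → ℝ) (S : Finset (Fin D))
    (K : (S → ℝ) → ℝ) : ℝ :=
  sSup {y | ∃ x ∈ box Zsp S, ∃ x' ∉ box Zsp S, y = |scaledKernel h S K (x - x')|}

/-- The operator norm of the bandwidth matrix. -/
def bandwidthNorm {D : ℕ} (h : Fin D → ℝ) (S : Finset (Fin D)) : ℝ :=
  ‖Matrix.toEuclideanCLM (𝕜 := ℝ) (bandwidth h S)‖

/-- `C_H`. -/
def biasH {D : ℕ} {F : Type*} (G : ADMG (Fin D)) (Zsp : Fin D → Set ℝ) (p : (Fin D → ℝ) → ℝ)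
    (ℓ : F → (Fin D → ℝ) → ℝ) (K : (j : Fin D) → (G.mp j → ℝ) → ℝ) (h : Fin D → ℝ) (β L : ℝ) : ℝ :=
  lossSup ℓ * ∑ j, 1 / densityInf Zsp p (G.mp j) *
    (volume.real (Zsp j) + kernelSup G K / kernelInf Zsp h (G.mp j) (K j)) *
    holderConst β L (K j) * bandwidthNorm h (G.mp j) ^ β

/-- `C_p`, where `pext j` and `qext j x` extend the marginal densities of the sub-vectors with indices
in `mp(j)` and in `{j} ∪ mp(j)`. -/
def biasP {D : ℕ} {F : Type*} (G : ADMG (Fin D)) (Zsp : Fin D → Set ℝ) (p : (Fin D → ℝ) → ℝ)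
    (ℓ : F → (Fin D → ℝ) → ℝ) (K : (j : Fin D) → (G.mp j → ℝ) → ℝ) (h : Fin D → ℝ)
    (pext : (j : Fin D) → (G.mp j → ℝ) → ℝ) (qext : (j : Fin D) → ℝ → (G.mp j → ℝ) → ℝ) : ℝ :=
  lossSup ℓ * ∑ j, kernelTail Zsp h (G.mp j) (K j) / densityInf Zsp p (G.mp j) *
    ((∫ x in Zsp j, ∫ u in (box Zsp (G.mp j))ᶜ, |qext j x u|) +
      kernelSup G K / kernelInf Zsp h (G.mp j) (K j) * ∫ u in (box Zsp (G.mp j))ᶜ, |pext j u|)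

/-- `C_K`. -/
def kernelConst {D : ℕ} (G : ADMG (Fin D)) (Zsp : Fin D → Set ℝ)
    (K : (j : Fin D) → (G.mp j → ℝ) → ℝ) (h : Fin D → ℝ) : ℝ :=
  ⨆ j, max (1 / kernelInf Zsp h (G.mp j) (K j))
    (kernelSup G K / kernelInf Zsp h (G.mp j) (K j) ^ 2)

/-- `R_{F,K}`, the complexity of the marginalized losses times the shifted kernels. -/
def lossComplexity {D : ℕ} {F : Type*} (n : ℕ) (G : ADMG (Fin D)) (Zsp : Fin D → Set ℝ)
    (p : (Fin D → ℝ) → ℝ) (ℓ : F → (Fin D → ℝ) → ℝ) (K : (j : Fin D) → (G.mp j → ℝ) → ℝ)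
    (h : Fin D → ℝ) : ℝ :=
  ∑ j, |(bandwidth h (G.mp j)).det| *
    rademacher n ((law Zsp p).map fun z => (z j, (G.mp j).restrict z))
      (tensor (lossClass G Zsp p ℓ j) (kernelClass Zsp h (G.mp j) (K j)))

/-- `R_K`, the complexity of the shifted kernels. -/
def kernelComplexity {D : ℕ} (n : ℕ) (G : ADMG (Fin D)) (Zsp : Fin D → Set ℝ)
    (p : (Fin D → ℝ) → ℝ) (K : (j : Fin D) → (G.mp j → ℝ) → ℝ) (h : Fin D → ℝ) : ℝ :=
  ∑ j, |(bandwidth h (G.mp j)).det| *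
    rademacher n ((law Zsp p).map (G.mp j).restrict) (kernelClass Zsp h (G.mp j) (K j))

end ADMGAug

end

open ADMGAug

namespace ADMGAug

/-! ### Outer expectations -/

/-! The excess risk of a minimizer of the augmented risk is at most twice sup_f |R̂_aug(f) - R(f)|,
so a uniform bound on that difference suffices.

Both risks arise by filling the coordinates one at a time. Every vertex of mp(j) precedes j, so the
weight of coordinate j depends only on earlier indices, and R̂_aug(f) is the mean of the loss when
i_1, ..., i_D are drawn in turn. By the factorization of p, R(f) is the same iterated mean with the
true conditional densities. Let ψ_m be the loss with the coordinates from m on integrated out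
(`tailLoss`), so that ψ_0 = R(f) and ψ_D = ℓ(f, ·). Exchanging the true conditional for the weights
one coordinate at a time telescopes R̂_aug - R into D one-step errors, averaged with probability
weights (`abs_weighted_sum_sub_le`, `abs_augRisk_sub_risk_le`). Each one-step error is that of a
kernel regression estimate of the conditional mean of ψ_{j+1}, needed uniformly in f and in the
point z.

That error is split at c = E[m k] / E[k], the ratio of smoothed population quantities, where m is
the regressed marginalized loss and k the kernel centred at z. The bias of c compares numerator and
denominator with their densities: a kernel of order ⌊β⌋ removes the Taylor polynomial of the Hölder
extension, and the extension outside the data space costs the tail of the kernel (`kernel_bias_on`,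
`abs_smoothed_condMean_sub_le`). The stochastic part is the empirical mean of (m - c) k over that of
k. The numerator is centred, and the denominator has a deterministic lower bound since k is positive
on a compact set. One empirical process per coordinate therefore suffices
(`exists_condMean_deviation`), controlled by symmetrization and McDiarmid's inequality.

Suprema over uncountable classes need not be measurable, so these two tools are proved for outer
expectations. Symmetrization works for each fixed sign vector by swapping with a ghost sample
(`outerExp_devSup_le`). McDiarmid's inequality is applied to a measurable majorant that has been
made to have bounded differences without raising its mean (`exists_boundedDiff_majorant`). -/

theorem outerExp_le {X : Type*} [MeasurableSpace X] (q : Measure X) {φ g : X → ℝ≥0∞}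
    (hg : Measurable g) (h : φ ≤ g) : outerExp q φ ≤ ∫⁻ x, g x ∂q :=
  iInf_le_of_le g (iInf₂_le hg h)

/-- The infimum is attained: the pointwise infimum of a minimizing sequence of majorants is still
measurable, because the sequence is countable. -/
theorem exists_measurable_majorant {X : Type*} [MeasurableSpace X] (q : Measure X)
    (φ : X → ℝ≥0∞) : ∃ g : X → ℝ≥0∞, Measurable g ∧ φ ≤ g ∧ ∫⁻ x, g x ∂q = outerExp q φ := by
  have hne : {a : ℝ≥0∞ | ∃ g : X → ℝ≥0∞, Measurable g ∧ φ ≤ g ∧ ∫⁻ x, g x ∂q = a}.Nonempty :=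
    ⟨_, fun _ => ⊤, measurable_const, fun _ => le_top, rfl⟩
  obtain ⟨u, -, hu, hmem⟩ := exists_seq_tendsto_sInf hne (OrderBot.bddBelow _)
  choose g hg hφ hint using hmem
  have hmeas : Measurable fun x => ⨅ m, g m x := Measurable.iInf hg
  have hle : φ ≤ fun x => ⨅ m, g m x := fun x => le_iInf fun m => hφ m x
  refine ⟨_, hmeas, hle, le_antisymm ?_ (outerExp_le q hmeas hle)⟩
  have h1 : ∫⁻ x, ⨅ m, g m x ∂q ≤
      sInf {a : ℝ≥0∞ | ∃ g : X → ℝ≥0∞, Measurable g ∧ φ ≤ g ∧ ∫⁻ x, g x ∂q = a} :=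
    ge_of_tendsto' hu fun m => (hint m).symm ▸ lintegral_mono fun x => iInf_le _ m
  exact h1.trans (le_iInf fun g' => le_iInf₂ fun hg' hφ' => sInf_le ⟨g', hg', hφ', rfl⟩)

theorem outerExp_mono_ae {X : Type*} [MeasurableSpace X] (q : Measure X) {φ ψ : X → ℝ≥0∞}
    (h : ∀ᵐ x ∂q, φ x ≤ ψ x) : outerExp q φ ≤ outerExp q ψ := by
  obtain ⟨g, hg, hψ, hint⟩ := exists_measurable_majorant q ψ
  obtain ⟨s, hs, hsm, hs0⟩ := exists_measurable_superset_of_null h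
  rw [← hint]
  classical
  -- On a measurable null set containing the exceptional points the majorant is raised to `⊤`, which
  -- leaves its integral unchanged.
  have h1 : Measurable (s.piecewise (fun _ => ⊤) g) := measurable_const.piecewise hsm hg
  refine (outerExp_le q h1 fun x => ?_).trans (lintegral_congr_ae ?_).le
  · by_cases hx : x ∈ s
    · simp [hx]
    · simp only [hx, not_false_eq_true, Set.piecewise_eq_of_notMem]
      have : φ x ≤ ψ x := by
        by_contra hc
        exact hx (hs hc)
      exact this.trans (hψ x)
  · filter_upwards [compl_mem_ae_iff.mpr hs0] with x hx
    exact Set.piecewise_eq_of_notMem _ _ _ hx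

theorem outerExp_add_le {X : Type*} [MeasurableSpace X] (q : Measure X) (φ ψ : X → ℝ≥0∞) :
    outerExp q (fun x => φ x + ψ x) ≤ outerExp q φ + outerExp q ψ := by
  obtain ⟨g, hg, hφ, hint⟩ := exists_measurable_majorant q φ
  obtain ⟨g', hg', hψ, hint'⟩ := exists_measurable_majorant q ψ
  rw [← hint, ← hint', ← lintegral_add_left hg]
  exact outerExp_le q (hg.add hg') fun x => add_le_add (hφ x) (hψ x)

theorem outerExp_const_mul_le {X : Type*} [MeasurableSpace X] (q : Measure X) (c : ℝ≥0∞)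
    (φ : X → ℝ≥0∞) : outerExp q (fun x => c * φ x) ≤ c * outerExp q φ := by
  obtain ⟨g, hg, hφ, hint⟩ := exists_measurable_majorant q φ
  rw [← hint, ← lintegral_const_mul c hg]
  exact outerExp_le q (hg.const_mul c) fun x => mul_le_mul_right (hφ x) c

/-- Majorants pull back along `π`. Only this inequality is available in general, since a majorant
upstairs need not factor through `π`. -/
theorem outerExp_comp_le {X Y : Type*} [MeasurableSpace X] [MeasurableSpace Y] {q : Measure X}
    {r : Measure Y} {π : X → Y} (hπ : MeasurePreserving π q r) (φ : Y → ℝ≥0∞) :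
    outerExp q (φ ∘ π) ≤ outerExp r φ := by
  obtain ⟨g, hg, hφ, hint⟩ := exists_measurable_majorant r φ
  rw [← hint, ← hπ.lintegral_comp hg]
  exact outerExp_le q (hg.comp hπ.measurable) fun x => hφ (π x)

/-! ### Bounded differences -/

/-- Replacing a function by its essential infimum over one coordinate wherever this lowers it by
more than `c`. -/
noncomputable def clampCoord {ι X : Type*} [DecidableEq ι] [MeasurableSpace X] (q : Measure X) (c : ℝ≥0∞)
    (i : ι) (g : (ι → X) → ℝ≥0∞) (x : ι → X) : ℝ≥0∞ :=
  max (essInf (fun y => g (Function.update x i y)) q)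
    (min (g x) (essInf (fun y => g (Function.update x i y)) q + c))

section clampCoord

variable {ι X : Type*} [DecidableEq ι] [MeasurableSpace X] {q : Measure X} {c : ℝ≥0∞}

/-- The essential infimum is used because a plain infimum over `y` need not be measurable. Its
superlevel sets are the points whose section of `{g < a}` is null, and the measure of a section is a
measurable function of the base point. -/
theorem measurable_essInf_update [SFinite q] (i : ι) {g : (ι → X) → ℝ≥0∞} (hg : Measurable g) :
    Measurable fun x : ι → X => essInf (fun y => g (Function.update x i y)) q := by
  refine measurable_of_Ici fun a => ?_
  have h : (fun x : ι → X => essInf (fun y => g (Function.update x i y)) q) ⁻¹' Set.Ici a =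
      {x | q (Prod.mk x ⁻¹' {w : (ι → X) × X | g (Function.update w.1 i w.2) < a}) = 0} := by
    ext x
    simp only [Set.mem_preimage, Set.mem_Ici, Set.mem_ofPred_eq]
    constructor
    · intro h
      have : ∀ᵐ y ∂q, a ≤ g (Function.update x i y) := by
        filter_upwards [ae_essInf_le (μ := q) (f := fun y => g (Function.update x i y))] with y hy
        exact h.trans hy
      simpa [ae_iff] using this
    · intro h
      refine le_essInf_of_ae_le a ?_
      simpa [Filter.EventuallyLE, ae_iff] using h
  rw [h]
  have hm : MeasurableSet {w : (ι → X) × X | g (Function.update w.1 i w.2) < a} :=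
    (hg.comp measurable_update') measurableSet_Iio
  exact (measurable_measure_prodMk_left hm) (measurableSet_singleton 0)

theorem measurable_clampCoord [SFinite q] (i : ι) {g : (ι → X) → ℝ≥0∞} (hg : Measurable g) :
    Measurable (clampCoord q c i g) :=
  (measurable_essInf_update i hg).max (hg.min ((measurable_essInf_update i hg).add_const c))

/-- Bounded differences of `φ` give `φ x ≤ g (update x i y) + c` for every `y`, hence `φ x` is below
the essential infimum plus `c`, and the clamping does not cut below `φ`. -/
theorem le_clampCoord (i : ι) {φ g : (ι → X) → ℝ≥0∞} (h : φ ≤ g)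
    (hφ : ∀ x y, φ x ≤ φ (Function.update x i y) + c) : φ ≤ clampCoord q c i g := by
  intro x
  refine le_max_of_le_right (le_min (h x) ?_)
  rw [← tsub_le_iff_right]
  refine le_essInf_of_ae_le _ (.of_forall fun y => ?_)
  rw [tsub_le_iff_right]
  exact (hφ x y).trans (by gcongr; exact h _)

/-- The values lie in `[e, e + c]`, where the essential infimum `e` does not see coordinate `i`. -/
theorem clampCoord_le_self_coord (i : ι) (g : (ι → X) → ℝ≥0∞) (x : ι → X) (y : X) :
    clampCoord q c i g x ≤ clampCoord q c i g (Function.update x i y) + c := by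
  have h1 : clampCoord q c i g x ≤ essInf (fun y => g (Function.update x i y)) q + c :=
    max_le le_self_add (min_le_right _ _)
  refine h1.trans (add_le_add_left ?_ c)
  refine le_max_of_le_left (le_of_eq ?_)
  simp

/-- Essential infima, minima and maxima are monotone and commute with adding `c`, so clamping one
coordinate preserves the bounded differences already obtained in the others. This allows the
coordinates to be treated one after another. -/
theorem clampCoord_le_other_coord {i i' : ι} (hi : i ≠ i') {g : (ι → X) → ℝ≥0∞}
    (hg : ∀ x y, g x ≤ g (Function.update x i' y) + c) (x : ι → X) (y : X) :
    clampCoord q c i g x ≤ clampCoord q c i g (Function.update x i' y) + c := by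
  have h1 : essInf (fun z => g (Function.update x i z)) q ≤
      essInf (fun z => g (Function.update (Function.update x i' y) i z)) q + c := by
    rw [← tsub_le_iff_right]
    refine le_essInf_of_ae_le _ ?_
    filter_upwards [ae_essInf_le (μ := q) (f := fun z => g (Function.update x i z))] with z hz
    rw [tsub_le_iff_right]
    refine hz.trans ((hg _ y).trans (le_of_eq ?_))
    rw [Function.update_comm hi]
  unfold clampCoord
  rw [max_add, min_add]
  exact max_le_max h1 (min_le_min (hg x y) (by gcongr))

/-- Along coordinate `i`, almost every value of `g` is at least its essential infimum, and there the
clamped function is at most `g`. Integrating this coordinate first gives the claim. -/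
theorem lintegral_clampCoord_le [Fintype ι] [SigmaFinite q] (i : ι) {g : (ι → X) → ℝ≥0∞}
    (hg : Measurable g) :
    ∫⁻ x, clampCoord q c i g x ∂(Measure.pi fun _ => q) ≤ ∫⁻ x, g x ∂(Measure.pi fun _ => q) := by
  refine lintegral_le_of_lmarginal_le {i} (measurable_clampCoord i hg) hg fun x => ?_
  rw [lmarginal_singleton, lmarginal_singleton]
  refine lintegral_mono_ae ?_
  filter_upwards [ae_essInf_le (μ := q) (f := fun z => g (Function.update x i z))] with z hz
  refine max_le ?_ (min_le_left _ _)
  simpa using hz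

theorem clampCoord_le_bound (i : ι) [NeZero q] {g : (ι → X) → ℝ≥0∞} {b : ℝ≥0∞}
    (hb : ∀ x, g x ≤ b) (x : ι → X) : clampCoord q c i g x ≤ b := by
  refine max_le ?_ ((min_le_left _ _).trans (hb x))
  refine (essInf_mono_ae (.of_forall fun y => hb (Function.update x i y))).trans (le_of_eq ?_)
  exact essInf_const' b

end clampCoord

/-- A function with bounded differences has a measurable majorant with bounded differences that is
no larger on average than a given measurable majorant. -/
theorem exists_boundedDiff_majorant {ι X : Type*} [Fintype ι] [DecidableEq ι] [MeasurableSpace X]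
    (q : Measure X) [IsProbabilityMeasure q] {c b : ℝ≥0∞} {φ g₀ : (ι → X) → ℝ≥0∞}
    (hφ : ∀ i x y, φ x ≤ φ (Function.update x i y) + c) (hg₀ : Measurable g₀) (hle : φ ≤ g₀)
    (hb : ∀ x, g₀ x ≤ b) :
    ∃ g : (ι → X) → ℝ≥0∞, Measurable g ∧ φ ≤ g ∧ (∀ x, g x ≤ b) ∧
      ∫⁻ x, g x ∂(Measure.pi fun _ => q) ≤ ∫⁻ x, g₀ x ∂(Measure.pi fun _ => q) ∧
      ∀ i x y, g x ≤ g (Function.update x i y) + c := by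
  suffices h : ∀ s : Finset ι, ∃ g : (ι → X) → ℝ≥0∞, Measurable g ∧ φ ≤ g ∧ (∀ x, g x ≤ b) ∧
      ∫⁻ x, g x ∂(Measure.pi fun _ => q) ≤ ∫⁻ x, g₀ x ∂(Measure.pi fun _ => q) ∧
      ∀ i ∈ s, ∀ x y, g x ≤ g (Function.update x i y) + c by
    simpa using h Finset.univ
  intro s
  induction s using Finset.induction with
  | empty => exact ⟨g₀, hg₀, hle, hb, le_rfl, by simp⟩
  | insert i s hi ih =>
    obtain ⟨g, h1, h2, h3, h4, h5⟩ := ih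
    refine ⟨clampCoord q c i g, measurable_clampCoord i h1, le_clampCoord i h2 (hφ i),
      clampCoord_le_bound i h3, (lintegral_clampCoord_le i h1).trans h4, fun i' hi' x y => ?_⟩
    rcases eq_or_ne i i' with rfl | hne
    · exact clampCoord_le_self_coord i g x y
    · exact clampCoord_le_other_coord hne
        (h5 i' ((Finset.mem_insert.mp hi').resolve_left hne.symm)) x y

theorem integrable_of_measurable_of_abs_le {X : Type*} [MeasurableSpace X] {q : Measure X}
    [IsFiniteMeasure q] {g : X → ℝ} (hg : Measurable g) {b : ℝ} (hb : ∀ x, |g x| ≤ b) :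
    Integrable g q :=
  .of_bound hg.aestronglyMeasurable b (.of_forall hb)

/-- Hoeffding's lemma: the oscillation bound places `g` in an interval of length `c` starting at its
infimum. -/
theorem mgf_le_of_mem_interval {X : Type*} [MeasurableSpace X] {q : Measure X}
    [IsProbabilityMeasure q] {g : X → ℝ} (hg : Measurable g) {b c : ℝ} (hb : ∀ x, |g x| ≤ b)
    (hc : ∀ x y, g x ≤ g y + c) (s : ℝ) :
    ∫ x, Real.exp (s * g x) ∂q ≤ Real.exp (s * ∫ x, g x ∂q + c ^ 2 * s ^ 2 / 8) := by
  have hne : Nonempty X := q.nonempty_of_neZero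
  have hbdd : BddBelow (Set.range g) := ⟨-b, by rintro _ ⟨x, rfl⟩; exact (abs_le.mp (hb x)).1⟩
  have hmem : ∀ x, g x ∈ Set.Icc (⨅ y, g y) ((⨅ y, g y) + c) := fun x =>
    ⟨ciInf_le hbdd x, by
      rw [← sub_le_iff_le_add]; exact le_ciInf fun y => by linarith [hc x y]⟩
  have h := (hasSubgaussianMGF_of_mem_Icc (μ := q) hg.aemeasurable (.of_forall hmem)).mgf_le s
  have h1 : mgf (fun ω => g ω - ∫ x, g x ∂q) q s =
      Real.exp (-(s * ∫ x, g x ∂q)) * ∫ x, Real.exp (s * g x) ∂q := by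
    rw [mgf, ← integral_const_mul (Real.exp (-(s * ∫ x, g x ∂q)))]
    refine integral_congr_ae (.of_forall fun x => ?_)
    beta_reduce
    rw [← Real.exp_add, mul_sub, sub_eq_add_neg, add_comm]
  rw [h1] at h
  have h2 : Real.exp (s * ∫ x, g x ∂q + c ^ 2 * s ^ 2 / 8) =
      Real.exp (s * ∫ x, g x ∂q) *
        Real.exp (((‖(⨅ y, g y) + c - ⨅ y, g y‖₊ / 2) ^ 2 : NNReal) * s ^ 2 / 2) := by
    rw [← Real.exp_add]
    congr 2
    push_cast
    simp only [add_sub_cancel_left, Real.norm_eq_abs, div_pow, sq_abs]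
    ring
  rw [h2, ← inv_mul_le_iff₀ (Real.exp_pos _), ← Real.exp_neg]
  exact h

/-- Tensorization by induction on the number of coordinates. With the first coordinate fixed, the
inductive hypothesis bounds the exponential moment in the remaining ones around their partial mean
`G`. Since `G` inherits the difference bound `c`, Hoeffding's lemma handles the first coordinate. -/
theorem mgf_pi_le_of_boundedDiff {X : Type*} [MeasurableSpace X] (q : Measure X)
    [IsProbabilityMeasure q] {c : ℝ} (s : ℝ) :
    ∀ {n : ℕ} {g : (Fin n → X) → ℝ}, Measurable g → ∀ {b : ℝ}, (∀ x, |g x| ≤ b) →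
      (∀ i x y, g x ≤ g (Function.update x i y) + c) →
      ∫ x, Real.exp (s * g x) ∂(Measure.pi fun _ => q) ≤
        Real.exp (s * (∫ x, g x ∂(Measure.pi fun _ => q)) + n * c ^ 2 * s ^ 2 / 8) := by
  intro n
  induction n with
  | zero =>
    intro g _ b _ _
    simp [integral_unique]
  | succ n ih =>
    intro g hg b hb hc
    have hmp := (measurePreserving_piFinSuccAbove (fun _ : Fin (n + 1) => q) 0).symm
    have hcons : Measurable fun w : X × (Fin n → X) => (Fin.cons w.1 w.2 : Fin (n + 1) → X) := by
      refine measurable_pi_iff.mpr fun i => ?_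
      refine Fin.cases ?_ (fun i => ?_) i
      · exact measurable_fst
      · exact (measurable_pi_apply i).comp measurable_snd
    have htr : ∀ F : (Fin (n + 1) → X) → ℝ,
        ∫ x, F x ∂(Measure.pi fun _ => q) =
          ∫ w : X × (Fin n → X), F (Fin.cons w.1 w.2) ∂(q.prod (Measure.pi fun _ => q)) := by
      intro F
      rw [← hmp.integral_comp']
      refine integral_congr_ae (.of_forall fun w => ?_)
      exact congrArg F (Fin.insertNth_zero' _ _)
    have hint : ∀ F : X × (Fin n → X) → ℝ, Measurable F → (∃ b, ∀ w, |F w| ≤ b) →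
        Integrable F (q.prod (Measure.pi fun _ => q)) := fun F hF ⟨b, hb⟩ =>
      integrable_of_measurable_of_abs_le hF hb
    have hgc := hg.comp hcons
    have hexpb : ∀ x, |Real.exp (s * g x)| ≤ Real.exp (|s| * b) := fun x => by
      rw [abs_of_pos (Real.exp_pos _)]
      refine Real.exp_le_exp.mpr ((le_abs_self _).trans ?_)
      rw [abs_mul]
      exact mul_le_mul_of_nonneg_left (hb x) (abs_nonneg s)
    have hi1 := hint (fun w => g (Fin.cons w.1 w.2)) hgc ⟨b, fun w => hb _⟩
    have hi2 := hint (fun w => Real.exp (s * g (Fin.cons w.1 w.2)))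
      ((hgc.const_mul s).exp) ⟨_, fun w => hexpb _⟩
    rw [htr, htr, integral_prod _ hi1, integral_prod _ hi2]
    set G : X → ℝ := fun x₀ => ∫ x', g (Fin.cons x₀ x') ∂(Measure.pi fun _ : Fin n => q) with hG
    have hGm : Measurable G :=
      (StronglyMeasurable.integral_prod_right' (f := fun w : X × (Fin n → X) =>
        g (Fin.cons w.1 w.2)) hgc.stronglyMeasurable).measurable
    have hsec : ∀ x₀ : X, Measurable fun x' : Fin n → X => g (Fin.cons x₀ x') := fun x₀ =>
      hgc.comp measurable_prodMk_left
    have hseci : ∀ x₀ : X, Integrable (fun x' : Fin n → X => g (Fin.cons x₀ x'))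
        (Measure.pi fun _ : Fin n => q) := fun x₀ =>
      integrable_of_measurable_of_abs_le (hsec x₀) (b := b) fun x' => hb _
    have hGb : ∀ x, |G x| ≤ b := fun x₀ => by
      rw [← Real.norm_eq_abs]
      refine (norm_integral_le_of_norm_le_const (C := b) (.of_forall fun x' => ?_)).trans ?_
      · exact hb _
      simp
    have hGc : ∀ x y, G x ≤ G y + c := fun x y => by
      have : G y + c = ∫ x', (g (Fin.cons y x') + c) ∂(Measure.pi fun _ : Fin n => q) := by
        rw [integral_add (hseci y) (integrable_const c)]
        simp [hG]
      rw [this]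
      refine integral_mono (hseci x) ((hseci y).add (integrable_const c)) fun x' => ?_
      have := hc 0 (Fin.cons x x') y
      rwa [Fin.update_cons_zero] at this
    have hstep : ∀ x₀, ∫ x', Real.exp (s * g (Fin.cons x₀ x')) ∂(Measure.pi fun _ : Fin n => q) ≤
        Real.exp (s * G x₀) * Real.exp (n * c ^ 2 * s ^ 2 / 8) := fun x₀ => by
      rw [← Real.exp_add]
      refine ih (hsec x₀) (fun x' => hb _) fun i x' y => ?_
      have := hc i.succ (Fin.cons x₀ x') y
      rwa [← Fin.cons_update] at this
    have hGexp : Integrable (fun x => Real.exp (s * G x)) q := by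
      refine integrable_of_measurable_of_abs_le ((hGm.const_mul s).exp) (b := Real.exp (|s| * b))
        fun x => ?_
      rw [abs_of_pos (Real.exp_pos _)]
      refine Real.exp_le_exp.mpr ((le_abs_self _).trans ?_)
      rw [abs_mul]
      exact mul_le_mul_of_nonneg_left (hGb x) (abs_nonneg s)
    calc _ ≤ ∫ x, Real.exp (s * G x) * Real.exp (n * c ^ 2 * s ^ 2 / 8) ∂q :=
          integral_mono hi2.integral_prod_left (hGexp.mul_const _) hstep
      _ = (∫ x, Real.exp (s * G x) ∂q) * Real.exp (n * c ^ 2 * s ^ 2 / 8) := integral_mul_const _ _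
      _ ≤ Real.exp (s * (∫ x, G x ∂q) + c ^ 2 * s ^ 2 / 8) * Real.exp (n * c ^ 2 * s ^ 2 / 8) :=
          mul_le_mul_of_nonneg_right (mgf_le_of_mem_interval hGm hGb hGc s) (Real.exp_pos _).le
      _ = _ := by
          rw [← Real.exp_add]
          congr 1
          push_cast
          ring

/-- McDiarmid's inequality for equal bounds of the differences. -/
theorem measureReal_ge_le_of_boundedDiff {X : Type*} [MeasurableSpace X] (q : Measure X)
    [IsProbabilityMeasure q] {n : ℕ} {g : (Fin n → X) → ℝ} (hg : Measurable g) {b c : ℝ}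
    (hb : ∀ x, |g x| ≤ b) (hc : ∀ i x y, g x ≤ g (Function.update x i y) + c) {t : ℝ}
    (ht : 0 ≤ t) :
    (Measure.pi fun _ : Fin n => q).real {x | t ≤ g x - ∫ y, g y ∂(Measure.pi fun _ => q)} ≤
      Real.exp (-(2 * t ^ 2) / (n * c ^ 2)) := by
  -- The exponent `n c² s² / 8` is `v s² / 2` with variance proxy `v = n c² / 4`.
  have hsub : HasSubgaussianMGF (fun x => g x - ∫ y, g y ∂(Measure.pi fun _ => q))
      (n * c ^ 2 / 4 : ℝ).toNNReal (Measure.pi fun _ : Fin n => q) := by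
    constructor
    · intro s
      refine integrable_of_measurable_of_abs_le (((hg.sub_const _).const_mul s).exp)
        (b := Real.exp (|s| * (b + b))) fun x => ?_
      rw [abs_of_pos (Real.exp_pos _)]
      refine Real.exp_le_exp.mpr ((le_abs_self _).trans ?_)
      rw [abs_mul]
      refine mul_le_mul_of_nonneg_left ((abs_sub _ _).trans (add_le_add (hb x) ?_)) (abs_nonneg s)
      rw [← Real.norm_eq_abs]
      refine (norm_integral_le_of_norm_le_const (C := b)
        (.of_forall fun x => (Real.norm_eq_abs _).trans_le (hb x))).trans ?_
      simp
    · intro s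
      have h := mgf_pi_le_of_boundedDiff q s hg hb hc
      have h1 : mgf (fun x => g x - ∫ y, g y ∂(Measure.pi fun _ => q))
          (Measure.pi fun _ : Fin n => q) s =
          Real.exp (-(s * ∫ y, g y ∂(Measure.pi fun _ => q))) *
            ∫ x, Real.exp (s * g x) ∂(Measure.pi fun _ => q) := by
        rw [mgf, ← integral_const_mul
          (Real.exp (-(s * ∫ y, g y ∂(Measure.pi fun _ : Fin n => q))))]
        refine integral_congr_ae (.of_forall fun x => ?_)
        beta_reduce
        rw [← Real.exp_add, mul_sub, sub_eq_add_neg, add_comm]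
      rw [h1]
      refine (mul_le_mul_of_nonneg_left h (Real.exp_pos _).le).trans (le_of_eq ?_)
      rw [← Real.exp_add]
      congr 1
      rw [Real.coe_toNNReal _ (by positivity)]
      ring
  refine (hsub.measure_ge_le ht).trans (le_of_eq ?_)
  congr 1
  rw [Real.coe_toNNReal _ (by positivity)]
  -- If `n c² = 0`, division by zero makes the bound `exp 0 = 1`.
  rcases eq_or_ne (n * c ^ 2 : ℝ) 0 with h0 | h0
  · simp [h0]
  · field_simp
    ring

/-! ### Uniform deviations -/

section uniformDeviation

variable {X T : Type*} [MeasurableSpace X] {n : ℕ}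

/-- The supremum of the deviations of the empirical means from the expectations. -/
noncomputable def devSup (n : ℕ) (q : Measure X) (f : T → X → ℝ) (x : Fin n → X) : ℝ≥0∞ :=
  ⨆ t, ENNReal.ofReal |(1 / (n : ℝ)) * ∑ i, f t (x i) - ∫ y, f t y ∂q|

/-- The supremum of the empirical means with signs. -/
noncomputable def signSup (σ : Fin n → ℤˣ) (f : T → X → ℝ) (x : Fin n → X) : ℝ≥0∞ :=
  ⨆ t, ENNReal.ofReal |(1 / (n : ℝ)) * ∑ i, ((σ i : ℤ) : ℝ) * f t (x i)|

theorem measurePreserving_select {ι : Type*} [Fintype ι] (q : Measure X) [IsProbabilityMeasure q]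
    (P : ι → Prop) [DecidablePred P] :
    MeasurePreserving (fun w : (ι → X) × (ι → X) => fun i => if P i then w.1 i else w.2 i)
      ((Measure.pi fun _ => q).prod (Measure.pi fun _ => q)) (Measure.pi fun _ => q) := by
  have h1 := (measurePreserving_arrowProdEquivProdArrow X X ι (fun _ => q) (fun _ => q)).symm
  have h2 := measurePreserving_pi (fun _ : ι => q.prod q) (fun _ => q)
    (f := fun i w => if P i then w.1 else w.2) (fun i => by
      by_cases h : P i
      · simpa [h] using measurePreserving_fst
      · simpa [h] using measurePreserving_snd)
  exact h2.comp h1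

/-- Symmetrization without averaging over signs. For a ghost sample `y`, let `W` take `x i` where
the sign is `1` and `y i` elsewhere, and let `W'` take the opposite choices. Then the sum of `f (x
i) - f (y i)` is the signed sum at `W` minus the signed sum at `W'`, and both `W` and `W'` are again
samples from `q`. The bound thus holds for each `σ`. -/
theorem outerExp_devSup_le (hn : 0 < n) (q : Measure X) [IsProbabilityMeasure q] (f : T → X → ℝ)
    (hf : ∀ t, Integrable (f t) q) (σ : Fin n → ℤˣ) :
    outerExp (Measure.pi fun _ : Fin n => q) (devSup n q f) ≤
      2 * outerExp (Measure.pi fun _ : Fin n => q) (signSup σ f) := by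
  obtain ⟨h, hh, hle, hint⟩ := exists_measurable_majorant (Measure.pi fun _ : Fin n => q)
    (signSup σ f)
  have hp := measurePreserving_select (ι := Fin n) q (fun i => σ i = 1)
  have hm := measurePreserving_select (ι := Fin n) q (fun i => ¬ σ i = 1)
  set W : (Fin n → X) × (Fin n → X) → Fin n → X :=
    fun w i => if σ i = 1 then w.1 i else w.2 i
  set W' : (Fin n → X) × (Fin n → X) → Fin n → X :=
    fun w i => if ¬ σ i = 1 then w.1 i else w.2 i
  -- The measurable majorant of the deviations is the mean over the ghost sample of `h (W (x, y)) +
  -- h (W' (x, y))`.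
  have hG : Measurable fun x => ∫⁻ y, (h (W (x, y)) + h (W' (x, y))) ∂(Measure.pi fun _ => q) :=
    Measurable.lintegral_prod_right'
      (f := fun w => h (W w) + h (W' w)) ((hh.comp hp.measurable).add (hh.comp hm.measurable))
  refine (outerExp_le _ hG fun x => iSup_le fun t => ?_).trans (le_of_eq ?_)
  · have hfi : ∀ i : Fin n, Integrable (fun y : Fin n → X => f t (y i)) (Measure.pi fun _ => q) :=
      fun i => (measurePreserving_eval (fun _ : Fin n => q) i).integrable_comp_of_integrable (hf t)
    have hfe : ∀ i : Fin n, ∫ y : Fin n → X, f t (y i) ∂(Measure.pi fun _ => q) =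
        ∫ y, f t y ∂q := fun i => by
      have hmp := measurePreserving_eval (fun _ : Fin n => q) i
      have h0 : AEStronglyMeasurable (f t)
          (Measure.map (Function.eval i) (Measure.pi fun _ : Fin n => q)) := by
        rw [hmp.map_eq]
        exact (hf t).aestronglyMeasurable
      have h1 := integral_map hmp.measurable.aemeasurable h0
      rw [hmp.map_eq] at h1
      exact h1.symm
    have hexp : (1 / (n : ℝ)) * ∑ i, f t (x i) - ∫ y, f t y ∂q =
        ∫ y : Fin n → X, (1 / (n : ℝ)) * ∑ i, (f t (x i) - f t (y i)) ∂(Measure.pi fun _ => q) := by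
      rw [integral_const_mul, integral_finsetSum (f := fun i (y : Fin n → X) => f t (x i) - f t (y i))
        Finset.univ fun i _ => (integrable_const _).sub (hfi i)]
      have : ∀ i : Fin n, ∫ y : Fin n → X, (f t (x i) - f t (y i)) ∂(Measure.pi fun _ => q) =
          f t (x i) - ∫ y, f t y ∂q := fun i => by
        rw [integral_sub (integrable_const _) (hfi i), hfe]
        simp
      simp only [this, Finset.sum_sub_distrib, Finset.sum_const, Finset.card_univ, Fintype.card_fin,
        nsmul_eq_mul, mul_sub]
      have : (n : ℝ) ≠ 0 := by positivity
      field_simp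
    rw [hexp]
    refine (ENNReal.ofReal_le_ofReal (abs_integral_le_integral_abs)).trans ?_
    rw [ofReal_integral_eq_lintegral_ofReal]
    · refine lintegral_mono fun y => ?_
      have hsplit : (1 / (n : ℝ)) * ∑ i, (f t (x i) - f t (y i)) =
          (1 / (n : ℝ)) * ∑ i, ((σ i : ℤ) : ℝ) * f t (W (x, y) i) -
            (1 / (n : ℝ)) * ∑ i, ((σ i : ℤ) : ℝ) * f t (W' (x, y) i) := by
        rw [← mul_sub, ← Finset.sum_sub_distrib]
        congr 1
        refine Finset.sum_congr rfl fun i _ => ?_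
        rcases Int.units_eq_one_or (σ i) with hi | hi
        · simp [W, W', hi]
        · have : ¬ ((-1 : ℤˣ) = 1) := by decide
          simp [W, W', hi, this, neg_add_eq_sub]
      rw [hsplit]
      refine (ENNReal.ofReal_le_ofReal (abs_sub _ _)).trans ?_
      rw [ENNReal.ofReal_add (abs_nonneg _) (abs_nonneg _)]
      refine add_le_add ((le_iSup_of_le t le_rfl).trans (hle _))
        ((le_iSup_of_le t le_rfl).trans (hle _))
    · exact ((integrable_finsetSum _ fun i _ =>
        (integrable_const _).sub (hfi i)).const_mul _).abs
    · exact .of_forall fun _ => abs_nonneg _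
  · rw [← lintegral_prod (fun w => h (W w) + h (W' w))
      ((hh.comp hp.measurable).add (hh.comp hm.measurable)).aemeasurable,
      lintegral_add_left (f := fun w => h (W w)) (hh.comp hp.measurable), hp.lintegral_comp hh, hm.lintegral_comp hh,
      hint, two_mul]

/-- Replacing one sample point moves every empirical mean by at most `M / n`, uniformly in `t`, and
the supremum inherits this. -/
theorem devSup_le_update (hn : 0 < n) (q : Measure X) {f : T → X → ℝ} {α : T → ℝ} {M : ℝ}
    (hf : ∀ t x, f t x ∈ Set.Icc (α t) (α t + M)) (i : Fin n) (x : Fin n → X) (y : X) :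
    devSup n q f x ≤ devSup n q f (Function.update x i y) + ENNReal.ofReal (M / n) := by
  refine iSup_le fun t => ?_
  have hM : 0 ≤ M := by linarith [(hf t y).1, (hf t y).2]
  have hn' : (0 : ℝ) < n := by exact_mod_cast hn
  have hsum : ∑ k, f t (x k) - ∑ k, f t (Function.update x i y k) = f t (x i) - f t y := by
    rw [← Finset.sum_sub_distrib, Finset.sum_eq_single i]
    · simp
    · intro k _ hk
      simp [hk]
    · simp
  have h1 : |f t (x i) - f t y| ≤ M := by
    rw [abs_le]
    constructor <;> linarith [(hf t y).1, (hf t y).2, (hf t (x i)).1, (hf t (x i)).2]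
  have h2 : |(1 / (n : ℝ)) * ∑ k, f t (x k) - ∫ y, f t y ∂q| ≤
      |(1 / (n : ℝ)) * ∑ k, f t (Function.update x i y k) - ∫ y, f t y ∂q| + M / n := by
    have : (1 / (n : ℝ)) * ∑ k, f t (x k) - ∫ y, f t y ∂q =
        ((1 / (n : ℝ)) * ∑ k, f t (Function.update x i y k) - ∫ y, f t y ∂q) +
          (f t (x i) - f t y) / n := by
      rw [← hsum]; ring
    rw [this]
    refine (abs_add_le _ _).trans ?_
    gcongr
    rw [abs_div, abs_of_pos hn']
    gcongr
  refine (ENNReal.ofReal_le_ofReal h2).trans ?_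
  rw [ENNReal.ofReal_add (abs_nonneg _) (by positivity)]
  gcongr
  exact le_iSup_of_le t le_rfl

theorem abs_mean_sub_integral_le (hn : 0 < n) (q : Measure X) [IsProbabilityMeasure q]
    {g : X → ℝ} (hgm : Integrable g q) {a M : ℝ} (hg : ∀ x, g x ∈ Set.Icc a (a + M))
    (x : Fin n → X) : |(1 / (n : ℝ)) * ∑ i, g (x i) - ∫ y, g y ∂q| ≤ M := by
  have hn' : (0 : ℝ) < n := by exact_mod_cast hn
  have h1 : n * a ≤ ∑ i, g (x i) := by
    simpa using Finset.card_nsmul_le_sum Finset.univ (fun i => g (x i)) a fun i _ => (hg (x i)).1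
  have h2 : ∑ i, g (x i) ≤ n * (a + M) := by
    have := Finset.sum_le_card_nsmul Finset.univ (fun i => g (x i)) (a + M)
      fun i _ => (hg (x i)).2
    rwa [Finset.card_univ, Fintype.card_fin, nsmul_eq_mul] at this
  have h3 : a ≤ ∫ y, g y ∂q := by
    simpa using integral_mono (integrable_const a) hgm fun y => (hg y).1
  have h4 : ∫ y, g y ∂q ≤ a + M := by
    simpa using integral_mono hgm (integrable_const (a + M)) fun y => (hg y).2
  have h5 : a ≤ (1 / (n : ℝ)) * ∑ i, g (x i) := by
    rw [one_div, ← div_eq_inv_mul, le_div_iff₀ hn']; linarith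
  have h6 : (1 / (n : ℝ)) * ∑ i, g (x i) ≤ a + M := by
    rw [one_div, ← div_eq_inv_mul, div_le_iff₀ hn']; linarith
  rw [abs_le]
  constructor <;> linarith

/-- With high probability all deviations of a class with values in intervals of length `M` are
bounded by twice the Rademacher complexity and a deviation term. -/
theorem exists_uniform_deviation (hn : 0 < n) (q : Measure X) [IsProbabilityMeasure q]
    {f : T → X → ℝ} (hf : ∀ t, Measurable (f t)) {A : Set X} (hA : MeasurableSet A)
    (hqA : ∀ᵐ x ∂q, x ∈ A) {α : T → ℝ} {M : ℝ} (hM : 0 ≤ M)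
    (hfA : ∀ t, ∀ x ∈ A, f t x ∈ Set.Icc (α t) (α t + M)) {ρ : (Fin n → ℤˣ) → ℝ≥0∞}
    (hρ : ∀ σ, outerExp (Measure.pi fun _ : Fin n => q) (signSup σ f) ≤ ρ σ)
    (hρ' : ∀ σ, ρ σ ≠ ∞) {δ : ℝ} (hδ : 0 < δ) (hδ1 : δ < 1) :
    ∃ S : Set (Fin n → X), MeasurableSet S ∧ 1 - δ ≤ (Measure.pi fun _ : Fin n => q).real S ∧
      ∀ x ∈ S, (∀ i, x i ∈ A) → ∀ t, |(1 / (n : ℝ)) * ∑ i, f t (x i) - ∫ y, f t y ∂q| ≤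
        2 * ((∑ σ, (ρ σ).toReal) / 2 ^ n) + M * √(Real.log (1 / δ) / (2 * n)) := by
  classical
  have hn' : (0 : ℝ) < n := by exact_mod_cast hn
  set ν : Measure (Fin n → X) := Measure.pi fun _ : Fin n => q with hν
  -- Off `A` the functions are replaced by the constant `α t`. The range condition then holds
  -- everywhere, as bounded differences demand, while a null set is all that changes.
  set f' : T → X → ℝ := fun t => A.piecewise (f t) fun _ => α t with hf'
  have hf'm : ∀ t, Measurable (f' t) := fun t => (hf t).piecewise hA measurable_const
  have hf'I : ∀ t x, f' t x ∈ Set.Icc (α t) (α t + M) := fun t x => by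
    by_cases hx : x ∈ A
    · simpa [hf', hx] using hfA t x hx
    · simp [hf', hx, hM]
  have hf'i : ∀ t, Integrable (f' t) q := fun t =>
    Integrable.of_mem_Icc (α t) (α t + M) (hf'm t).aemeasurable (.of_forall (hf'I t))
  have hf'e : ∀ t, ∫ y, f' t y ∂q = ∫ y, f t y ∂q := fun t =>
    integral_congr_ae (hqA.mono fun x hx => by simp [hf', hx])
  have hνA : ∀ᵐ x ∂ν, ∀ i, x i ∈ A := by
    rw [ae_all_iff]
    exact fun i => (measurePreserving_eval (fun _ : Fin n => q) i).quasiMeasurePreserving.ae hqA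
  have hsign : ∀ σ : Fin n → ℤˣ, outerExp ν (signSup σ f') ≤ ρ σ := fun σ => by
    refine (outerExp_mono_ae ν ?_).trans (hρ σ)
    filter_upwards [hνA] with x hx
    refine le_of_eq ?_
    simp [signSup, hf', hx]
  have hdev : ∀ σ : Fin n → ℤˣ, outerExp ν (devSup n q f') ≤ 2 * ρ σ := fun σ =>
    (outerExp_devSup_le hn q f' hf'i σ).trans (mul_le_mul_right (hsign σ) 2)
  have hdevtop : outerExp ν (devSup n q f') ≠ ∞ :=
    ((hdev 1).trans_lt (ENNReal.mul_lt_top (by simp) (hρ' 1).lt_top)).ne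
  -- The symmetrization bound holds for each of the `2 ^ n` sign vectors, so it holds for their
  -- average, which is the form of the Rademacher complexity.
  have hdevreal : (outerExp ν (devSup n q f')).toReal ≤ 2 * ((∑ σ, (ρ σ).toReal) / 2 ^ n) := by
    have h1 : ∑ _σ : Fin n → ℤˣ, (outerExp ν (devSup n q f')).toReal ≤
        ∑ σ, 2 * (ρ σ).toReal := Finset.sum_le_sum fun σ _ => by
      have := ENNReal.toReal_mono (ENNReal.mul_ne_top (by simp) (hρ' σ)) (hdev σ)
      simpa using this
    have hcard : Fintype.card (Fin n → ℤˣ) = 2 ^ n := by simp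
    rw [Finset.sum_const, Finset.card_univ, hcard, ← Finset.mul_sum, nsmul_eq_mul] at h1
    push_cast at h1
    rw [← mul_div_assoc, le_div_iff₀ (by positivity)]
    linarith
  have hlog : 0 ≤ Real.log (1 / δ) := Real.log_nonneg (by rw [le_div_iff₀ hδ]; linarith)
  -- For `M = 0` the deviations vanish on `A`. This case is separate because the exponent in
  -- McDiarmid's inequality would divide by zero.
  rcases hM.eq_or_lt with rfl | hMpos
  · refine ⟨Set.univ, .univ, by simp [hδ.le], fun x _ hx t => ?_⟩
    have h1 := abs_mean_sub_integral_le hn q (hf'i t) (hf'I t) x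
    rw [hf'e t] at h1
    have h2 : ∀ i, f' t (x i) = f t (x i) := fun i => by simp [hf', hx i]
    simp only [h2] at h1
    refine h1.trans ?_
    positivity
  obtain ⟨g₀, hg₀, hle₀, hint₀⟩ := exists_measurable_majorant ν (devSup n q f')
  have hφb : ∀ x, devSup n q f' x ≤ ENNReal.ofReal M := fun x => iSup_le fun t =>
    ENNReal.ofReal_le_ofReal (abs_mean_sub_integral_le hn q (hf'i t) (hf'I t) x)
  -- The optimal majorant, truncated at `M`, is made to have bounded differences. Its mean does not
  -- increase, so it stays below the outer expectation.
  obtain ⟨g, hg, hle, hgb, hgint, hgd⟩ := exists_boundedDiff_majorant q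
    (c := ENNReal.ofReal (M / n)) (b := ENNReal.ofReal M) (φ := devSup n q f')
    (g₀ := fun x => min (g₀ x) (ENNReal.ofReal M)) (devSup_le_update hn q hf'I)
    (hg₀.min measurable_const) (fun x => le_min (hle₀ x) (hφb x)) (fun x => min_le_right _ _)
  have hgtop : ∀ x, g x ≠ ∞ := fun x => ((hgb x).trans_lt ENNReal.ofReal_lt_top).ne
  have hgr : ∀ x, |(g x).toReal| ≤ M := fun x => by
    rw [abs_of_nonneg ENNReal.toReal_nonneg]
    exact ENNReal.toReal_le_of_le_ofReal hM (hgb x)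
  have hgdr : ∀ i x y, (g x).toReal ≤ (g (Function.update x i y)).toReal + M / n := fun i x y => by
    have := ENNReal.toReal_mono (ENNReal.add_ne_top.mpr ⟨hgtop _, ENNReal.ofReal_ne_top⟩) (hgd i x y)
    rwa [ENNReal.toReal_add (hgtop _) ENNReal.ofReal_ne_top, ENNReal.toReal_ofReal (by positivity)]
      at this
  have hgI : ∫ x, (g x).toReal ∂ν ≤ (outerExp ν (devSup n q f')).toReal := by
    rw [integral_toReal hg.aemeasurable (.of_forall fun x => (hgtop x).lt_top), ← hint₀]
    refine ENNReal.toReal_mono (hint₀ ▸ hdevtop) (hgint.trans (lintegral_mono fun x => min_le_left _ _))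
  set τ : ℝ := M * √(Real.log (1 / δ) / (2 * n)) with hτ
  have hτ0 : 0 ≤ τ := by positivity
  have htail := measureReal_ge_le_of_boundedDiff q hg.ennreal_toReal hgr hgdr hτ0
  -- The deviation `τ` is the one that makes McDiarmid's tail equal to `δ`.
  have hexp : Real.exp (-(2 * τ ^ 2) / (n * (M / n) ^ 2)) = δ := by
    have : -(2 * τ ^ 2) / (n * (M / n) ^ 2) = Real.log δ := by
      rw [hτ, mul_pow, Real.sq_sqrt (by positivity), one_div, Real.log_inv]
      field_simp
    rw [this, Real.exp_log hδ]
  rw [hexp] at htail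
  have hSm : MeasurableSet {x | τ ≤ (g x).toReal - ∫ y, (g y).toReal ∂ν} :=
    measurableSet_le measurable_const (hg.ennreal_toReal.sub_const _)
  refine ⟨{x | τ ≤ (g x).toReal - ∫ y, (g y).toReal ∂ν}ᶜ, hSm.compl, ?_, fun x hx hxA t => ?_⟩
  · rw [probReal_compl_eq_one_sub hSm]
    linarith
  · have h1 : (g x).toReal - ∫ y, (g y).toReal ∂ν < τ := not_le.mp hx
    have h2 : |(1 / (n : ℝ)) * ∑ i, f' t (x i) - ∫ y, f' t y ∂q| ≤ (g x).toReal := by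
      rw [← ENNReal.ofReal_le_iff_le_toReal (hgtop x)]
      exact (le_iSup_of_le t le_rfl).trans (hle x)
    rw [hf'e t] at h2
    have h3 : ∀ i, f' t (x i) = f t (x i) := fun i => by simp [hf', hxA i]
    simp only [h3] at h2
    linarith

end uniformDeviation

/-! ### The Euclidean norm and monomials -/

section euclNorm

variable {ι : Type*} [Fintype ι]

theorem euclNorm_nonneg (u : ι → ℝ) : 0 ≤ euclNorm u := norm_nonneg _

theorem euclNorm_eq (u : ι → ℝ) : euclNorm u = √(∑ i, u i ^ 2) := by
  simp [euclNorm, EuclideanSpace.norm_eq]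

theorem euclNorm_smul (t : ℝ) (u : ι → ℝ) : euclNorm (t • u) = |t| * euclNorm u := by
  simp [euclNorm, WithLp.toLp_smul, norm_smul]

theorem euclNorm_neg (u : ι → ℝ) : euclNorm (-u) = euclNorm u := by
  simp [euclNorm_eq]

theorem abs_apply_le_euclNorm (u : ι → ℝ) (i : ι) : |u i| ≤ euclNorm u := by
  rw [euclNorm_eq]
  refine Real.abs_le_sqrt ?_
  exact Finset.single_le_sum (f := fun i => u i ^ 2) (fun i _ => sq_nonneg _) (Finset.mem_univ i)

/-- Weighted arithmetic-geometric mean inequality with weights `α i / k`, followed by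
Cauchy-Schwarz. -/
theorem prod_abs_pow_le {k : ℕ} (hk : 0 < k) (w : ι → ℝ) (α : ι → ℕ) (hα : ∑ i, α i = k) :
    ∏ i, |w i| ^ α i ≤ (euclNorm (fun i => (α i : ℝ)) * euclNorm w / k) ^ k := by
  have hk' : (0 : ℝ) < k := by exact_mod_cast hk
  have hsum : ∑ i, (α i : ℝ) = k := by exact_mod_cast hα
  have h1 := Real.geom_mean_le_arith_mean Finset.univ (fun i => (α i : ℝ)) (fun i => |w i|)
    (fun i _ => by positivity) (by rw [hsum]; exact hk') (fun i _ => abs_nonneg _)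
  simp only [Real.rpow_natCast, hsum] at h1
  have h2 : ∑ i, (α i : ℝ) * |w i| ≤ euclNorm (fun i => (α i : ℝ)) * euclNorm w := by
    have := Real.sum_mul_le_sqrt_mul_sqrt Finset.univ (fun i => (α i : ℝ)) (fun i => |w i|)
    simpa [euclNorm_eq] using this
  have h3 : 0 ≤ ∏ i, |w i| ^ α i := Finset.prod_nonneg fun i _ => by positivity
  calc ∏ i, |w i| ^ α i = ((∏ i, |w i| ^ α i) ^ ((k : ℝ)⁻¹)) ^ k :=
        (Real.rpow_inv_natCast_pow h3 hk.ne').symm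
    _ ≤ _ := by
        gcongr
        exact h1.trans (by gcongr)

/-- This is the source of the combinatorial factor in `holderConst`. The multinomial theorem gives
coefficients `k! / α!`, the monomials are bounded by `prod_abs_pow_le`, and `k! / k ^ k = (k - 1)! /
k ^ (k - 1)`. The remaining `(k - 1)!` cancels against the Taylor remainder. -/
theorem sum_abs_pow_le [DecidableEq ι] {k : ℕ} (hk : 0 < k) (w : ι → ℝ) :
    (∑ i, |w i|) ^ k ≤ (k - 1).factorial *
      (∑ α ∈ Finset.piAntidiag (Finset.univ : Finset ι) k,
        euclNorm (fun i => (α i : ℝ)) ^ k /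
          ((∏ i, ((α i).factorial : ℝ)) * (k : ℝ) ^ (k - 1))) * euclNorm w ^ k := by
  rw [Finset.sum_pow_eq_sum_piAntidiag, Finset.mul_sum, Finset.sum_mul]
  refine Finset.sum_le_sum fun α hα => ?_
  have hα' : ∑ i, α i = k := (Finset.mem_piAntidiag.mp hα).1
  have hk' : (0 : ℝ) < k := by exact_mod_cast hk
  have hspec : (∏ i, ((α i).factorial : ℝ)) * Nat.multinomial Finset.univ α = k.factorial := by
    have := Nat.multinomial_spec Finset.univ α
    rw [hα'] at this
    exact_mod_cast this
  have hpos : 0 < ∏ i, ((α i).factorial : ℝ) := Finset.prod_pos fun i _ => by positivity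
  have hfac : (k.factorial : ℝ) = k * (k - 1).factorial := by
    exact_mod_cast (Nat.mul_factorial_pred hk.ne').symm
  have hpow : (k : ℝ) ^ k = k ^ (k - 1) * k := by
    rw [← pow_succ, Nat.sub_add_cancel hk]
  have hm : (Nat.multinomial Finset.univ α : ℝ) = k.factorial / ∏ i, ((α i).factorial : ℝ) := by
    rw [eq_div_iff hpos.ne', mul_comm, hspec]
  refine (mul_le_mul_of_nonneg_left (prod_abs_pow_le hk w α hα') (by positivity)).trans
    (le_of_eq ?_)
  rw [hm, hfac, div_pow, mul_pow, hpow]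
  field_simp

end euclNorm

/-! ### Taylor expansion in Hölder classes -/

section taylor

variable {ι : Type*} [Fintype ι]

theorem iteratedDeriv_comp_line {E : Type*} [NormedAddCommGroup E] [NormedSpace ℝ E] {g : E → ℝ}
    {k : ℕ} (hg : ContDiff ℝ k g) (z w : E) {m : ℕ} (hm : m ≤ k) (t : ℝ) :
    iteratedDeriv m (fun t : ℝ => g (z + t • w)) t =
      iteratedFDeriv ℝ m g (z + t • w) fun _ => w := by
  have h1 : (fun t : ℝ => g (z + t • w)) =
      (fun y => g (z + y)) ∘ (ContinuousLinearMap.toSpanSingleton ℝ w) := by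
    ext t; simp
  have h2 : ContDiff ℝ k fun y => g (z + y) := hg.comp (contDiff_const.add contDiff_id)
  rw [iteratedDeriv_eq_iteratedFDeriv, h1,
    ContinuousLinearMap.iteratedFDeriv_comp_right _ h2 _ (by exact_mod_cast hm),
    iteratedFDeriv_comp_add_left]
  simp

/-- Taylor's formula of order `k - 1` along the segment, with integral remainder. Since `(1 - t) ^
(k - 1) / (k - 1)!` has integral `1 / k!` over `[0, 1]`, the term of order `k` can be moved under
the integral. What remains is a difference of `k`-th derivatives, the quantity a Hölder condition
controls. -/
theorem sub_taylor_eq_integral {E : Type*} [NormedAddCommGroup E] [NormedSpace ℝ E] {g : E → ℝ}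
    {k : ℕ} (hk : 0 < k) (hg : ContDiff ℝ k g) (z w : E) :
    g (z + w) - ∑ m ∈ Finset.range (k + 1),
        ((m.factorial : ℝ)⁻¹ * iteratedFDeriv ℝ m g z fun _ => w) =
      ∫ t in (0 : ℝ)..1, (1 - t) ^ (k - 1) / (k - 1).factorial *
        ((iteratedFDeriv ℝ k g (z + t • w) fun _ => w) - iteratedFDeriv ℝ k g z fun _ => w) := by
  obtain ⟨n, rfl⟩ : ∃ n, k = n + 1 := ⟨k - 1, by omega⟩
  set φ : ℝ → ℝ := fun t => g (z + t • w) with hφ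
  have hφc : ContDiff ℝ (n + 1 : ℕ) φ := hg.comp (contDiff_const.add (contDiff_id.smul contDiff_const))
  have hI : Set.uIcc (0 : ℝ) 1 = Set.Icc 0 1 := Set.uIcc_of_le zero_le_one
  have hu : UniqueDiffOn ℝ (Set.Icc (0 : ℝ) 1) := uniqueDiffOn_Icc zero_lt_one
  have hT := taylor_integral_remainder (f := φ) (x := 1) (x₀ := 0) (n := n) hφc.contDiffOn
  have hd : ∀ m ≤ n + 1, ∀ t ∈ Set.Icc (0 : ℝ) 1,
      iteratedDerivWithin m φ (Set.Icc 0 1) t = iteratedFDeriv ℝ m g (z + t • w) fun _ => w := by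
    intro m hm t ht
    rw [iteratedDerivWithin_eq_iteratedDeriv hu ((hφc.of_le (by exact_mod_cast hm)).contDiffAt) ht,
      iteratedDeriv_comp_line hg z w hm t]
  rw [hI, taylor_within_apply] at hT
  have hsum : ∑ m ∈ Finset.range (n + 1), ((m.factorial : ℝ)⁻¹ * (1 - 0) ^ m) •
      iteratedDerivWithin m φ (Set.Icc 0 1) 0 = ∑ m ∈ Finset.range (n + 1),
        ((m.factorial : ℝ)⁻¹ * iteratedFDeriv ℝ m g z fun _ => w) := by
    refine Finset.sum_congr rfl fun m hm => ?_
    rw [hd m (Finset.mem_range.mp hm).le 0 (by simp)]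
    simp
  have hint : ∫ t in (0 : ℝ)..1, ((1 - t) ^ n / (n.factorial : ℝ)) •
      iteratedDerivWithin (n + 1) φ (Set.Icc 0 1) t =
      ∫ t in (0 : ℝ)..1, (1 - t) ^ n / (n.factorial : ℝ) *
        (iteratedFDeriv ℝ (n + 1) g (z + t • w) fun _ => w) := by
    refine intervalIntegral.integral_congr fun t ht => ?_
    rw [hI] at ht
    simp only [hd (n + 1) le_rfl t ht, smul_eq_mul]
  rw [hsum, hint] at hT
  have hcont : Continuous fun t : ℝ => iteratedFDeriv ℝ (n + 1) g (z + t • w) fun _ => w := by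
    have h1 : Continuous fun t : ℝ => iteratedFDeriv ℝ (n + 1) g (z + t • w) :=
      (hg.continuous_iteratedFDeriv le_rfl).comp (by fun_prop)
    exact (ContinuousMultilinearMap.apply ℝ (fun _ : Fin (n + 1) => E) ℝ fun _ => w).continuous.comp h1
  have hpoly : ∫ t in (0 : ℝ)..1, (1 - t) ^ n / (n.factorial : ℝ) *
      (iteratedFDeriv ℝ (n + 1) g z fun _ => w) =
      ((n + 1).factorial : ℝ)⁻¹ * iteratedFDeriv ℝ (n + 1) g z fun _ => w := by
    have h1 : ∫ t in (0 : ℝ)..1, (1 - t) ^ n = ((n : ℝ) + 1)⁻¹ := by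
      rw [intervalIntegral.integral_comp_sub_left (fun t => t ^ n) 1]
      simp
    rw [intervalIntegral.integral_mul_const, intervalIntegral.integral_div, h1, Nat.factorial_succ]
    push_cast
    field_simp
  simp only [mul_sub, Nat.add_sub_cancel]
  rw [intervalIntegral.integral_sub, ← hT, hpoly, Finset.sum_range_succ]
  · simp only [hφ, one_smul]
    ring
  · exact ((by fun_prop : Continuous fun t : ℝ => (1 - t) ^ n / (n.factorial : ℝ)).mul
      hcont).intervalIntegrable _ _
  · exact ((by fun_prop : Continuous fun t : ℝ => (1 - t) ^ n / (n.factorial : ℝ)).mul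
      continuous_const).intervalIntegrable _ _

variable [DecidableEq ι]

/-- Expansion in the standard basis, which brings a derivative in direction `w` to the directional
sequences in which `HolderClass` is stated. -/
theorem multilinear_apply_eq_sum {m : ℕ} (A : ContinuousMultilinearMap ℝ (fun _ : Fin m => ι → ℝ) ℝ)
    (w : ι → ℝ) :
    (A fun _ => w) = ∑ a : Fin m → ι, (∏ l, w (a l)) * A fun l => Pi.single (a l) 1 := by
  have hw : w = ∑ i, w i • (Pi.single i 1 : ι → ℝ) := by
    ext i
    simp [Finset.sum_apply, Pi.single_apply]
  calc (A fun _ => w) = A fun _ => ∑ i, w i • (Pi.single i 1 : ι → ℝ) := by rw [← hw]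
    _ = ∑ a : Fin m → ι, A fun l => w (a l) • (Pi.single (a l) 1 : ι → ℝ) := A.map_sum _
    _ = _ := by
        refine Finset.sum_congr rfl fun a _ => ?_
        rw [A.map_smul_univ, smul_eq_mul]

theorem abs_sub_taylor_le {β L : ℝ} (hβ : 1 < β) (hL : 0 < L) {g : (ι → ℝ) → ℝ}
    (hg : g ∈ HolderClass β L) (z w : ι → ℝ) :
    |g (z + w) - ∑ m ∈ Finset.range (⌊β⌋₊ + 1),
        ((m.factorial : ℝ)⁻¹ * iteratedFDeriv ℝ m g z fun _ => w)| ≤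
      L * (∫ t in (0 : ℝ)..1, (1 - t) ^ (⌊β⌋₊ - 1) * t ^ (β - ⌊β⌋₊)) *
        (∑ α ∈ Finset.piAntidiag (Finset.univ : Finset ι) ⌊β⌋₊,
          euclNorm (fun i => (α i : ℝ)) ^ ⌊β⌋₊ /
            ((∏ i, ((α i).factorial : ℝ)) * (⌊β⌋₊ : ℝ) ^ (⌊β⌋₊ - 1))) * euclNorm w ^ β := by
  set k := ⌊β⌋₊ with hk
  have hk0 : 0 < k := Nat.floor_pos.mpr hβ.le
  have hkβ : (k : ℝ) ≤ β := Nat.floor_le (by linarith)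
  have he : 0 ≤ β - k := by linarith
  rw [sub_taylor_eq_integral hk0 hg.1 z w]
  have hbound : ∀ t ∈ Set.Ioc (0 : ℝ) 1, ‖(1 - t) ^ (k - 1) / ((k - 1).factorial : ℝ) *
      ((iteratedFDeriv ℝ k g (z + t • w) fun _ => w) - iteratedFDeriv ℝ k g z fun _ => w)‖ ≤
      ((1 - t) ^ (k - 1) * t ^ (β - k)) *
        (((k - 1).factorial : ℝ)⁻¹ * (L * euclNorm w ^ (β - k) * (∑ i, |w i|) ^ k)) := by
    intro t ht
    have ht1 : 0 ≤ 1 - t := by linarith [ht.2]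
    have hdiff : |(iteratedFDeriv ℝ k g (z + t • w) fun _ => w) - iteratedFDeriv ℝ k g z fun _ => w| ≤
        t ^ (β - k) * (L * euclNorm w ^ (β - k) * (∑ i, |w i|) ^ k) := by
      rw [multilinear_apply_eq_sum, multilinear_apply_eq_sum, ← Finset.sum_sub_distrib]
      simp only [← mul_sub]
      refine (Finset.abs_sum_le_sum_abs _ _).trans ?_
      -- The products of `|w (a l)|` over all sequences `a` sum to `(∑ i, |w i|) ^ k`.
      rw [Finset.sum_pow' , Finset.mul_sum, Finset.mul_sum]
      refine Finset.sum_le_sum fun a _ => ?_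
      rw [abs_mul, Finset.abs_prod]
      have h1 := hg.2 a (z + t • w) z
      rw [add_sub_cancel_left, euclNorm_smul, abs_of_pos ht.1,
        Real.mul_rpow ht.1.le (euclNorm_nonneg w)] at h1
      calc _ ≤ (∏ l, |w (a l)|) * (L * (t ^ (β - k) * euclNorm w ^ (β - k))) := by
            gcongr
        _ = _ := by ring
    rw [norm_mul, Real.norm_eq_abs, Real.norm_eq_abs, abs_of_nonneg (by positivity)]
    calc _ ≤ (1 - t) ^ (k - 1) / ((k - 1).factorial : ℝ) *
          (t ^ (β - k) * (L * euclNorm w ^ (β - k) * (∑ i, |w i|) ^ k)) := by gcongr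
      _ = _ := by ring
  have hint : IntervalIntegrable (fun t : ℝ => (1 - t) ^ (k - 1) * t ^ (β - k)) volume 0 1 :=
    ((by fun_prop : Continuous fun t : ℝ => (1 - t) ^ (k - 1)).mul
      (Real.continuous_rpow_const he)).intervalIntegrable _ _
  have hI0 : 0 ≤ ∫ t in (0 : ℝ)..1, (1 - t) ^ (k - 1) * t ^ (β - k) := by
    refine intervalIntegral.integral_nonneg zero_le_one fun t ht => ?_
    have : 0 ≤ 1 - t := by linarith [ht.2]
    have := ht.1
    positivity
  rw [← Real.norm_eq_abs]
  refine (intervalIntegral.norm_integral_le_of_norm_le zero_le_one (.of_forall hbound)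
    (hint.mul_const _)).trans ?_
  rw [intervalIntegral.integral_mul_const]
  have hw0 := euclNorm_nonneg w
  have hsplit : euclNorm w ^ β = euclNorm w ^ (β - k) * euclNorm w ^ k := by
    rw [← Real.rpow_natCast, ← Real.rpow_add_of_nonneg hw0 he (Nat.cast_nonneg k),
      sub_add_cancel]
  have hs := sum_abs_pow_le hk0 w
  have hfpos : (0 : ℝ) < (k - 1).factorial := by positivity
  calc _ ≤ (∫ t in (0 : ℝ)..1, (1 - t) ^ (k - 1) * t ^ (β - k)) *
        (((k - 1).factorial : ℝ)⁻¹ * (L * euclNorm w ^ (β - k) * ((k - 1).factorial *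
      (∑ α ∈ Finset.piAntidiag (Finset.univ : Finset ι) k,
        euclNorm (fun i => (α i : ℝ)) ^ k /
          ((∏ i, ((α i).factorial : ℝ)) * (k : ℝ) ^ (k - 1))) * euclNorm w ^ k))) := by
        gcongr
    _ = _ := by
        rw [hsplit]
        generalize (∑ α ∈ Finset.piAntidiag (Finset.univ : Finset ι) k, _ : ℝ) = s
        field_simp

end taylor

/-! ### Kernels of a given order -/

section monomial

variable {ι : Type*} [Fintype ι]

theorem abs_prod_apply_le {m : ℕ} (a : Fin m → ι) (v : ι → ℝ) :
    |∏ l, v (a l)| ≤ euclNorm v ^ m := by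
  rw [Finset.abs_prod]
  refine (Finset.prod_le_prod (fun l _ => abs_nonneg _)
    fun l _ => abs_apply_le_euclNorm v (a l)).trans (by simp)

/-- A monomial of degree at most `β` is dominated by `1 + ‖v‖ ^ β`, so the mass and the `β`-moment
of `K` suffice. -/
theorem integrable_kernel_mul_monomial {K : (ι → ℝ) → ℝ} (hK : Continuous K) (hKi : Integrable K)
    {β : ℝ} (hKm : Integrable fun u => |K u| * euclNorm u ^ β) {m : ℕ} (hm : (m : ℝ) ≤ β)
    (a : Fin m → ι) : Integrable fun v : ι → ℝ => K v * ∏ l, v (a l) := by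
  refine (hKi.abs.add hKm).mono' (by fun_prop) (.of_forall fun v => ?_)
  rw [Real.norm_eq_abs, abs_mul]
  have h0 := euclNorm_nonneg v
  have h1 : |∏ l, v (a l)| ≤ 1 + euclNorm v ^ β := by
    refine (abs_prod_apply_le a v).trans ?_
    have h3 : 0 ≤ euclNorm v ^ β := by positivity
    rcases le_total (euclNorm v) 1 with h2 | h2
    · linarith [pow_le_one₀ h0 h2 (n := m)]
    · rw [← Real.rpow_natCast]
      linarith [Real.rpow_le_rpow_of_exponent_le h2 hm]
  calc _ ≤ |K v| * (1 + euclNorm v ^ β) := by gcongr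
    _ = _ := by simp [mul_add]

/-- A sequence of directions corresponds to the multi-index that counts how often each direction
occurs. -/
theorem integral_kernel_mul_monomial [DecidableEq ι] {K : (ι → ℝ) → ℝ} {k m : ℕ}
    (hK : IsKernelOfOrder k K) (hm : 1 ≤ m) (hmk : m ≤ k) (a : Fin m → ι) :
    ∫ v, K v * ∏ l, v (a l) = 0 := by
  have hsum : ∑ i, (Finset.univ.filter fun l => a l = i).card = m := by
    rw [← Finset.card_eq_sum_card_fiberwise (f := a) (s := Finset.univ) (t := Finset.univ) (by simp)]
    simp
  have h := hK.2 (fun i => (Finset.univ.filter fun l => a l = i).card) (by rw [hsum]; exact hm)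
    (by rw [hsum]; exact hmk)
  rw [← h]
  congr 1
  ext v
  rw [← Finset.prod_fiberwise' Finset.univ a v]
  simp

end monomial

/-! ### Bandwidth matrices and the bias of kernel smoothing -/

section bandwidth

variable {D : ℕ} {h : Fin D → ℝ} {S : Finset (Fin D)}

theorem bandwidth_det_pos (hh : ∀ k, 0 < h k) : 0 < (bandwidth h S).det := by
  rw [bandwidth, Matrix.det_diagonal]
  exact Finset.prod_pos fun i _ => hh i

theorem bandwidth_mulVec (v : S → ℝ) : (bandwidth h S).mulVec v = fun i : S => h i * v i := by
  ext i
  rw [bandwidth, Matrix.mulVec_diagonal]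

theorem continuous_scaledKernel {K : (S → ℝ) → ℝ} (hK : Continuous K) :
    Continuous (scaledKernel h S K) := by
  unfold scaledKernel
  refine continuous_const.mul (hK.comp ?_)
  exact Continuous.matrix_mulVec continuous_const continuous_id

theorem euclNorm_bandwidth_mulVec_le (v : S → ℝ) :
    euclNorm ((bandwidth h S).mulVec v) ≤ bandwidthNorm h S * euclNorm v := by
  have := (Matrix.toEuclideanCLM (𝕜 := ℝ) (bandwidth h S)).le_opNorm (WithLp.toLp 2 v)
  rwa [Matrix.toEuclideanCLM_toLp] at this

theorem bandwidthNorm_nonneg : 0 ≤ bandwidthNorm h S := norm_nonneg _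

theorem integrable_comp_bandwidth_inv (hh : ∀ k, 0 < h k) {F : (S → ℝ) → ℝ} (hF : Continuous F)
    (hFi : Integrable F) (z : S → ℝ) :
    Integrable (fun u => F (Matrix.mulVec (bandwidth h S)⁻¹ (z - u))) ∧
      ∫ u, F (Matrix.mulVec (bandwidth h S)⁻¹ (z - u)) = |(bandwidth h S).det| * ∫ v, F v := by
  have hdet := bandwidth_det_pos (S := S) hh
  have hdet' : ((bandwidth h S)⁻¹).det ≠ 0 := by
    rw [Matrix.det_nonsing_inv, Ring.inverse_eq_inv']
    exact inv_ne_zero hdet.ne'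
  have hmap := Real.map_matrix_volume_pi_eq_smul_volume_pi hdet'
  rw [Matrix.det_nonsing_inv, Ring.inverse_eq_inv', inv_inv] at hmap
  have hc : Continuous (Matrix.toLin' (bandwidth h S)⁻¹) := LinearMap.continuous_on_pi _
  have hi : Integrable (fun u => F (Matrix.mulVec (bandwidth h S)⁻¹ u)) := by
    have h1 : Integrable F (Measure.map (Matrix.toLin' (bandwidth h S)⁻¹) volume) := by
      rw [hmap]
      exact hFi.smul_measure ENNReal.ofReal_ne_top
    exact h1.comp_measurable hc.measurable
  refine ⟨(Measure.measurePreserving_sub_left volume z).integrable_comp_of_integrable hi, ?_⟩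
  rw [integral_sub_left_eq_self (fun u => F (Matrix.mulVec (bandwidth h S)⁻¹ u)) volume z]
  have h2 := integral_map (μ := volume) hc.measurable.aemeasurable
    (f := F) hF.aestronglyMeasurable
  rw [hmap, integral_smul_measure, ENNReal.toReal_ofReal (abs_nonneg _)] at h2
  exact h2.symm

/-- The Taylor polynomial of `g` at `z` in direction `-H v` is a polynomial in `v` of degree at most
`⌊β⌋`. Against a kernel of this order all its terms but the constant `g z` integrate to zero. The
remainder is at most a constant times `‖H‖ ^ β ‖v‖ ^ β`, whose integral against `|K|` gives
`holderConst`. -/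
theorem kernel_taylor_bound {β L : ℝ} (hβ : 1 < β) (hL : 0 < L)
    {K : (S → ℝ) → ℝ} (hK : Continuous K) (hKo : IsKernelOfOrder ⌊β⌋₊ K)
    (hKm : Integrable fun u => |K u| * euclNorm u ^ β) {g : (S → ℝ) → ℝ}
    (hg : g ∈ HolderClass β L) (z : S → ℝ) :
    Integrable (fun v => K v * g (z - (bandwidth h S).mulVec v)) ∧
      |(∫ v, K v * g (z - (bandwidth h S).mulVec v)) - g z| ≤
        holderConst β L K * bandwidthNorm h S ^ β := by
  have hk0 : 0 < ⌊β⌋₊ := Nat.floor_pos.mpr hβ.le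
  have hkβ : (⌊β⌋₊ : ℝ) ≤ β := Nat.floor_le (by linarith)
  -- The integral of a non-integrable function is `0` by convention, which contradicts `∫ K = 1`.
  have hKi : Integrable K := by
    by_contra hc
    have := hKo.1
    rw [integral_undef hc] at this
    exact zero_ne_one this
  obtain ⟨c, hc⟩ : ∃ c, c = L * (∫ t in (0 : ℝ)..1, (1 - t) ^ (⌊β⌋₊ - 1) * t ^ (β - ⌊β⌋₊)) *
        (∑ α ∈ Finset.piAntidiag (Finset.univ : Finset S) ⌊β⌋₊,
          euclNorm (fun i => (α i : ℝ)) ^ ⌊β⌋₊ /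
            ((∏ i, ((α i).factorial : ℝ)) * (⌊β⌋₊ : ℝ) ^ (⌊β⌋₊ - 1))) := ⟨_, rfl⟩
  have hc0 : 0 ≤ c := by
    have hI0 : 0 ≤ ∫ t in (0 : ℝ)..1, (1 - t) ^ (⌊β⌋₊ - 1) * t ^ (β - ⌊β⌋₊) := by
      refine intervalIntegral.integral_nonneg zero_le_one fun t ht => ?_
      have : 0 ≤ 1 - t := by linarith [ht.2]
      have := ht.1
      positivity
    rw [hc]
    refine mul_nonneg (mul_nonneg hL.le hI0) (Finset.sum_nonneg fun α _ => ?_)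
    have := euclNorm_nonneg (fun i => (α i : ℝ))
    positivity
  set P : ℕ → (S → ℝ) → ℝ := fun m v =>
    (m.factorial : ℝ)⁻¹ * iteratedFDeriv ℝ m g z fun _ => -(bandwidth h S).mulVec v with hP
  have hPe : ∀ m v, P m v = ∑ a : Fin m → S, ((m.factorial : ℝ)⁻¹ * (∏ l, -h (a l)) *
      iteratedFDeriv ℝ m g z fun l => Pi.single (a l) 1) * ∏ l, v (a l) := by
    intro m v
    simp only [hP]
    rw [multilinear_apply_eq_sum, Finset.mul_sum]
    refine Finset.sum_congr rfl fun a _ => ?_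
    have : ∏ l, (-(bandwidth h S).mulVec v) (a l) = (∏ l, -h (a l)) * ∏ l, v (a l) := by
      rw [← Finset.prod_mul_distrib]
      simp [bandwidth_mulVec]
    rw [this]
    ring
  have hPc : ∀ m, Continuous (P m) := fun m => by
    rw [funext (hPe m)]
    fun_prop
  have hPi : ∀ m ≤ ⌊β⌋₊, Integrable fun v => K v * P m v := by
    intro m hm
    have hmβ : (m : ℝ) ≤ β := le_trans (by exact_mod_cast hm) hkβ
    simp only [hPe, Finset.mul_sum]
    refine integrable_finsetSum _ fun a _ => ?_
    simp only [mul_left_comm (K _)]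
    exact (integrable_kernel_mul_monomial hK hKi hKm hmβ a).const_mul _
  have hP0 : ∀ m ≤ ⌊β⌋₊, 1 ≤ m → ∫ v, K v * P m v = 0 := by
    intro m hm hm1
    have hmβ : (m : ℝ) ≤ β := le_trans (by exact_mod_cast hm) hkβ
    simp only [hPe, Finset.mul_sum]
    simp only [mul_left_comm (K _)]
    rw [integral_finsetSum _ fun a _ =>
      (integrable_kernel_mul_monomial hK hKi hKm hmβ a).const_mul _]
    refine Finset.sum_eq_zero fun a _ => ?_
    rw [integral_const_mul, integral_kernel_mul_monomial hKo hm1 hm a, mul_zero]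
  have hgc : Continuous g := hg.1.continuous
  have hHc : Continuous fun v : S → ℝ => (bandwidth h S).mulVec v :=
    Continuous.matrix_mulVec continuous_const continuous_id
  set Q : (S → ℝ) → ℝ := fun v => ∑ m ∈ Finset.range (⌊β⌋₊ + 1), P m v with hQ
  have hQc : Continuous Q := continuous_finsetSum _ fun m _ => hPc m
  have hR : ∀ v, |K v * (g (z - (bandwidth h S).mulVec v) - Q v)| ≤
      c * bandwidthNorm h S ^ β * (|K v| * euclNorm v ^ β) := by
    intro v
    have h1 := abs_sub_taylor_le hβ hL hg z (-(bandwidth h S).mulVec v)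
    rw [← hc, euclNorm_neg, ← sub_eq_add_neg] at h1
    have h2 : euclNorm ((bandwidth h S).mulVec v) ^ β ≤ bandwidthNorm h S ^ β * euclNorm v ^ β := by
      rw [← Real.mul_rpow bandwidthNorm_nonneg (euclNorm_nonneg v)]
      exact Real.rpow_le_rpow (euclNorm_nonneg _) (euclNorm_bandwidth_mulVec_le v) (by linarith)
    rw [abs_mul]
    calc _ ≤ |K v| * (c * (bandwidthNorm h S ^ β * euclNorm v ^ β)) := by
          gcongr
          exact h1.trans (by gcongr)
      _ = _ := by ring
  have hRi : Integrable fun v => K v * (g (z - (bandwidth h S).mulVec v) - Q v) := by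
    refine (hKm.const_mul (c * bandwidthNorm h S ^ β)).mono' ?_ (.of_forall hR)
    exact (hK.mul ((hgc.comp (continuous_const.sub hHc)).sub hQc)).aestronglyMeasurable
  have hQi : Integrable fun v => K v * Q v := by
    simp only [hQ, Finset.mul_sum]
    exact integrable_finsetSum _ fun m hm => hPi m (Nat.lt_succ_iff.mp (Finset.mem_range.mp hm))
  have hQI : ∫ v, K v * Q v = g z := by
    simp only [hQ, Finset.mul_sum]
    rw [integral_finsetSum _ fun m hm => hPi m (Nat.lt_succ_iff.mp (Finset.mem_range.mp hm)),
      Finset.sum_eq_single 0]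
    · simp only [hP, Nat.factorial_zero, Nat.cast_one, inv_one, iteratedFDeriv_zero_apply, one_mul]
      rw [integral_mul_const, hKo.1, one_mul]
    · exact fun m hm hm0 => hP0 m (Nat.lt_succ_iff.mp (Finset.mem_range.mp hm))
        (Nat.one_le_iff_ne_zero.mpr hm0)
    · simp
  have hsplit : ∀ v, K v * g (z - (bandwidth h S).mulVec v) =
      K v * (g (z - (bandwidth h S).mulVec v) - Q v) + K v * Q v := fun v => by ring
  refine ⟨by simp only [hsplit]; exact hRi.add hQi, ?_⟩
  rw [integral_congr_ae (.of_forall hsplit), integral_add hRi hQi, hQI, add_sub_cancel_right,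
    ← Real.norm_eq_abs]
  refine (norm_integral_le_of_norm_le (hKm.const_mul (c * bandwidthNorm h S ^ β))
    (.of_forall hR)).trans (le_of_eq ?_)
  rw [integral_const_mul, holderConst, ← hc]
  ring

/-- The bias of kernel smoothing in Hölder classes. -/
theorem kernel_bias (hh : ∀ k, 0 < h k) {β L : ℝ} (hβ : 1 < β) (hL : 0 < L)
    {K : (S → ℝ) → ℝ} (hK : Continuous K) (hKo : IsKernelOfOrder ⌊β⌋₊ K)
    (hKm : Integrable fun u => |K u| * euclNorm u ^ β) {g : (S → ℝ) → ℝ}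
    (hg : g ∈ HolderClass β L) (z : S → ℝ) :
    Integrable (fun u => scaledKernel h S K (z - u) * g u) ∧
      |(∫ u, scaledKernel h S K (z - u) * g u) - g z| ≤
        holderConst β L K * bandwidthNorm h S ^ β := by
  obtain ⟨h1, h2⟩ := kernel_taylor_bound (h := h) hβ hL hK hKo hKm hg z
  have hHc : Continuous fun v : S → ℝ => (bandwidth h S).mulVec v :=
    Continuous.matrix_mulVec continuous_const continuous_id
  have hdet := bandwidth_det_pos (S := S) hh
  have hFc : Continuous fun v => K v * g (z - (bandwidth h S).mulVec v) :=
    hK.mul (hg.1.continuous.comp (continuous_const.sub hHc))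
  obtain ⟨h3, h4⟩ := integrable_comp_bandwidth_inv hh hFc h1 z
  -- The substitution `v = H⁻¹ (z - u)`, so that `u = z - H v`; the factor `|det H|⁻¹` cancels the
  -- Jacobian.
  have he : ∀ u, scaledKernel h S K (z - u) * g u = |(bandwidth h S).det|⁻¹ *
      (K (Matrix.mulVec (bandwidth h S)⁻¹ (z - u)) *
        g (z - (bandwidth h S).mulVec (Matrix.mulVec (bandwidth h S)⁻¹ (z - u)))) := by
    intro u
    rw [Matrix.mulVec_mulVec, Matrix.mul_nonsing_inv _ (isUnit_iff_ne_zero.mpr hdet.ne'),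
      Matrix.one_mulVec, sub_sub_cancel, scaledKernel, mul_assoc]
  simp only [he]
  refine ⟨h3.const_mul _, ?_⟩
  rw [integral_const_mul, h4, inv_mul_cancel_left₀ (abs_pos.mpr hdet.ne').ne']
  exact h2

end bandwidth

/-! ### Kernels on the compact data space and their constants -/

section kernel

variable {D : ℕ} {h : Fin D → ℝ} {S : Finset (Fin D)} {Zsp : Fin D → Set ℝ} {K : (S → ℝ) → ℝ}

theorem isCompact_box (hZ : ∀ j, IsCompact (Zsp j)) (S : Finset (Fin D)) :
    IsCompact (box Zsp S) := isCompact_univ_pi fun k => hZ k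

theorem measurableSet_box (hZ : ∀ j, IsCompact (Zsp j)) (S : Finset (Fin D)) :
    MeasurableSet (box Zsp S) := MeasurableSet.univ_pi fun k => (hZ k).measurableSet

theorem measurableSet_space (hZ : ∀ j, IsCompact (Zsp j)) : MeasurableSet (space Zsp) :=
  MeasurableSet.univ_pi fun k => (hZ k).measurableSet

theorem restrict_mem_box {z : Fin D → ℝ} (hz : z ∈ space Zsp) (S : Finset (Fin D)) :
    S.restrict z ∈ box Zsp S := fun k _ => hz k trivial

/-- The sample only produces the integral over `B`, whereas the bias estimate is for the whole
space. The missing integral over the complement is at most the kernel tail `τ` times the mass of the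
extension there. -/
theorem kernel_bias_on (hh : ∀ k, 0 < h k) {β L : ℝ} (hβ : 1 < β) (hL : 0 < L)
    (hK : Continuous K) (hKo : IsKernelOfOrder ⌊β⌋₊ K)
    (hKm : Integrable fun u => |K u| * euclNorm u ^ β) {g : (S → ℝ) → ℝ}
    (hg : g ∈ HolderClass β L) {z : S → ℝ} {B : Set (S → ℝ)} (hB : MeasurableSet B)
    (hgB : IntegrableOn g Bᶜ) {τ : ℝ} (hτ : ∀ u ∉ B, |scaledKernel h S K (z - u)| ≤ τ) :
    |(∫ u in B, scaledKernel h S K (z - u) * g u) - g z| ≤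
      holderConst β L K * bandwidthNorm h S ^ β + τ * ∫ u in Bᶜ, |g u| := by
  obtain ⟨h1, h2⟩ := kernel_bias hh hβ hL hK hKo hKm hg z
  rw [← integral_add_compl hB h1] at h2
  have h3 : |∫ u in Bᶜ, scaledKernel h S K (z - u) * g u| ≤ τ * ∫ u in Bᶜ, |g u| := by
    rw [← integral_const_mul, ← Real.norm_eq_abs]
    refine norm_integral_le_of_norm_le (hgB.abs.const_mul τ) ?_
    filter_upwards [ae_restrict_mem hB.compl] with u hu
    rw [norm_mul, Real.norm_eq_abs, Real.norm_eq_abs]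
    exact mul_le_mul_of_nonneg_right (hτ u hu) (abs_nonneg _)
  have h4 := abs_le.mp h2
  have h5 := abs_le.mp h3
  rw [abs_le]
  constructor <;> linarith [h4.1, h4.2, h5.1, h5.2]

theorem scaledKernel_pos (hh : ∀ k, 0 < h k) (hK : ∀ u, 0 < K u) (u : S → ℝ) :
    0 < scaledKernel h S K u :=
  mul_pos (inv_pos.mpr (abs_pos.mpr (bandwidth_det_pos hh).ne')) (hK _)

theorem scaledKernel_le (hh : ∀ k, 0 < h k) {b : ℝ} (hb : ∀ u, |K u| ≤ b) (u : S → ℝ) :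
    |scaledKernel h S K u| ≤ b / |(bandwidth h S).det| := by
  have := abs_pos.mpr (bandwidth_det_pos (S := S) hh).ne'
  rw [scaledKernel, abs_mul, abs_of_pos (inv_pos.mpr this), div_eq_inv_mul]
  gcongr
  exact hb _

theorem le_kernelTail (hh : ∀ k, 0 < h k) {b : ℝ} (hb : ∀ u, |K u| ≤ b) {x x' : S → ℝ}
    (hx : x ∈ box Zsp S) (hx' : x' ∉ box Zsp S) :
    |scaledKernel h S K (x - x')| ≤ kernelTail Zsp h S K := by
  refine le_csSup ⟨b / |(bandwidth h S).det|, ?_⟩ ⟨x, hx, x', hx', rfl⟩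
  rintro _ ⟨y, _, y', _, rfl⟩
  exact scaledKernel_le hh hb _

theorem kernelTail_nonneg : 0 ≤ kernelTail Zsp h S K := by
  refine Real.sSup_nonneg ?_
  rintro _ ⟨y, _, y', _, rfl⟩
  exact abs_nonneg _

theorem kernelInf_le (hh : ∀ k, 0 < h k) (hK : ∀ u, 0 < K u) {x x' : S → ℝ}
    (hx : x ∈ box Zsp S) (hx' : x' ∈ box Zsp S) :
    kernelInf Zsp h S K ≤ |(bandwidth h S).det| * scaledKernel h S K (x - x') := by
  refine mul_le_mul_of_nonneg_left (csInf_le ⟨0, ?_⟩ ⟨x, hx, x', hx', rfl⟩) (abs_nonneg _)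
  rintro _ ⟨y, _, y', _, rfl⟩
  exact (scaledKernel_pos hh hK _).le

/-- A continuous positive function attains a positive minimum on the compact product of the box with
itself. -/
theorem kernelInf_pos (hh : ∀ k, 0 < h k) (hK : ∀ u, 0 < K u) (hKc : Continuous K)
    (hZ : ∀ j, IsCompact (Zsp j)) (hne : (box Zsp S).Nonempty) : 0 < kernelInf Zsp h S K := by
  refine mul_pos (abs_pos.mpr (bandwidth_det_pos hh).ne') ?_
  have hcont : Continuous fun w : (S → ℝ) × (S → ℝ) => scaledKernel h S K (w.1 - w.2) :=
    (continuous_scaledKernel hKc).comp (continuous_fst.sub continuous_snd)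
  obtain ⟨w, hw, hmin⟩ := ((isCompact_box hZ S).prod (isCompact_box hZ S)).exists_isMinOn
    (hne.prod hne) hcont.continuousOn
  refine (scaledKernel_pos hh hK (w.1 - w.2)).trans_le
    (le_csInf ⟨_, w.1, hw.1, w.2, hw.2, rfl⟩ ?_)
  rintro _ ⟨y, hy, y', hy', rfl⟩
  exact isMinOn_iff.mp hmin (y, y') ⟨hy, hy'⟩

end kernel

theorem le_kernelSup {D : ℕ} {G : ADMG (Fin D)} {K : (j : Fin D) → (G.mp j → ℝ) → ℝ}
    (hK : ∀ j, BddAbove (Set.range fun u => |K j u|)) (j : Fin D) (u : G.mp j → ℝ) :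
    |K j u| ≤ kernelSup G K :=
  (le_ciSup (hK j) u).trans
    (le_ciSup (f := fun j => ⨆ u, |K j u|) (Set.finite_range _).bddAbove j)

theorem le_lossSup {D : ℕ} {F : Type*} {ℓ : F → (Fin D → ℝ) → ℝ}
    (hℓ : BddAbove (Set.range fun w : F × (Fin D → ℝ) => |ℓ w.1 w.2|)) (f : F) (z : Fin D → ℝ) :
    ℓ f z ≤ lossSup ℓ :=
  (le_abs_self _).trans (le_ciSup hℓ (f, z))

theorem lossSup_nonneg {D : ℕ} {F : Type*} (ℓ : F → (Fin D → ℝ) → ℝ) : 0 ≤ lossSup ℓ :=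
  Real.iSup_nonneg fun _ => abs_nonneg _

theorem inv_kernelInf_le_kernelConst {D : ℕ} (G : ADMG (Fin D)) (Zsp : Fin D → Set ℝ)
    (K : (j : Fin D) → (G.mp j → ℝ) → ℝ) (h : Fin D → ℝ) (j : Fin D) :
    1 / kernelInf Zsp h (G.mp j) (K j) ≤ kernelConst G Zsp K h :=
  (le_max_left _ _).trans (le_ciSup (f := fun j => max (1 / kernelInf Zsp h (G.mp j) (K j))
    (kernelSup G K / kernelInf Zsp h (G.mp j) (K j) ^ 2)) (Set.finite_range _).bddAbove j)

theorem densityInf_le {D : ℕ} {Zsp : Fin D → Set ℝ} {p : (Fin D → ℝ) → ℝ} {S : Finset (Fin D)}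
    {c : ℝ} (hc : ∀ z ∈ space Zsp, c ≤ marginal Zsp p S z) {z : Fin D → ℝ} (hz : z ∈ space Zsp) :
    densityInf Zsp p S ≤ marginal Zsp p S z :=
  csInf_le ⟨c, by rintro _ ⟨y, hy, rfl⟩; exact hc y hy⟩ ⟨z, hz, rfl⟩

theorem densityInf_pos {D : ℕ} {Zsp : Fin D → Set ℝ} {p : (Fin D → ℝ) → ℝ} {S : Finset (Fin D)}
    {c : ℝ} (hc0 : 0 < c) (hc : ∀ z ∈ space Zsp, c ≤ marginal Zsp p S z)
    (hne : (space Zsp).Nonempty) : 0 < densityInf Zsp p S := by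
  refine hc0.trans_le (le_csInf (hne.image _) ?_)
  rintro _ ⟨y, hy, rfl⟩
  exact hc y hy

/-- The pillow is formed among the vertices up to `j`, with `j` removed. This ordering is what makes
the resampling sequential. -/
theorem ADMG.mp_lt {D : ℕ} (G : ADMG (Fin D)) {j k : Fin D} (hk : k ∈ G.mp j) : k < j := by
  simp only [ADMG.mp, Set.Finite.mem_toFinset, ADMG.pillowSet] at hk
  obtain ⟨v, ⟨-, hv⟩, rfl⟩ := hk
  exact lt_of_le_of_ne v.2 fun he => hv (Subtype.ext he)

/-! ### Integrating out coordinates -/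

section integrateOut

variable {D : ℕ}

/-- The Lebesgue measure on a coordinate space. -/
noncomputable abbrev coordMeasure (Zsp : Fin D → Set ℝ) (i : Fin D) : Measure ℝ :=
  volume.restrict (Zsp i)

theorem restrict_space_eq_pi (Zsp : Fin D → Set ℝ) :
    (volume : Measure (Fin D → ℝ)).restrict (space Zsp) = Measure.pi (coordMeasure Zsp) := by
  rw [space, volume_pi, Measure.restrict_pi_pi]

theorem restrict_box_eq_pi (Zsp : Fin D → Set ℝ) (S : Finset (Fin D)) :
    (volume : Measure (S → ℝ)).restrict (box Zsp S) =
      Measure.pi fun k : S => coordMeasure Zsp k := by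
  rw [box, volume_pi, Measure.restrict_pi_pi]

/-- Iterated integrals are handled as `lmarginal`s of nonnegative functions, where Tonelli's theorem
needs no integrability. -/
theorem integrateOut_eq_toReal (Zsp : Fin D → Set ℝ) (S : Finset (Fin D))
    {f : (Fin D → ℝ) → ℝ} (hf : Measurable f) (hf0 : ∀ z, 0 ≤ f z) (z : Fin D → ℝ) :
    integrateOut Zsp S f z =
      ((∫⋯∫⁻_S, (fun z => ENNReal.ofReal (f z)) ∂coordMeasure Zsp) z).toReal := by
  rw [integrateOut, integral_eq_lintegral_of_nonneg_ae (.of_forall fun u => hf0 _)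
    (hf.comp measurable_updateFinset).aestronglyMeasurable]
  rfl

theorem const_mul_lmarginal (Zsp : Fin D → Set ℝ) (S : Finset (Fin D))
    {f : (Fin D → ℝ) → ℝ≥0∞} (hf : Measurable f) (c : ℝ≥0∞) (z : Fin D → ℝ) :
    c * (∫⋯∫⁻_S, f ∂coordMeasure Zsp) z =
      ∫⁻ u : S → ℝ, c * f (Function.updateFinset z S u)
        ∂Measure.pi fun k : S => coordMeasure Zsp k :=
  (lintegral_const_mul c (hf.comp measurable_updateFinset)).symm

theorem updateFinset_mem_space {Zsp : Fin D → Set ℝ} {S : Finset (Fin D)} {z : Fin D → ℝ}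
    (hz : z ∈ space Zsp) {u : S → ℝ} (hu : u ∈ box Zsp S) :
    Function.updateFinset z S u ∈ space Zsp := by
  intro k _
  by_cases hk : k ∈ S
  · simpa [Function.updateFinset, hk] using hu ⟨k, hk⟩ trivial
  · simpa [Function.updateFinset, hk] using hz k trivial

theorem update_mem_space {Zsp : Fin D → Set ℝ} {z : Fin D → ℝ} (hz : z ∈ space Zsp) {j : Fin D}
    {x : ℝ} (hx : x ∈ Zsp j) : Function.update z j x ∈ space Zsp := by
  intro k _
  rcases eq_or_ne k j with rfl | hk
  · simpa using hx
  · simpa [hk] using hz k trivial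

end integrateOut

/-! ### Marginal and conditional densities -/

section density

variable {D : ℕ} {Zsp : Fin D → Set ℝ} {p : (Fin D → ℝ) → ℝ}

/-- The marginal density with values in the extended nonnegative reals. -/
noncomputable def emarginal (Zsp : Fin D → Set ℝ) (p : (Fin D → ℝ) → ℝ) (S : Finset (Fin D)) :
    (Fin D → ℝ) → ℝ≥0∞ :=
  ∫⋯∫⁻_Sᶜ, (fun z => ENNReal.ofReal (p z)) ∂coordMeasure Zsp

theorem measurable_emarginal (hp : Measurable p) (S : Finset (Fin D)) :
    Measurable (emarginal Zsp p S) := hp.ennreal_ofReal.lmarginal _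

theorem emarginal_congr {S : Finset (Fin D)} {y z : Fin D → ℝ} (h : ∀ k ∈ S, y k = z k) :
    emarginal Zsp p S y = emarginal Zsp p S z :=
  lmarginal_congr _ _ fun k hk => h k (by simpa using hk)

theorem marginal_eq_toReal (hp : Measurable p) (hp0 : ∀ z, 0 ≤ p z) (S : Finset (Fin D))
    (z : Fin D → ℝ) : marginal Zsp p S z = (emarginal Zsp p S z).toReal :=
  integrateOut_eq_toReal Zsp Sᶜ hp hp0 z

theorem measurable_marginal (hp : Measurable p) (hp0 : ∀ z, 0 ≤ p z) (S : Finset (Fin D)) :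
    Measurable (marginal Zsp p S) := by
  rw [funext (marginal_eq_toReal hp hp0 S)]
  exact (measurable_emarginal hp S).ennreal_toReal

theorem marginal_nonneg (hp : Measurable p) (hp0 : ∀ z, 0 ≤ p z) (S : Finset (Fin D))
    (z : Fin D → ℝ) : 0 ≤ marginal Zsp p S z := by
  rw [marginal_eq_toReal hp hp0]
  exact ENNReal.toReal_nonneg

theorem marginal_congr (hp : Measurable p) (hp0 : ∀ z, 0 ≤ p z) {S : Finset (Fin D)}
    {y z : Fin D → ℝ} (h : ∀ k ∈ S, y k = z k) : marginal Zsp p S y = marginal Zsp p S z := by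
  rw [marginal_eq_toReal hp hp0, marginal_eq_toReal hp hp0, emarginal_congr h]

/-- An infinite value would be read as `0` by `toReal`, so positivity of the real marginal excludes
it. -/
theorem emarginal_ne_top (hp : Measurable p) (hp0 : ∀ z, 0 ≤ p z) {S : Finset (Fin D)}
    {z : Fin D → ℝ} (h : 0 < marginal Zsp p S z) : emarginal Zsp p S z ≠ ∞ := by
  intro hc
  rw [marginal_eq_toReal hp hp0, hc] at h
  simp at h

theorem ofReal_marginal (hp : Measurable p) (hp0 : ∀ z, 0 ≤ p z) {S : Finset (Fin D)}
    {z : Fin D → ℝ} (h : emarginal Zsp p S z ≠ ∞) :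
    ENNReal.ofReal (marginal Zsp p S z) = emarginal Zsp p S z := by
  rw [marginal_eq_toReal hp hp0, ENNReal.ofReal_toReal h]

theorem lintegral_emarginal_insert (hp : Measurable p) {S : Finset (Fin D)} {j : Fin D}
    (hj : j ∉ S) (z : Fin D → ℝ) :
    ∫⁻ x in Zsp j, emarginal Zsp p (insert j S) (Function.update z j x) =
      emarginal Zsp p S z := by
  have h1 : Sᶜ = insert j (insert j S)ᶜ := by
    ext k
    by_cases hk : k = j <;> simp [hk, hj]
  rw [emarginal, emarginal, h1, lmarginal_insert _ hp.ennreal_ofReal (by simp)]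

/-- Integrals of functions of the coordinates in `S` under the law are integrals against the
marginal density. -/
theorem lintegral_law_eq_lmarginal (hp : Measurable p) (S : Finset (Fin D))
    {H : (Fin D → ℝ) → ℝ≥0∞} (hH : Measurable H) (hHS : ∀ y z, (∀ k ∈ S, y k = z k) → H y = H z)
    (z : Fin D → ℝ) :
    ∫⁻ y, H y ∂(law Zsp p) =
      (∫⋯∫⁻_S, (fun y => H y * emarginal Zsp p S y) ∂coordMeasure Zsp) z := by
  have h1 : ∀ y, (∫⋯∫⁻_Sᶜ, (fun y => H y * ENNReal.ofReal (p y)) ∂coordMeasure Zsp) y =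
      H y * emarginal Zsp p S y := by
    intro y
    rw [emarginal, const_mul_lmarginal _ _ hp.ennreal_ofReal, lmarginal]
    refine lintegral_congr fun u => ?_
    rw [hHS (Function.updateFinset y Sᶜ u) y fun k hk => by simp [Function.updateFinset, hk]]
  rw [law, lintegral_withDensity_eq_lintegral_mul _ hp.ennreal_ofReal hH, restrict_space_eq_pi,
    lintegral_eq_lmarginal_univ z, ← funext h1,
    ← lmarginal_union (coordMeasure Zsp) (fun y => H y * ENNReal.ofReal (p y))
      (hH.mul hp.ennreal_ofReal) disjoint_compl_right, Finset.union_compl,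
    mul_comm]
  rfl

variable {G : ADMG (Fin D)}

theorem measurable_condDensity (hp : Measurable p) (hp0 : ∀ z, 0 ≤ p z) (j : Fin D) :
    Measurable (condDensity G Zsp p j) :=
  (measurable_marginal hp hp0 _).div (measurable_marginal hp hp0 _)

theorem condDensity_nonneg (hp : Measurable p) (hp0 : ∀ z, 0 ≤ p z) (j : Fin D)
    (z : Fin D → ℝ) : 0 ≤ condDensity G Zsp p j z :=
  div_nonneg (marginal_nonneg hp hp0 _ z) (marginal_nonneg hp hp0 _ z)

theorem condDensity_congr (hp : Measurable p) (hp0 : ∀ z, 0 ≤ p z) {j : Fin D} {y z : Fin D → ℝ}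
    (h : ∀ k ≤ j, y k = z k) : condDensity G Zsp p j y = condDensity G Zsp p j z := by
  have h1 : ∀ k ∈ G.mp j, y k = z k := fun k hk => h k (G.mp_lt hk).le
  rw [condDensity, condDensity, marginal_congr hp hp0 h1, marginal_congr hp hp0 (z := z)]
  intro k hk
  rcases Finset.mem_insert.mp hk with rfl | hk
  · exact h k le_rfl
  · exact h1 k hk

/-- The pillow density is constant in coordinate `j`, and integrating the joint marginal over that
coordinate returns it. Points where the joint marginal is infinite form a null set of `x`, as the
total is finite. -/
theorem lintegral_condDensity (hp : Measurable p) (hp0 : ∀ z, 0 ≤ p z) (j : Fin D)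
    {z : Fin D → ℝ} (hz : 0 < marginal Zsp p (G.mp j) z) :
    ∫⁻ x in Zsp j, ENNReal.ofReal (condDensity G Zsp p j (Function.update z j x)) = 1 := by
  have hj : j ∉ G.mp j := fun hc => lt_irrefl _ (G.mp_lt hc)
  have hins := lintegral_emarginal_insert (Zsp := Zsp) hp hj z
  have htop := emarginal_ne_top hp hp0 hz
  have hm : Measurable fun x => emarginal Zsp p (insert j (G.mp j)) (Function.update z j x) :=
    (measurable_emarginal hp _).comp (measurable_update z)
  have hfin := ae_lt_top hm (hins ▸ htop)
  have h1 : ∀ᵐ x ∂(volume.restrict (Zsp j)),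
      ENNReal.ofReal (condDensity G Zsp p j (Function.update z j x)) =
        emarginal Zsp p (insert j (G.mp j)) (Function.update z j x) / emarginal Zsp p (G.mp j) z := by
    filter_upwards [hfin] with x hx
    rw [condDensity, marginal_congr hp hp0 (S := G.mp j) (z := z), ENNReal.ofReal_div_of_pos hz,
      ofReal_marginal hp hp0 hx.ne, ofReal_marginal hp hp0 htop]
    intro k hk
    exact Function.update_of_ne (G.mp_lt hk).ne _ _
  rw [lintegral_congr_ae h1]
  simp only [div_eq_mul_inv]
  rw [lintegral_mul_const _ hm, hins]
  refine ENNReal.mul_inv_cancel ?_ htop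
  intro h0
  rw [marginal_eq_toReal hp hp0, h0] at hz
  simp at hz

end density

/-! ### Marginalized losses -/

section tailLoss

variable {D : ℕ}

/-- The function `g` with the coordinates from `m` on integrated out against their conditional
densities. -/
noncomputable def tailLoss (G : ADMG (Fin D)) (Zsp : Fin D → Set ℝ) (p : (Fin D → ℝ) → ℝ)
    (g : (Fin D → ℝ) → ℝ) (m : ℕ) : (Fin D → ℝ) → ℝ≥0∞ :=
  ∫⋯∫⁻_(Finset.univ.filter fun k : Fin D => m ≤ k), (fun z => ENNReal.ofReal
    (g z * ∏ k ∈ Finset.univ.filter fun k : Fin D => m ≤ k, condDensity G Zsp p k z))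
    ∂coordMeasure Zsp

variable {G : ADMG (Fin D)} {Zsp : Fin D → Set ℝ} {p : (Fin D → ℝ) → ℝ} {g : (Fin D → ℝ) → ℝ}

theorem measurable_mul_prod_condDensity (hp : Measurable p) (hp0 : ∀ z, 0 ≤ p z)
    (hg : Measurable g) (s : Finset (Fin D)) :
    Measurable fun z => g z * ∏ k ∈ s, condDensity G Zsp p k z :=
  hg.mul (Finset.measurable_prod _ fun k _ => measurable_condDensity hp hp0 k)

theorem measurable_tailLoss (hp : Measurable p) (hp0 : ∀ z, 0 ≤ p z)
    (hg : Measurable g) (m : ℕ) : Measurable (tailLoss G Zsp p g m) :=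
  (measurable_mul_prod_condDensity hp hp0 hg _).ennreal_ofReal.lmarginal _

theorem filter_le_eq_insert (j : Fin D) :
    (Finset.univ.filter fun k : Fin D => (j : ℕ) ≤ k) =
      insert j (Finset.univ.filter fun k : Fin D => (j : ℕ) + 1 ≤ k) := by
  ext k
  simp only [Finset.mem_filter, Finset.mem_univ, true_and, Finset.mem_insert, Fin.ext_iff]
  omega

theorem tailLoss_congr (m : ℕ) {y z : Fin D → ℝ} (h : ∀ k : Fin D, (k : ℕ) < m → y k = z k) :
    tailLoss G Zsp p g m y = tailLoss G Zsp p g m z :=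
  lmarginal_congr _ _ fun k hk => h k (by simpa using hk)

/-- The recursion behind the telescoping: the conditional density of coordinate `j` involves no
later coordinate, so it leaves the inner integral. -/
theorem tailLoss_eq_lintegral (hp : Measurable p) (hp0 : ∀ z, 0 ≤ p z) (hg : Measurable g)
    (j : Fin D) (z : Fin D → ℝ) :
    tailLoss G Zsp p g j z = ∫⁻ x in Zsp j,
      ENNReal.ofReal (condDensity G Zsp p j (Function.update z j x)) *
        tailLoss G Zsp p g (j + 1) (Function.update z j x) := by
  have hj : j ∉ Finset.univ.filter fun k : Fin D => (j : ℕ) + 1 ≤ k := by simp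
  rw [tailLoss, filter_le_eq_insert,
    lmarginal_insert _ (measurable_mul_prod_condDensity hp hp0 hg _).ennreal_ofReal hj]
  refine lintegral_congr fun x => ?_
  rw [tailLoss, const_mul_lmarginal _ _ (measurable_mul_prod_condDensity hp hp0 hg _).ennreal_ofReal,
    lmarginal]
  refine lintegral_congr fun u => ?_
  rw [← ENNReal.ofReal_mul (condDensity_nonneg hp hp0 _ _), Finset.prod_insert hj,
    condDensity_congr hp hp0 (j := j)
      (y := Function.updateFinset (Function.update z j x) _ u) (z := Function.update z j x)]
  · congr 1
    ring
  · intro k hk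
    have : ¬ j < k := not_lt.mpr hk
    simp [Function.updateFinset, this]

/-- Downward induction from the last coordinate. Each step averages against a conditional density of
total mass one, so the bound `B` persists. -/
theorem tailLoss_le (hp : Measurable p) (hp0 : ∀ z, 0 ≤ p z) (hg : Measurable g)
    (hpos : ∀ j, ∀ z ∈ space Zsp, 0 < marginal Zsp p (G.mp j) z)
    (hZ : ∀ j, IsCompact (Zsp j)) {B : ℝ} (hB : ∀ z, g z ≤ B) (m : ℕ) :
    ∀ z ∈ space Zsp, tailLoss G Zsp p g m z ≤ ENNReal.ofReal B := by
  obtain ⟨d, hd⟩ : ∃ d, D ≤ m + d := ⟨D, by omega⟩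
  have hfin : ∀ m, D ≤ m → ∀ z ∈ space Zsp, tailLoss G Zsp p g m z ≤ ENNReal.ofReal B := by
    intro m hm z _
    have he : (Finset.univ.filter fun k : Fin D => m ≤ k) = ∅ := by
      ext k
      simp only [Finset.mem_filter, Finset.mem_univ, true_and, Finset.notMem_empty, iff_false]
      omega
    rw [tailLoss, he, lmarginal_empty]
    simpa using ENNReal.ofReal_le_ofReal (hB z)
  induction d generalizing m with
  | zero => exact hfin m hd
  | succ d ih =>
    rcases le_or_gt D m with hm | hm
    · exact hfin m hm
    intro z hz
    have h1 := tailLoss_eq_lintegral (G := G) (Zsp := Zsp) hp hp0 hg ⟨m, hm⟩ z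
    simp only at h1
    rw [h1]
    calc _ ≤ ∫⁻ x in Zsp ⟨m, hm⟩,
          ENNReal.ofReal (condDensity G Zsp p ⟨m, hm⟩ (Function.update z ⟨m, hm⟩ x)) *
            ENNReal.ofReal B := by
          refine setLIntegral_mono' (hZ _).measurableSet fun x hx => ?_
          exact mul_le_mul_right (ih (m + 1) (by omega) _ (update_mem_space hz hx)) _
      _ = ENNReal.ofReal B := by
          have hm' : Measurable fun x =>
              ENNReal.ofReal (condDensity G Zsp p ⟨m, hm⟩ (Function.update z ⟨m, hm⟩ x)) :=
            ((measurable_condDensity hp hp0 _).comp (measurable_update z)).ennreal_ofReal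
          rw [lintegral_mul_const _ hm', lintegral_condDensity hp hp0 _ (hpos _ z hz), one_mul]

variable {F : Type*} {ℓ : F → (Fin D → ℝ) → ℝ}

theorem margLoss_eq_toReal (hp : Measurable p) (hp0 : ∀ z, 0 ≤ p z)
    (hℓ : ∀ f, Measurable (ℓ f)) (hℓ0 : ∀ f z, 0 ≤ ℓ f z) (j : Fin D) (f : F) (z : Fin D → ℝ) :
    margLoss G Zsp p ℓ j f z = (tailLoss G Zsp p (ℓ f) (j + 1) z).toReal := by
  have he : (Finset.univ.filter fun k : Fin D => (j : ℕ) + 1 ≤ k) = Finset.Ioi j := by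
    ext k
    simp only [Finset.mem_filter, Finset.mem_univ, true_and, Finset.mem_Ioi, Fin.lt_def]
    omega
  rw [margLoss, tailLoss, he, integrateOut_eq_toReal _ _
    (measurable_mul_prod_condDensity hp hp0 (hℓ f) _)]
  exact fun z => mul_nonneg (hℓ0 f z) (Finset.prod_nonneg fun k _ => condDensity_nonneg hp hp0 k z)

/-- Here the factorization of `p` enters. With all coordinates integrated out, the value no longer
depends on the point `z`. -/
theorem risk_eq_toReal (hp : Measurable p) (hp0 : ∀ z, 0 ≤ p z) (hfact : Factorizes G Zsp p)
    (hℓ : ∀ f, Measurable (ℓ f)) (hℓ0 : ∀ f z, 0 ≤ ℓ f z) (f : F) (z : Fin D → ℝ) :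
    risk Zsp p ℓ f = (tailLoss G Zsp p (ℓ f) 0 z).toReal := by
  have he : (Finset.univ.filter fun k : Fin D => 0 ≤ (k : ℕ)) = Finset.univ := by simp
  rw [risk, integral_eq_lintegral_of_nonneg_ae (.of_forall (hℓ0 f)) (hℓ f).aestronglyMeasurable,
    law, lintegral_withDensity_eq_lintegral_mul _ hp.ennreal_ofReal (hℓ f).ennreal_ofReal,
    tailLoss, he, lmarginal_univ, ← restrict_space_eq_pi]
  congr 1
  refine lintegral_congr_ae ?_
  filter_upwards [hfact] with y hy
  rw [Pi.mul_apply, hy, ← ENNReal.ofReal_mul (Finset.prod_nonneg fun k _ =>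
    condDensity_nonneg hp hp0 k y), mul_comm]

end tailLoss

/-! ### Bias of the smoothed conditional means -/

section bias

variable {D : ℕ} {Zsp : Fin D → Set ℝ} {p : (Fin D → ℝ) → ℝ} {S : Finset (Fin D)}

theorem ae_law_mem_space (hZ : ∀ j, IsCompact (Zsp j)) (p : (Fin D → ℝ) → ℝ) :
    ∀ᵐ y ∂(law Zsp p), y ∈ space Zsp :=
  (withDensity_absolutelyContinuous _ _).ae_le (ae_restrict_mem (measurableSet_space hZ))

theorem continuousOn_integrable_box (hZ : ∀ j, IsCompact (Zsp j)) {g : (S → ℝ) → ℝ}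
    (hg : Continuous g) : IntegrableOn g (box Zsp S) :=
  hg.continuousOn.integrableOn_compact (isCompact_box hZ S)

theorem restrict_updateFinset_self (z : Fin D → ℝ) (u : S → ℝ) :
    S.restrict (Function.updateFinset z S u) = u := by
  ext k
  simp [Function.updateFinset]

theorem extension_eq_marginal {j : Fin D} (hj : j ∉ S) {q : ℝ → (S → ℝ) → ℝ}
    (hqm : ∀ z ∈ space Zsp, q (z j) (S.restrict z) = marginal Zsp p (insert j S) z)
    {z : Fin D → ℝ} (hz : z ∈ space Zsp) {x : ℝ} (hx : x ∈ Zsp j) {u : S → ℝ}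
    (hu : u ∈ box Zsp S) :
    q x u = marginal Zsp p (insert j S) (Function.updateFinset (Function.update z j x) S u) := by
  rw [← hqm _ (updateFinset_mem_space (update_mem_space hz hx) hu), restrict_updateFinset_self]
  simp [Function.updateFinset, hj]

theorem integral_law_restrict (hp : Measurable p) (hp0 : ∀ z, 0 ≤ p z)
    (hZ : ∀ j, IsCompact (Zsp j)) (hpos : ∀ z ∈ space Zsp, 0 < marginal Zsp p S z)
    {g : (S → ℝ) → ℝ} (hg : Continuous g)
    (hgm : ∀ z ∈ space Zsp, g (S.restrict z) = marginal Zsp p S z)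
    {κ : (S → ℝ) → ℝ} (hκ : Continuous κ) (hκ0 : ∀ u, 0 ≤ κ u) {z : Fin D → ℝ}
    (hz : z ∈ space Zsp) :
    ∫ y, κ (S.restrict y) ∂(law Zsp p) = ∫ u in box Zsp S, κ u * g u := by
  have hκm : Measurable fun y : Fin D → ℝ => κ (S.restrict y) :=
    hκ.measurable.comp (Finset.measurable_restrict S)
  have hpt : ∀ u ∈ box Zsp S, g u = marginal Zsp p S (Function.updateFinset z S u) := fun u hu => by
    rw [← hgm _ (updateFinset_mem_space hz hu), restrict_updateFinset_self]
  have hae : ∀ᵐ u ∂(volume.restrict (box Zsp S)), 0 ≤ κ u * g u := by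
    filter_upwards [ae_restrict_mem (measurableSet_box hZ S)] with u hu
    rw [hpt u hu]
    exact mul_nonneg (hκ0 u) (marginal_nonneg hp hp0 _ _)
  rw [integral_eq_lintegral_of_nonneg_ae (.of_forall fun y => hκ0 _) hκm.aestronglyMeasurable,
    integral_eq_lintegral_of_nonneg_ae hae (hκ.mul hg).aestronglyMeasurable,
    lintegral_law_eq_lmarginal hp S hκm.ennreal_ofReal (fun y y' hy => ?_) z, lmarginal,
    ← restrict_box_eq_pi]
  · congr 1
    refine setLIntegral_congr_fun (measurableSet_box hZ S) fun u hu => ?_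
    have hmem := updateFinset_mem_space hz hu
    simp only [restrict_updateFinset_self]
    rw [← ofReal_marginal hp hp0 (emarginal_ne_top hp hp0 (hpos _ hmem)), ← hpt u hu,
      ← ENNReal.ofReal_mul (hκ0 u)]
  · have : S.restrict y = S.restrict y' := funext fun k => hy k k.2
    rw [this]

theorem lintegral_law_prod (hp : Measurable p) {j : Fin D} (hj : j ∉ S) {b : ℝ → ℝ≥0∞}
    (hb : Measurable b) {κ : (S → ℝ) → ℝ≥0∞} (hκ : Measurable κ) (z : Fin D → ℝ) :
    ∫⁻ y, b (y j) * κ (S.restrict y) ∂(law Zsp p) =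
      ∫⁻ x in Zsp j, b x * ∫⁻ u in box Zsp S,
        κ u * emarginal Zsp p (insert j S) (Function.updateFinset (Function.update z j x) S u) := by
  have hH : Measurable fun y : Fin D → ℝ => b (y j) * κ (S.restrict y) :=
    (hb.comp (measurable_pi_apply j)).mul (hκ.comp (Finset.measurable_restrict S))
  rw [lintegral_law_eq_lmarginal hp (insert j S) hH (fun y y' hy => ?_) z,
    lmarginal_insert (fun y => b (y j) * κ (S.restrict y) * emarginal Zsp p (insert j S) y)
      (hH.mul (measurable_emarginal hp _)) hj]
  · refine lintegral_congr fun x => ?_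
    rw [← lintegral_const_mul, lmarginal, ← restrict_box_eq_pi]
    · refine lintegral_congr fun u => ?_
      rw [restrict_updateFinset_self]
      simp [Function.updateFinset, hj, mul_assoc]
    · exact hκ.mul ((measurable_emarginal hp _).comp measurable_updateFinset)
  · have : S.restrict y = S.restrict y' := funext fun k => hy k (Finset.mem_insert_of_mem k.2)
    rw [this, hy j (Finset.mem_insert_self j S)]

theorem measurable_lintegral_emarginal (hp : Measurable p) (j : Fin D) {κ : (S → ℝ) → ℝ≥0∞}
    (hκ : Measurable κ) (z : Fin D → ℝ) :
    Measurable fun x => ∫⁻ u in box Zsp S,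
        κ u * emarginal Zsp p (insert j S)
          (Function.updateFinset (Function.update z j x) S u) := by
  have h1 : Measurable fun w : ℝ × (S → ℝ) =>
      Function.updateFinset (Function.update z j w.1) S w.2 :=
    measurable_updateFinset'.comp (((measurable_update z).comp measurable_fst).prodMk measurable_snd)
  exact Measurable.lintegral_prod_right' (f := fun w : ℝ × (S → ℝ) => κ w.2 *
    emarginal Zsp p (insert j S) (Function.updateFinset (Function.update z j w.1) S w.2))
    ((hκ.comp measurable_snd).mul ((measurable_emarginal hp _).comp h1))

/-- The integrand on the left could be infinite on a small set. The law has finite mass, so for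
almost every `x` the marginal is finite for almost every `u`; there it agrees with the extension,
which is continuous and hence integrable on the compact box. -/
theorem lintegral_kernel_emarginal (hp : Measurable p) (hp0 : ∀ z, 0 ≤ p z)
    (hZ : ∀ j, IsCompact (Zsp j)) [IsFiniteMeasure (law Zsp p)] {j : Fin D} (hj : j ∉ S)
    {q : ℝ → (S → ℝ) → ℝ} (hq : ∀ x ∈ Zsp j, Continuous (q x))
    (hqm : ∀ z ∈ space Zsp, q (z j) (S.restrict z) = marginal Zsp p (insert j S) z)
    {κ : (S → ℝ) → ℝ} (hκ : Continuous κ) (hκ0 : ∀ u, 0 ≤ κ u) {z : Fin D → ℝ}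
    (hz : z ∈ space Zsp) :
    ∀ᵐ x ∂(volume.restrict (Zsp j)), ∫⁻ u in box Zsp S, ENNReal.ofReal (κ u) *
        emarginal Zsp p (insert j S) (Function.updateFinset (Function.update z j x) S u) =
      ENNReal.ofReal (∫ u in box Zsp S, κ u * q x u) := by
  have h1 := lintegral_law_prod (Zsp := Zsp) hp hj (b := fun _ => 1) measurable_const
    (κ := fun _ => 1) measurable_const z
  have h2 : ∫⁻ x in Zsp j, (1 : ℝ≥0∞) * ∫⁻ u in box Zsp S, 1 *
      emarginal Zsp p (insert j S) (Function.updateFinset (Function.update z j x) S u) ≠ ∞ := by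
    rw [← h1]
    simp
  simp only [one_mul] at h2
  have h0 := measurable_lintegral_emarginal (Zsp := Zsp) (S := S) hp j (κ := fun _ => 1)
    measurable_const z
  simp only [one_mul] at h0
  have h3 := ae_lt_top h0 h2
  filter_upwards [h3, ae_restrict_mem (hZ j).measurableSet] with x hx hxj
  have h4 := ae_lt_top (f := fun u => emarginal Zsp p (insert j S)
    (Function.updateFinset (Function.update z j x) S u))
    ((measurable_emarginal hp _).comp measurable_updateFinset) hx.ne
  have hpt : ∀ u ∈ box Zsp S, q x u = marginal Zsp p (insert j S)
      (Function.updateFinset (Function.update z j x) S u) := fun u hu =>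
    extension_eq_marginal hj hqm hz hxj hu
  have hae : ∀ᵐ u ∂(volume.restrict (box Zsp S)), 0 ≤ κ u * q x u := by
    filter_upwards [ae_restrict_mem (measurableSet_box hZ S)] with u hu
    rw [hpt u hu]
    exact mul_nonneg (hκ0 u) (marginal_nonneg hp hp0 _ _)
  rw [ofReal_integral_eq_lintegral_ofReal (f := fun u => κ u * q x u)
    (continuousOn_integrable_box hZ (hκ.mul (hq x hxj))) hae]
  refine lintegral_congr_ae ?_
  filter_upwards [h4, ae_restrict_mem (measurableSet_box hZ S)] with u hu hub
  rw [ENNReal.ofReal_mul (hκ0 u), hpt u hub, ofReal_marginal hp hp0 hu.ne]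

theorem integral_law_prod (hp : Measurable p) (hp0 : ∀ z, 0 ≤ p z)
    (hZ : ∀ j, IsCompact (Zsp j)) [IsFiniteMeasure (law Zsp p)] {j : Fin D} (hj : j ∉ S)
    {q : ℝ → (S → ℝ) → ℝ} (hq : ∀ x ∈ Zsp j, Continuous (q x))
    (hqm : ∀ z ∈ space Zsp, q (z j) (S.restrict z) = marginal Zsp p (insert j S) z)
    {κ : (S → ℝ) → ℝ} (hκ : Continuous κ) (hκ0 : ∀ u, 0 ≤ κ u) {C : ℝ} (hC : ∀ u, κ u ≤ C)
    {b : ℝ → ℝ} (hb : Measurable b) (hb0 : ∀ x, 0 ≤ b x) {B : ℝ} (hB : ∀ x ∈ Zsp j, b x ≤ B)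
    {z : Fin D → ℝ} (hz : z ∈ space Zsp) :
    IntegrableOn (fun x => b x * ∫ u in box Zsp S, κ u * q x u) (Zsp j) ∧
      ∫ y, b (y j) * κ (S.restrict y) ∂(law Zsp p) =
        ∫ x in Zsp j, b x * ∫ u in box Zsp S, κ u * q x u := by
  have hker := lintegral_kernel_emarginal hp hp0 hZ hj hq hqm hκ hκ0 hz
  have hI0 : ∀ᵐ x ∂(volume.restrict (Zsp j)), 0 ≤ b x * ∫ u in box Zsp S, κ u * q x u := by
    filter_upwards [ae_restrict_mem (hZ j).measurableSet] with x hxj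
    refine mul_nonneg (hb0 x) (setIntegral_nonneg (measurableSet_box hZ S) fun u hu => ?_)
    rw [extension_eq_marginal hj hqm hz hxj hu]
    exact mul_nonneg (hκ0 u) (marginal_nonneg hp hp0 _ _)
  have hΦ := measurable_lintegral_emarginal (Zsp := Zsp) hp j (κ := fun u => ENNReal.ofReal (κ u))
    hκ.measurable.ennreal_ofReal z
  have hlin : ∫⁻ y, ENNReal.ofReal (b (y j) * κ (S.restrict y)) ∂(law Zsp p) =
      ∫⁻ x in Zsp j, ENNReal.ofReal (b x * ∫ u in box Zsp S, κ u * q x u) := by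
    have h1 := lintegral_law_prod (Zsp := Zsp) hp hj hb.ennreal_ofReal
      (κ := fun u => ENNReal.ofReal (κ u)) hκ.measurable.ennreal_ofReal z
    simp only [← ENNReal.ofReal_mul (hb0 _)] at h1
    rw [h1]
    refine lintegral_congr_ae ?_
    filter_upwards [hker] with x hx
    rw [hx, ENNReal.ofReal_mul (hb0 x)]
  have hfin : ∫⁻ y, ENNReal.ofReal (b (y j) * κ (S.restrict y)) ∂(law Zsp p) ≠ ∞ := by
    have h1 : ∫⁻ y, ENNReal.ofReal (b (y j) * κ (S.restrict y)) ∂(law Zsp p) ≤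
        ∫⁻ _, ENNReal.ofReal (B * C) ∂(law Zsp p) := by
      refine lintegral_mono_ae ?_
      filter_upwards [ae_law_mem_space hZ p] with y hy
      have h2 := hB (y j) (hy j trivial)
      refine ENNReal.ofReal_le_ofReal (mul_le_mul h2 (hC _) (hκ0 _) ((hb0 _).trans h2))
    refine (h1.trans_lt ?_).ne
    rw [lintegral_const]
    exact ENNReal.mul_lt_top ENNReal.ofReal_lt_top (measure_lt_top _ _)
  -- Measurability in `x` comes from the marginal of `p`, with which the integral of the extension
  -- agrees almost everywhere on `Zsp j`.
  have hmeas : AEStronglyMeasurable (fun x => b x * ∫ u in box Zsp S, κ u * q x u)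
      (volume.restrict (Zsp j)) := by
    refine ((hb.mul hΦ.ennreal_toReal).aestronglyMeasurable).congr ?_
    filter_upwards [hker, ae_restrict_mem (hZ j).measurableSet] with x hx hxj
    simp only [Pi.mul_apply]
    rw [hx, ENNReal.toReal_ofReal]
    refine setIntegral_nonneg (measurableSet_box hZ S) fun u hu => ?_
    rw [extension_eq_marginal hj hqm hz hxj hu]
    exact mul_nonneg (hκ0 u) (marginal_nonneg hp hp0 _ _)
  refine ⟨⟨hmeas, ?_⟩, ?_⟩
  · rw [hasFiniteIntegral_iff_ofReal hI0, ← hlin]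
    exact hfin.lt_top
  · rw [integral_eq_lintegral_of_nonneg_ae hI0 hmeas,
      integral_eq_lintegral_of_nonneg_ae (.of_forall fun y => mul_nonneg (hb0 _) (hκ0 _)), hlin]
    exact ((hb.comp (measurable_pi_apply j)).mul
      (hκ.measurable.comp (Finset.measurable_restrict S))).aestronglyMeasurable

/-- Writing `N / Dn - q / r = ((N - q) - (N / Dn) (Dn - r)) / r` uses only that the first ratio lies
in `[0, B]` and that `r ≥ ε`. No lower bound on `Dn` beyond positivity enters. -/
theorem abs_ratio_sub_ratio_le {N Dn q r B e₁ e₂ ε : ℝ} (h₁ : |N - q| ≤ e₁) (h₂ : |Dn - r| ≤ e₂)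
    (hN0 : 0 ≤ N) (hN : N ≤ B * Dn) (hD : 0 < Dn) (hε : 0 < ε) (hr : ε ≤ r) :
    |N / Dn - q / r| ≤ (e₁ + B * e₂) / ε := by
  have hr0 : 0 < r := hε.trans_le hr
  have hc : N / Dn ≤ B := by rwa [div_le_iff₀ hD]
  have hc0 : 0 ≤ N / Dn := by positivity
  have he₂ : 0 ≤ e₂ := (abs_nonneg _).trans h₂
  have h3 : N / Dn - q / r = ((N - q) - N / Dn * (Dn - r)) / r := by
    field_simp
    ring
  rw [h3, abs_div, abs_of_pos hr0]
  have h4 : |(N - q) - N / Dn * (Dn - r)| ≤ e₁ + B * e₂ := by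
    refine (abs_sub _ _).trans (add_le_add h₁ ?_)
    rw [abs_mul, abs_of_nonneg hc0]
    exact mul_le_mul hc h₂ (abs_nonneg _) (hc0.trans hc)
  exact div_le_div₀ ((abs_nonneg _).trans h4) h4 hε hr

end bias

/-! ### Smoothed conditional means of the marginalized losses -/

section condMean

variable {D : ℕ} {Zsp : Fin D → Set ℝ} {p : (Fin D → ℝ) → ℝ} {S : Finset (Fin D)}

theorem integrableOn_mul_extension (hp : Measurable p) (hp0 : ∀ z, 0 ≤ p z)
    (hZ : ∀ j, IsCompact (Zsp j)) (hpos : ∀ z ∈ space Zsp, 0 < marginal Zsp p S z) {j : Fin D}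
    (hj : j ∉ S) {q : ℝ → (S → ℝ) → ℝ}
    (hqm : ∀ z ∈ space Zsp, q (z j) (S.restrict z) = marginal Zsp p (insert j S) z)
    {b : ℝ → ℝ} (hb : Measurable b) (hb0 : ∀ x, 0 ≤ b x) {B : ℝ} (hB : ∀ x ∈ Zsp j, b x ≤ B)
    {z : Fin D → ℝ} (hz : z ∈ space Zsp) :
    IntegrableOn (fun x => b x * q x (S.restrict z)) (Zsp j) := by
  have h1 : IntegrableOn (fun x => marginal Zsp p (insert j S) (Function.update z j x)) (Zsp j) := by
    simp only [marginal_eq_toReal hp hp0]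
    refine integrable_toReal_of_lintegral_ne_top
      (((measurable_emarginal hp _).comp (measurable_update z)).aemeasurable) ?_
    have h2 := lintegral_emarginal_insert (Zsp := Zsp) hp hj z
    rw [h2]
    exact emarginal_ne_top hp hp0 (hpos z hz)
  have h3 : IntegrableOn (fun x => b x * marginal Zsp p (insert j S) (Function.update z j x))
      (Zsp j) := by
    refine (h1.const_mul B).mono' (hb.mul ((measurable_marginal hp hp0 _).comp
      (measurable_update z))).aestronglyMeasurable ?_
    filter_upwards [ae_restrict_mem (hZ j).measurableSet] with x hx
    have hm := marginal_nonneg (Zsp := Zsp) hp hp0 (insert j S) (Function.update z j x)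
    rw [Real.norm_of_nonneg (mul_nonneg (hb0 x) hm)]
    exact mul_le_mul_of_nonneg_right (hB x hx) hm
  refine h3.congr_fun (fun x hx => ?_) (hZ j).measurableSet
  have h4 := hqm _ (update_mem_space hz hx)
  have h5 : S.restrict (Function.update z j x) = S.restrict z := funext fun k =>
    Function.update_of_ne (ne_of_mem_of_not_mem k.2 hj) _ _
  rw [h5, Function.update_self] at h4
  simp only [h4]

/-- The bias of the ratio of smoothed densities. -/
theorem abs_smoothed_condMean_sub_le (hp : Measurable p) (hp0 : ∀ z, 0 ≤ p z)
    (hZ : ∀ j, IsCompact (Zsp j)) [IsProbabilityMeasure (law Zsp p)] {j : Fin D} (hj : j ∉ S)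
    {ε : ℝ} (hε : 0 < ε) (hpos : ∀ z ∈ space Zsp, ε ≤ marginal Zsp p S z)
    {h : Fin D → ℝ} (hh : ∀ k, 0 < h k) {β L : ℝ} (hβ : 1 < β) (hL : 0 < L)
    {K : (S → ℝ) → ℝ} (hK : Continuous K) (hK0 : ∀ u, 0 < K u) {C : ℝ} (hC : ∀ u, |K u| ≤ C)
    (hKo : IsKernelOfOrder ⌊β⌋₊ K) (hKm : Integrable fun u => |K u| * euclNorm u ^ β)
    {r : (S → ℝ) → ℝ} {q : ℝ → (S → ℝ) → ℝ}
    (hrm : ∀ z ∈ space Zsp, r (S.restrict z) = marginal Zsp p S z)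
    (hqm : ∀ z ∈ space Zsp, q (z j) (S.restrict z) = marginal Zsp p (insert j S) z)
    (hrh : r ∈ HolderClass β L) (hqh : ∀ x ∈ Zsp j, q x ∈ HolderClass β L)
    (hri : IntegrableOn r (box Zsp S)ᶜ)
    (hqi : IntegrableOn (Function.uncurry q) (Zsp j ×ˢ (box Zsp S)ᶜ))
    {b : ℝ → ℝ} (hb : Measurable b) (hb0 : ∀ x, 0 ≤ b x) {B : ℝ} (hB0 : 0 ≤ B)
    (hB : ∀ x ∈ Zsp j, b x ≤ B) {z : Fin D → ℝ} (hz : z ∈ space Zsp) :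
    0 < ∫ y, scaledKernel h S K (S.restrict z - S.restrict y) ∂(law Zsp p) ∧
    0 ≤ ∫ y, b (y j) * scaledKernel h S K (S.restrict z - S.restrict y) ∂(law Zsp p) ∧
    ∫ y, b (y j) * scaledKernel h S K (S.restrict z - S.restrict y) ∂(law Zsp p) ≤
      B * ∫ y, scaledKernel h S K (S.restrict z - S.restrict y) ∂(law Zsp p) ∧
    |(∫ y, b (y j) * scaledKernel h S K (S.restrict z - S.restrict y) ∂(law Zsp p)) /
        (∫ y, scaledKernel h S K (S.restrict z - S.restrict y) ∂(law Zsp p)) -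
        (∫ x in Zsp j, b x * q x (S.restrict z)) / marginal Zsp p S z| ≤
      (B * (volume.real (Zsp j) * (holderConst β L K * bandwidthNorm h S ^ β) +
          kernelTail Zsp h S K * ∫ x in Zsp j, ∫ u in (box Zsp S)ᶜ, |q x u|) +
        B * (holderConst β L K * bandwidthNorm h S ^ β +
          kernelTail Zsp h S K * ∫ u in (box Zsp S)ᶜ, |r u|)) / ε := by
  set κ : (S → ℝ) → ℝ := fun u => scaledKernel h S K (S.restrict z - u) with hκdef
  have hκ : Continuous κ := (continuous_scaledKernel hK).comp (continuous_const.sub continuous_id)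
  have hκ0 : ∀ u, 0 < κ u := fun u => scaledKernel_pos hh hK0 _
  have hκC : ∀ u, κ u ≤ C / |(bandwidth h S).det| := fun u =>
    (le_abs_self _).trans (scaledKernel_le hh hC _)
  have hpos' : ∀ z ∈ space Zsp, 0 < marginal Zsp p S z := fun z hz => hε.trans_le (hpos z hz)
  have hzb := restrict_mem_box hz S
  have hκm : Measurable fun y : Fin D → ℝ => κ (S.restrict y) :=
    hκ.measurable.comp (Finset.measurable_restrict S)
  have hκi : Integrable (fun y => κ (S.restrict y)) (law Zsp p) :=
    .of_bound hκm.aestronglyMeasurable (C / |(bandwidth h S).det|) (.of_forall fun y => by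
      rw [Real.norm_of_nonneg (hκ0 _).le]; exact hκC _)
  have hspace := ae_law_mem_space hZ p
  have hDpos : 0 < ∫ y, κ (S.restrict y) ∂(law Zsp p) := by
    rw [integral_pos_iff_support_of_nonneg (fun y => (hκ0 _).le) hκi]
    have : Function.support (fun y : Fin D → ℝ => κ (S.restrict y)) = Set.univ :=
      Set.eq_univ_of_forall fun y => (hκ0 _).ne'
    rw [this]
    simp
  have hN0 : 0 ≤ ∫ y, b (y j) * κ (S.restrict y) ∂(law Zsp p) :=
    integral_nonneg fun y => mul_nonneg (hb0 _) (hκ0 _).le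
  have hNB : ∫ y, b (y j) * κ (S.restrict y) ∂(law Zsp p) ≤
      B * ∫ y, κ (S.restrict y) ∂(law Zsp p) := by
    rw [← integral_const_mul]
    refine integral_mono_of_nonneg (.of_forall fun y => mul_nonneg (hb0 _) (hκ0 _).le)
      (hκi.const_mul B) ?_
    filter_upwards [hspace] with y hy
    exact mul_le_mul_of_nonneg_right (hB _ (hy j trivial)) (hκ0 _).le
  refine ⟨hDpos, hN0, hNB, abs_ratio_sub_ratio_le ?_ ?_ hN0 hNB hDpos hε (hpos z hz)⟩
  · obtain ⟨h1, h2⟩ := integral_law_prod hp hp0 hZ hj (fun x hx => (hqh x hx).1.continuous) hqm hκ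
      (fun u => (hκ0 u).le) hκC hb hb0 hB hz
    have h3 := integrableOn_mul_extension hp hp0 hZ hpos' hj hqm hb hb0 hB hz
    have hprod : (volume : Measure (ℝ × (S → ℝ))).restrict (Zsp j ×ˢ (box Zsp S)ᶜ) =
        (volume.restrict (Zsp j)).prod (volume.restrict (box Zsp S)ᶜ) := by
      rw [Measure.volume_eq_prod, Measure.prod_restrict]
    rw [IntegrableOn, hprod] at hqi
    -- Joint integrability of the extension gives integrable sections for almost every `x`, which is
    -- what `kernel_bias_on` requires before integrating in `x`.
    have h4 := hqi.prod_right_ae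
    have h5 : Integrable (fun x => ∫ u in (box Zsp S)ᶜ, |q x u|) (volume.restrict (Zsp j)) :=
      hqi.norm.integral_prod_left
    have h6 : Integrable (fun _ : ℝ => holderConst β L K * bandwidthNorm h S ^ β)
        (volume.restrict (Zsp j)) :=
      integrableOn_const (hZ j).measure_lt_top.ne
    rw [h2, ← integral_sub h1 h3, ← Real.norm_eq_abs]
    refine (norm_integral_le_of_norm_le ((h6.add (h5.const_mul (kernelTail Zsp h S K))).const_mul B)
      ?_).trans (le_of_eq ?_)
    · filter_upwards [h4, ae_restrict_mem (hZ j).measurableSet] with x hx hxj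
      rw [← mul_sub, norm_mul, Real.norm_of_nonneg (hb0 x), Real.norm_eq_abs]
      exact mul_le_mul (hB x hxj) (kernel_bias_on hh hβ hL hK hKo hKm (hqh x hxj)
        (measurableSet_box hZ S) hx fun u hu => le_kernelTail hh hC hzb hu) (abs_nonneg _) hB0
    · rw [integral_const_mul]
      simp only [Pi.add_apply]
      rw [integral_add h6 (h5.const_mul _), setIntegral_const, integral_const_mul, smul_eq_mul]
  · rw [integral_law_restrict hp hp0 hZ hpos' hrh.1.continuous hrm hκ (fun u => (hκ0 u).le) hz,
      ← hrm z hz]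
    exact kernel_bias_on hh hβ hL hK hKo hKm hrh (measurableSet_box hZ S) hri
      fun u hu => le_kernelTail hh hC hzb hu

variable {G : ADMG (Fin D)} {F : Type*} {ℓ : F → (Fin D → ℝ) → ℝ}

theorem measurable_margLoss (hp : Measurable p) (hp0 : ∀ z, 0 ≤ p z)
    (hℓ : ∀ f, Measurable (ℓ f)) (hℓ0 : ∀ f z, 0 ≤ ℓ f z) (j : Fin D) (f : F) :
    Measurable (margLoss G Zsp p ℓ j f) := by
  rw [funext (margLoss_eq_toReal hp hp0 hℓ hℓ0 j f)]
  exact (measurable_tailLoss hp hp0 (hℓ f) _).ennreal_toReal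

theorem margLoss_nonneg (hp : Measurable p) (hp0 : ∀ z, 0 ≤ p z)
    (hℓ : ∀ f, Measurable (ℓ f)) (hℓ0 : ∀ f z, 0 ≤ ℓ f z) (j : Fin D) (f : F) (z : Fin D → ℝ) :
    0 ≤ margLoss G Zsp p ℓ j f z := by
  rw [margLoss_eq_toReal hp hp0 hℓ hℓ0]
  exact ENNReal.toReal_nonneg

theorem margLoss_le (hp : Measurable p) (hp0 : ∀ z, 0 ≤ p z)
    (hℓ : ∀ f, Measurable (ℓ f)) (hℓ0 : ∀ f z, 0 ≤ ℓ f z)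
    (hpos : ∀ j, ∀ z ∈ space Zsp, 0 < marginal Zsp p (G.mp j) z)
    (hZ : ∀ j, IsCompact (Zsp j)) {B : ℝ} (hB0 : 0 ≤ B) (hB : ∀ f z, ℓ f z ≤ B) (j : Fin D)
    (f : F) {z : Fin D → ℝ} (hz : z ∈ space Zsp) : margLoss G Zsp p ℓ j f z ≤ B := by
  rw [margLoss_eq_toReal hp hp0 hℓ hℓ0]
  exact ENNReal.toReal_le_of_le_ofReal hB0 (tailLoss_le hp hp0 (hℓ f) hpos hZ (hB f) _ z hz)

/-- Since the pillow density does not depend on coordinate `j`, it can be divided out of the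
integral. This puts the conditional mean in the form estimated by `abs_smoothed_condMean_sub_le`. -/
theorem toReal_tailLoss_eq_div (hp : Measurable p) (hp0 : ∀ z, 0 ≤ p z)
    (hℓ : ∀ f, Measurable (ℓ f)) (hℓ0 : ∀ f z, 0 ≤ ℓ f z)
    (hpos : ∀ j, ∀ z ∈ space Zsp, 0 < marginal Zsp p (G.mp j) z)
    (hZ : ∀ j, IsCompact (Zsp j)) {B : ℝ} (hB : ∀ f z, ℓ f z ≤ B) (j : Fin D)
    (f : F) {q : ℝ → (G.mp j → ℝ) → ℝ} (hqm : ∀ z ∈ space Zsp,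
      q (z j) ((G.mp j).restrict z) = marginal Zsp p (insert j (G.mp j)) z)
    {z : Fin D → ℝ} (hz : z ∈ space Zsp) :
    (tailLoss G Zsp p (ℓ f) j z).toReal =
      (∫ x in Zsp j, margLoss G Zsp p ℓ j f (Function.update z j x) * q x ((G.mp j).restrict z)) /
        marginal Zsp p (G.mp j) z := by
  have hj : j ∉ G.mp j := fun hc => lt_irrefl _ (G.mp_lt hc)
  have h1 : tailLoss G Zsp p (ℓ f) j z = ∫⁻ x in Zsp j,
      ENNReal.ofReal (condDensity G Zsp p j (Function.update z j x) *
        margLoss G Zsp p ℓ j f (Function.update z j x)) := by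
    rw [tailLoss_eq_lintegral hp hp0 (hℓ f)]
    refine setLIntegral_congr_fun (hZ j).measurableSet fun x hx => ?_
    have hfin : tailLoss G Zsp p (ℓ f) (j + 1) (Function.update z j x) ≠ ∞ :=
      ((tailLoss_le hp hp0 (hℓ f) hpos hZ (hB f) _ _ (update_mem_space hz hx)).trans_lt
        ENNReal.ofReal_lt_top).ne
    rw [margLoss_eq_toReal hp hp0 hℓ hℓ0, ENNReal.ofReal_mul (condDensity_nonneg hp hp0 _ _),
      ENNReal.ofReal_toReal hfin]
  have hm : Measurable fun x => condDensity G Zsp p j (Function.update z j x) *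
      margLoss G Zsp p ℓ j f (Function.update z j x) :=
    ((measurable_condDensity hp hp0 j).comp (measurable_update z)).mul
      ((measurable_margLoss hp hp0 hℓ hℓ0 j f).comp (measurable_update z))
  rw [h1, ← integral_eq_lintegral_of_nonneg_ae (.of_forall fun x =>
    mul_nonneg (condDensity_nonneg hp hp0 _ _) (margLoss_nonneg hp hp0 hℓ hℓ0 _ _ _))
    hm.aestronglyMeasurable, ← integral_div]
  refine setIntegral_congr_fun (hZ j).measurableSet fun x hx => ?_
  have h5 : (G.mp j).restrict (Function.update z j x) = (G.mp j).restrict z := funext fun k =>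
    Function.update_of_ne (ne_of_mem_of_not_mem k.2 hj) _ _
  have h4 := hqm _ (update_mem_space hz hx)
  rw [h5, Function.update_self] at h4
  have h6 : marginal Zsp p (G.mp j) (Function.update z j x) = marginal Zsp p (G.mp j) z :=
    marginal_congr hp hp0 fun k hk => Function.update_of_ne (ne_of_mem_of_not_mem hk hj) _ _
  simp only [condDensity, ← h4, h6]
  ring

end condMean

/-! ### Telescoping -/

section telescoping

variable {D n : ℕ}

/-- Exchanging `i m` with the extra index `a` is an involution of the pairs `(i, a)`; after it the
summand is free of `a`. -/
theorem sum_sum_update (m : Fin D) (φ : (Fin D → Fin n) → ℝ) :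
    ∑ i : Fin D → Fin n, ∑ a : Fin n, φ (Function.update i m a) = n * ∑ i, φ i := by
  have h1 : Function.Involutive fun w : (Fin D → Fin n) × Fin n =>
      (Function.update w.1 m w.2, w.1 m) := fun w => by simp
  rw [← Fintype.sum_prod_type' (f := fun i a => φ (Function.update i m a))]
  have h2 := Equiv.sum_comp h1.toPerm fun w : (Fin D → Fin n) × Fin n => φ w.1
  simp only [Function.Involutive.coe_toPerm] at h2
  rw [h2, Fintype.sum_prod_type]
  simp [Finset.mul_sum]

/-- The weight of an index vector whose coordinates from `m` on are uniform. -/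
noncomputable def partialWeight (w : Fin D → Fin n → (Fin D → Fin n) → ℝ) (m : ℕ)
    (i : Fin D → Fin n) : ℝ :=
  ∏ j : Fin D, if (j : ℕ) < m then w j (i j) i else (n : ℝ)⁻¹

variable {w : Fin D → Fin n → (Fin D → Fin n) → ℝ}

/-- Not-yet-drawn coordinates carry the placeholder weight `1 / n`, which lets every stage be a sum
over full index vectors. Drawing coordinate `m` replaces its `1 / n` by `w m a`, and the factor `n`
this produces is the one in `sum_sum_update`. Earlier weights are unaffected because they do not
look at coordinate `m`. -/
theorem sum_partialWeight_succ (hn : 0 < n)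
    (hw : ∀ j a i k b, j ≤ k → w j a (Function.update i k b) = w j a i) (m : Fin D)
    (φ : (Fin D → Fin n) → ℝ) :
    ∑ i, partialWeight w (m + 1) i * φ i =
      ∑ i, partialWeight w m i * ∑ a, w m a i * φ (Function.update i m a) := by
  have hn' : (n : ℝ) ≠ 0 := by positivity
  have hpt : ∀ i a, partialWeight w (m + 1) (Function.update i m a) =
      n * (partialWeight w m i * w m a i) := by
    intro i a
    rw [partialWeight, partialWeight, ← Finset.mul_prod_erase _ _ (Finset.mem_univ m),
      ← Finset.mul_prod_erase Finset.univ (fun j : Fin D =>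
        if (j : ℕ) < m then w j (i j) i else (n : ℝ)⁻¹) (Finset.mem_univ m)]
    have h1 : ∏ j ∈ Finset.univ.erase m, (if (j : ℕ) < m + 1 then
        w j (Function.update i m a j) (Function.update i m a) else (n : ℝ)⁻¹) =
        ∏ j ∈ Finset.univ.erase m, (if (j : ℕ) < m then w j (i j) i else (n : ℝ)⁻¹) := by
      refine Finset.prod_congr rfl fun j hj => ?_
      have hne := Finset.ne_of_mem_erase hj
      have hne' : (j : ℕ) ≠ m := fun hc => hne (Fin.ext hc)
      by_cases hjm : (j : ℕ) < m
      · rw [if_pos hjm, if_pos (by omega), Function.update_of_ne hne, hw j _ i m a hjm.le]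
      · rw [if_neg hjm, if_neg (by omega)]
    rw [h1]
    simp only [Nat.lt_succ_self, if_true, lt_irrefl, if_false, Function.update_self,
      hw m a i m a le_rfl]
    field_simp
  have h2 := sum_sum_update m fun i => partialWeight w (m + 1) i * φ i
  rw [← mul_right_inj' hn', ← h2, Finset.mul_sum]
  refine Finset.sum_congr rfl fun i _ => ?_
  simp only [Finset.mul_sum, hpt]
  exact Finset.sum_congr rfl fun a _ => by ring

theorem sum_partialWeight (hn : 0 < n)
    (hw : ∀ j a i k b, j ≤ k → w j a (Function.update i k b) = w j a i)
    (hw1 : ∀ j i, ∑ a, w j a i = 1) {m : ℕ} (hm : m ≤ D) : ∑ i, partialWeight w m i = 1 := by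
  induction m with
  | zero =>
    have hn' : (n : ℝ) ≠ 0 := by positivity
    simp [partialWeight, hn']
  | succ m ih =>
    have h1 := sum_partialWeight_succ hn hw ⟨m, hm⟩ fun _ => 1
    simp only [mul_one, hw1] at h1
    rw [h1, ih (by omega)]

/-- The hybrid sums `U m` draw the coordinates before `m` from the weights and evaluate `ψ m`. They
run from `R` at `m = 0` to the fully weighted sum at `m = D`, and each increment is an average, with
weights summing to one, of one-step errors. -/
theorem abs_weighted_sum_sub_le (hn : 0 < n) (hw0 : ∀ j a i, 0 ≤ w j a i)
    (hw : ∀ j a i k b, j ≤ k → w j a (Function.update i k b) = w j a i)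
    (hw1 : ∀ j i, ∑ a, w j a i = 1) {ψ : ℕ → (Fin D → Fin n) → ℝ} {R : ℝ} (hR : ∀ i, ψ 0 i = R)
    {e : Fin D → ℝ}
    (he : ∀ (j : Fin D) i, |∑ a, w j a i * ψ (j + 1) (Function.update i j a) - ψ j i| ≤ e j) :
    |∑ i : Fin D → Fin n, (∏ j, w j (i j) i) * ψ D i - R| ≤ ∑ j, e j := by
  set U : ℕ → ℝ := fun m => ∑ i, partialWeight w m i * ψ m i with hU
  have hpw0 : ∀ m i, 0 ≤ partialWeight w m i := fun m i => Finset.prod_nonneg fun j _ => by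
    split_ifs
    · exact hw0 _ _ _
    · positivity
  have hstep : ∀ j : Fin D, |U (j + 1) - U j| ≤ e j := by
    intro j
    simp only [hU]
    rw [sum_partialWeight_succ hn hw, ← Finset.sum_sub_distrib]
    refine (Finset.abs_sum_le_sum_abs _ _).trans ?_
    calc _ ≤ ∑ i, partialWeight w j i * e j := by
          refine Finset.sum_le_sum fun i _ => ?_
          rw [← mul_sub, abs_mul, abs_of_nonneg (hpw0 _ _)]
          exact mul_le_mul_of_nonneg_left (he j i) (hpw0 _ _)
      _ = e j := by
          rw [← Finset.sum_mul, sum_partialWeight hn hw hw1 j.2.le, one_mul]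
  have h0 : U 0 = R := by
    simp only [hU, hR]
    rw [← Finset.sum_mul, sum_partialWeight hn hw hw1 (Nat.zero_le _), one_mul]
  have hD : U D = ∑ i : Fin D → Fin n, (∏ j, w j (i j) i) * ψ D i := by
    simp [hU, partialWeight]
  rw [← hD, ← h0, ← Finset.sum_range_sub, Finset.sum_range]
  exact (Finset.abs_sum_le_sum_abs _ _).trans (Finset.sum_le_sum fun j _ => hstep j)

end telescoping

/-! ### The augmented risk compared with the risk -/

section augRisk

variable {D n : ℕ} {G : ADMG (Fin D)} {K : (j : Fin D) → (G.mp j → ℝ) → ℝ} {h : Fin D → ℝ}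

theorem augPoint_update (data : Fin n → Fin D → ℝ) (i : Fin D → Fin n) (k : Fin D) (a : Fin n) :
    augPoint data (Function.update i k a) = Function.update (augPoint data i) k (data a k) := by
  ext j
  rcases eq_or_ne j k with rfl | hj
  · simp [augPoint]
  · simp [augPoint, hj]

theorem abs_augRisk_sub_risk_le (hn : 0 < n) {Zsp : Fin D → Set ℝ} {p : (Fin D → ℝ) → ℝ}
    (hp : Measurable p) (hp0 : ∀ z, 0 ≤ p z) (hfact : Factorizes G Zsp p)
    {F : Type*} {ℓ : F → (Fin D → ℝ) → ℝ} (hℓ : ∀ f, Measurable (ℓ f)) (hℓ0 : ∀ f z, 0 ≤ ℓ f z)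
    (hh : ∀ k, 0 < h k) (hK : ∀ j u, 0 < K j u) {data : Fin n → Fin D → ℝ}
    (hdata : ∀ i, data i ∈ space Zsp) {e : Fin D → ℝ} (f : F)
    (he : ∀ j, ∀ z ∈ space Zsp, |∑ a, weight G K h data j a ((G.mp j).restrict z) *
      margLoss G Zsp p ℓ j f (Function.update z j (data a j)) -
        (tailLoss G Zsp p (ℓ f) j z).toReal| ≤ e j) :
    |augRisk G K h ℓ data f - risk Zsp p ℓ f| ≤ ∑ j, e j := by
  -- The data space is a product, so recombined points stay in it. They need not be data points,
  -- which is why the one-step bound is required at every `z` in the space.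
  have hmem : ∀ i : Fin D → Fin n, augPoint data i ∈ space Zsp := fun i k _ => hdata (i k) k trivial
  have hkpos : ∀ j u, 0 < scaledKernel h (G.mp j) (K j) u := fun j u => scaledKernel_pos hh (hK j) u
  have hden : ∀ (j : Fin D) (u : G.mp j → ℝ),
      0 < ∑ k, scaledKernel h (G.mp j) (K j) (u - (G.mp j).restrict (data k)) := fun j u =>
    Finset.sum_pos (fun k _ => hkpos _ _) ⟨⟨0, hn⟩, Finset.mem_univ _⟩
  refine abs_weighted_sum_sub_le (w := fun j a i => weight G K h data j a
    ((G.mp j).restrict (augPoint data i))) (ψ := fun m i =>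
      (tailLoss G Zsp p (ℓ f) m (augPoint data i)).toReal) hn
      (fun j a i => (div_pos (hkpos _ _) (hden _ _)).le) (fun j a i k b hjk => ?_) (fun j i => ?_)
      (fun i => (risk_eq_toReal hp hp0 hfact hℓ hℓ0 f _).symm) (fun j i => ?_) |>.trans' (le_of_eq ?_)
  · rw [augPoint_update]
    congr 1
    exact funext fun l => Function.update_of_ne ((G.mp_lt l.2).trans_le hjk).ne _ _
  · simp only [weight]
    rw [← Finset.sum_div, div_self (hden _ _).ne']
  · simp only [augPoint_update]
    simp only [← margLoss_eq_toReal hp hp0 hℓ hℓ0]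
    exact he j _ (hmem i)
  · congr 2
    refine Finset.sum_congr rfl fun i _ => ?_
    congr 1
    -- From index `D` on nothing is left to integrate, so the last hybrid evaluates the loss itself.
    have he : (Finset.univ.filter fun k : Fin D => D ≤ k) = ∅ := by
      ext k
      simp only [Finset.mem_filter, Finset.mem_univ, true_and, Finset.notMem_empty, iff_false]
      omega
    simp only [tailLoss, he, lmarginal_empty, Finset.prod_empty, mul_one]
    rw [ENNReal.toReal_ofReal (hℓ0 _ _)]

end augRisk

/-! ### Uniform deviations of the smoothed conditional means -/

/-- Finiteness matters because `rademacher` applies `toReal`, which would turn an infinite outer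
expectation into `0`. -/
theorem outerExp_rademacher_ne_top {X : Type*} [MeasurableSpace X] {n : ℕ} (hn : 0 < n)
    {q : Measure X} [IsProbabilityMeasure q] {A : Set X} (hA : ∀ᵐ x ∂q, x ∈ A)
    {C : Set (X → ℝ)} {b : ℝ} (hC : ∀ g ∈ C, ∀ x ∈ A, |g x| ≤ b) (σ : Fin n → ℤˣ) :
    outerExp (Measure.pi fun _ : Fin n => q) (fun x =>
      ⨆ g ∈ C, ENNReal.ofReal |(1 / (n : ℝ)) * ∑ i, ((σ i : ℤ) : ℝ) * g (x i)|) ≠ ∞ := by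
  have hn' : (0 : ℝ) < n := by exact_mod_cast hn
  have hνA : ∀ᵐ x ∂(Measure.pi fun _ : Fin n => q), ∀ i, x i ∈ A := by
    rw [ae_all_iff]
    exact fun i => (measurePreserving_eval (fun _ : Fin n => q) i).quasiMeasurePreserving.ae hA
  have h1 : outerExp (Measure.pi fun _ : Fin n => q) (fun x =>
      ⨆ g ∈ C, ENNReal.ofReal |(1 / (n : ℝ)) * ∑ i, ((σ i : ℤ) : ℝ) * g (x i)|) ≤
      outerExp (Measure.pi fun _ : Fin n => q) fun _ => ENNReal.ofReal b := by
    refine outerExp_mono_ae _ ?_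
    filter_upwards [hνA] with x hx
    refine iSup₂_le fun g hg => ENNReal.ofReal_le_ofReal ?_
    have h2 : |∑ i, ((σ i : ℤ) : ℝ) * g (x i)| ≤ n * b := by
      refine (Finset.abs_sum_le_sum_abs _ _).trans ?_
      have h3 : ∀ i ∈ Finset.univ, |((σ i : ℤ) : ℝ) * g (x i)| ≤ b := fun i _ => by
        rcases Int.units_eq_one_or (σ i) with hi | hi <;> simpa [hi] using hC g hg _ (hx i)
      simpa using Finset.sum_le_card_nsmul _ _ _ h3
    rw [abs_mul, abs_of_pos (by positivity)]
    calc _ ≤ 1 / (n : ℝ) * (n * b) := by gcongr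
      _ = b := by field_simp
  refine (h1.trans (outerExp_le _ measurable_const le_rfl)).trans_lt ?_ |>.ne
  simp

section deviation

variable {D n : ℕ} {Zsp : Fin D → Set ℝ} {p : (Fin D → ℝ) → ℝ} {G : ADMG (Fin D)} {F : Type*}
  {ℓ : F → (Fin D → ℝ) → ℝ}

theorem margLoss_congr (hp : Measurable p) (hp0 : ∀ z, 0 ≤ p z)
    (hℓ : ∀ f, Measurable (ℓ f)) (hℓ0 : ∀ f z, 0 ≤ ℓ f z) {j : Fin D} (f : F) {y z : Fin D → ℝ}
    (h : ∀ k ≤ j, y k = z k) : margLoss G Zsp p ℓ j f y = margLoss G Zsp p ℓ j f z := by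
  rw [margLoss_eq_toReal hp hp0 hℓ hℓ0, margLoss_eq_toReal hp hp0 hℓ hℓ0,
    tailLoss_congr _ fun k hk => h k (Nat.lt_succ_iff.mp hk)]

/-- Members of the class constrain `z` only before `j`. The later coordinates have been integrated
out, so they may be replaced by those of a point of the space, where the bound on `margLoss`
applies. -/
theorem lossClass_mem_Icc (hp : Measurable p) (hp0 : ∀ z, 0 ≤ p z)
    (hℓ : ∀ f, Measurable (ℓ f)) (hℓ0 : ∀ f z, 0 ≤ ℓ f z)
    (hpos : ∀ j, ∀ z ∈ space Zsp, 0 < marginal Zsp p (G.mp j) z)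
    (hZ : ∀ j, IsCompact (Zsp j)) (hne : (space Zsp).Nonempty) {B : ℝ} (hB0 : 0 ≤ B)
    (hB : ∀ f z, ℓ f z ≤ B) {j : Fin D} {g : ℝ → ℝ} (hg : g ∈ lossClass G Zsp p ℓ j) {x : ℝ}
    (hx : x ∈ Zsp j) : g x ∈ Set.Icc 0 B := by
  obtain ⟨f, z, hz, rfl⟩ := hg
  obtain ⟨z₀, hz₀⟩ := hne
  refine ⟨margLoss_nonneg hp hp0 hℓ hℓ0 _ _ _, ?_⟩
  have hmem : Function.update (fun k => if k < j then z k else z₀ k) j x ∈ space Zsp := by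
    intro k _
    rcases eq_or_ne k j with rfl | hk
    · simpa using hx
    · by_cases hkj : k < j
      · simpa [hk, hkj] using hz k hkj
      · simpa [hk, hkj] using hz₀ k trivial
  have hcongr : margLoss G Zsp p ℓ j f (Function.update z j x) = margLoss G Zsp p ℓ j f
      (Function.update (fun k => if k < j then z k else z₀ k) j x) := by
    refine margLoss_congr hp hp0 hℓ hℓ0 f fun k hk => ?_
    rcases eq_or_lt_of_le hk with rfl | hk
    · simp
    · simp [hk.ne, hk]
  simp only [hcongr]
  exact margLoss_le hp hp0 hℓ hℓ0 hpos hZ hB0 hB j f hmem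

/-- The uniform deviation bound for the functions `(m - c) k` indexed by `f` and `z`. Treating this
combination at once, instead of numerator and denominator separately, needs a single event. As `c`
is a constant in `[0, B]` for each index, the signed sums split into one for the product class and
at most `B` times one for the kernel class. -/
theorem exists_condMean_deviation (hn : 0 < n) (hp : Measurable p) (hp0 : ∀ z, 0 ≤ p z)
    (hℓ : ∀ f, Measurable (ℓ f)) (hℓ0 : ∀ f z, 0 ≤ ℓ f z)
    (hpos : ∀ j, ∀ z ∈ space Zsp, 0 < marginal Zsp p (G.mp j) z)
    (hZ : ∀ j, IsCompact (Zsp j)) (hne : (space Zsp).Nonempty) [IsProbabilityMeasure (law Zsp p)]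
    {B : ℝ} (hB0 : 0 ≤ B) (hB : ∀ f z, ℓ f z ≤ B) {h : Fin D → ℝ} (hh : ∀ k, 0 < h k) (j : Fin D)
    {S : Finset (Fin D)}
    {K : (S → ℝ) → ℝ} (hK : Continuous K) (hK0 : ∀ u, 0 < K u) {C : ℝ}
    (hC : ∀ u, |K u| ≤ C) {c : F → (Fin D → ℝ) → ℝ}
    (hc : ∀ f, ∀ z ∈ space Zsp, c f z ∈ Set.Icc 0 B) {δ : ℝ} (hδ : 0 < δ) (hδ1 : δ < 1) :
    ∃ E : Set (Fin n → ℝ × (S → ℝ)), MeasurableSet E ∧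
      1 - δ ≤ (Measure.pi fun _ : Fin n =>
        (law Zsp p).map fun z => (z j, S.restrict z)).real E ∧
      ∀ x ∈ E, (∀ i, x i ∈ Zsp j ×ˢ box Zsp S) → ∀ f, ∀ z ∈ space Zsp,
        |(1 / (n : ℝ)) * ∑ i, (margLoss G Zsp p ℓ j f (Function.update z j (x i).1) - c f z) *
            scaledKernel h S K (S.restrict z - (x i).2) -
          ∫ y, (margLoss G Zsp p ℓ j f (Function.update z j (y j)) - c f z) *
            scaledKernel h S K (S.restrict z - S.restrict y) ∂(law Zsp p)| ≤
        2 * (rademacher n ((law Zsp p).map fun z => (z j, S.restrict z))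
            (tensor (lossClass G Zsp p ℓ j) (kernelClass Zsp h S K)) +
          B * rademacher n ((law Zsp p).map S.restrict) (kernelClass Zsp h S K)) +
        B * (C / |(bandwidth h S).det|) * √(Real.log (1 / δ) / (2 * n)) := by
  have hC0 : 0 ≤ C := (abs_nonneg _).trans (hC 0)
  have hπ : Measurable fun z : Fin D → ℝ => (z j, S.restrict z) :=
    (measurable_pi_apply j).prodMk (Finset.measurable_restrict S)
  set q : Measure (ℝ × (S → ℝ)) := (law Zsp p).map fun z => (z j, S.restrict z) with hq
  set q' : Measure (S → ℝ) := (law Zsp p).map S.restrict with hq'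
  have : IsProbabilityMeasure q := Measure.isProbabilityMeasure_map hπ.aemeasurable
  have : IsProbabilityMeasure q' :=
    Measure.isProbabilityMeasure_map (Finset.measurable_restrict S).aemeasurable
  have hsnd : MeasurePreserving Prod.snd q q' :=
    ⟨measurable_snd, by rw [hq, Measure.map_map measurable_snd hπ]; rfl⟩
  have hAm : MeasurableSet (Zsp j ×ˢ box Zsp S) :=
    (hZ j).measurableSet.prod (measurableSet_box hZ S)
  have hspace := ae_law_mem_space hZ p
  have hqA : ∀ᵐ x ∂q, x ∈ Zsp j ×ˢ box Zsp S := by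
    rw [hq, ae_map_iff (p := fun x => x ∈ Zsp j ×ˢ box Zsp S) hπ.aemeasurable hAm]
    filter_upwards [hspace] with y hy
    exact ⟨hy j trivial, restrict_mem_box hy S⟩
  have hres : Measurable fun z : Fin D → ℝ => (S.restrict z : S → ℝ) := Finset.measurable_restrict S
  have hq'A : ∀ᵐ u ∂q', u ∈ box Zsp S := by
    have : q' = (law Zsp p).map fun z : Fin D → ℝ => (S.restrict z : S → ℝ) := rfl
    rw [this, ae_map_iff (p := fun x : S → ℝ => x ∈ box Zsp S) hres.aemeasurable
      (measurableSet_box hZ S)]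
    filter_upwards [hspace] with y hy
    exact restrict_mem_box hy S
  set C' : ℝ := C / |(bandwidth h S).det| with hC'
  have hC'0 : 0 ≤ C' := by positivity
  have hκ0 : ∀ u, 0 < scaledKernel h S K u := fun u => scaledKernel_pos hh hK0 u
  have hκC : ∀ u, scaledKernel h S K u ≤ C' := fun u =>
    (le_abs_self _).trans (scaledKernel_le hh hC u)
  have hκm : Measurable (scaledKernel h S K) := (continuous_scaledKernel hK).measurable
  set T := F × {z : Fin D → ℝ // z ∈ space Zsp}
  set φ : T → ℝ × (S → ℝ) → ℝ := fun t x =>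
    (margLoss G Zsp p ℓ j t.1 (Function.update t.2.1 j x.1) - c t.1 t.2.1) *
      scaledKernel h S K (S.restrict t.2.1 - x.2) with hφ
  have hφm : ∀ t, Measurable (φ t) := fun t =>
    ((((measurable_margLoss hp hp0 hℓ hℓ0 j t.1).comp (measurable_update t.2.1)).comp
      measurable_fst).sub_const _).mul (hκm.comp (measurable_const.sub measurable_snd))
  -- With `m` and `c` in `[0, B]` and `k` in `[0, C']`, the values lie between `-c C'` and `(B - c)
  -- C'`, an interval of length `B C'` rather than `2 B C'`.
  have hφA : ∀ t, ∀ x ∈ Zsp j ×ˢ box Zsp S,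
      φ t x ∈ Set.Icc (-(c t.1 t.2.1 * C')) (-(c t.1 t.2.1 * C') + B * C') := by
    rintro ⟨f, z, hz⟩ x hx
    have h1 : margLoss G Zsp p ℓ j f (Function.update z j x.1) ∈ Set.Icc 0 B :=
      ⟨margLoss_nonneg hp hp0 hℓ hℓ0 _ _ _,
        margLoss_le hp hp0 hℓ hℓ0 hpos hZ hB0 hB j f (update_mem_space hz hx.1)⟩
    have h2 := hκ0 (S.restrict z - x.2)
    have h3 := hκC (S.restrict z - x.2)
    have h4 := hc f z hz
    simp only [hφ]
    constructor
    · nlinarith [mul_nonneg h1.1 h2.le, mul_le_mul_of_nonneg_left h3 h4.1]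
    · nlinarith [mul_nonneg (sub_nonneg.mpr h1.2) h2.le,
        mul_le_mul_of_nonneg_left h3 (sub_nonneg.mpr h4.2)]
  set ρ₁ : (Fin n → ℤˣ) → ℝ≥0∞ := fun σ => outerExp (Measure.pi fun _ : Fin n => q) fun x =>
    ⨆ g ∈ tensor (lossClass G Zsp p ℓ j) (kernelClass Zsp h S K),
      ENNReal.ofReal |(1 / (n : ℝ)) * ∑ i, ((σ i : ℤ) : ℝ) * g (x i)| with hρ₁
  set ρ₂ : (Fin n → ℤˣ) → ℝ≥0∞ := fun σ => outerExp (Measure.pi fun _ : Fin n => q') fun x =>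
    ⨆ g ∈ kernelClass Zsp h S K,
      ENNReal.ofReal |(1 / (n : ℝ)) * ∑ i, ((σ i : ℤ) : ℝ) * g (x i)| with hρ₂
  have hρ₁top : ∀ σ, ρ₁ σ ≠ ∞ := by
    refine fun σ => outerExp_rademacher_ne_top hn hqA (b := B * C') ?_ σ
    rintro _ ⟨a, ha, _, ⟨z, _, rfl⟩, rfl⟩ x hx
    have h1 := lossClass_mem_Icc hp hp0 hℓ hℓ0 hpos hZ hne hB0 hB ha hx.1
    rw [abs_mul, abs_of_nonneg h1.1, abs_of_pos (hκ0 _)]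
    exact mul_le_mul h1.2 (hκC _) (hκ0 _).le hB0
  have hρ₂top : ∀ σ, ρ₂ σ ≠ ∞ := by
    refine fun σ => outerExp_rademacher_ne_top hn hq'A (b := C') ?_ σ
    rintro _ ⟨z, _, rfl⟩ x _
    rw [abs_of_pos (hκ0 _)]
    exact hκC _
  have hsign : ∀ σ, outerExp (Measure.pi fun _ : Fin n => q) (signSup σ φ) ≤
      ρ₁ σ + ENNReal.ofReal B * ρ₂ σ := by
    intro σ
    have hpi := measurePreserving_pi (fun _ : Fin n => q) (fun _ => q') fun _ => hsnd
    have h2 := (outerExp_const_mul_le (Measure.pi fun _ : Fin n => q) (ENNReal.ofReal B)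
      ((fun x : Fin n → S → ℝ => ⨆ g ∈ kernelClass Zsp h S K,
        ENNReal.ofReal |(1 / (n : ℝ)) * ∑ i, ((σ i : ℤ) : ℝ) * g (x i)|) ∘
          fun x i => (x i).2)).trans (mul_le_mul_right (outerExp_comp_le hpi _) _)
    refine le_trans ?_ ((outerExp_add_le _ _ _).trans (add_le_add_right h2 _))
    refine outerExp_mono_ae _ (.of_forall fun x => iSup_le ?_)
    rintro ⟨f, z, hz⟩
    have hcz := hc f z hz
    set a : ℝ → ℝ := fun y => margLoss G Zsp p ℓ j f (Function.update z j y) with ha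
    set k : (S → ℝ) → ℝ := fun u => scaledKernel h S K (S.restrict z - u) with hk
    have hkmem : k ∈ kernelClass Zsp h S K := ⟨_, restrict_mem_box hz S, rfl⟩
    have hamem : (fun w : ℝ × (S → ℝ) => a w.1 * k w.2) ∈
        tensor (lossClass G Zsp p ℓ j) (kernelClass Zsp h S K) :=
      ⟨a, ⟨f, z, fun k _ => hz k trivial, rfl⟩, k, hkmem, rfl⟩
    have hsplit : (1 / (n : ℝ)) * ∑ i, ((σ i : ℤ) : ℝ) * φ (f, ⟨z, hz⟩) (x i) =
        (1 / (n : ℝ)) * ∑ i, ((σ i : ℤ) : ℝ) * (a (x i).1 * k (x i).2) -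
          c f z * ((1 / (n : ℝ)) * ∑ i, ((σ i : ℤ) : ℝ) * k (x i).2) := by
      rw [mul_left_comm, ← mul_sub, Finset.mul_sum _ _ (c f z), ← Finset.sum_sub_distrib]
      congr 1
      refine Finset.sum_congr rfl fun i _ => ?_
      simp only [hφ, ha, hk]
      ring
    rw [hsplit]
    refine (ENNReal.ofReal_le_ofReal (abs_sub _ _)).trans ?_
    rw [ENNReal.ofReal_add (abs_nonneg _) (abs_nonneg _), abs_mul (c f z), abs_of_nonneg hcz.1,
      ENNReal.ofReal_mul hcz.1]
    refine add_le_add (le_iSup₂_of_le _ hamem le_rfl)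
      (mul_le_mul' (ENNReal.ofReal_le_ofReal hcz.2) (le_iSup₂_of_le k hkmem le_rfl))
  obtain ⟨E, hEm, hE, hdev⟩ := exists_uniform_deviation hn q hφm hAm hqA
    (mul_nonneg hB0 hC'0) hφA hsign (fun σ => ENNReal.add_ne_top.mpr ⟨hρ₁top σ,
      ENNReal.mul_ne_top ENNReal.ofReal_ne_top (hρ₂top σ)⟩) hδ hδ1
  refine ⟨E, hEm, hE, fun x hx hxA f z hz => ?_⟩
  have h1 := hdev x hx hxA (f, ⟨z, hz⟩)
  have h2 : (∑ σ, (ρ₁ σ + ENNReal.ofReal B * ρ₂ σ).toReal) / 2 ^ n =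
      rademacher n q (tensor (lossClass G Zsp p ℓ j) (kernelClass Zsp h S K)) +
        B * rademacher n q' (kernelClass Zsp h S K) := by
    rw [rademacher, rademacher, ← mul_div_assoc, ← add_div, Finset.mul_sum,
      ← Finset.sum_add_distrib]
    congr 1
    refine Finset.sum_congr rfl fun σ _ => ?_
    rw [ENNReal.toReal_add (hρ₁top σ) (ENNReal.mul_ne_top ENNReal.ofReal_ne_top (hρ₂top σ)),
      ENNReal.toReal_mul, ENNReal.toReal_ofReal hB0]
  have h3 : ∫ y, φ (f, ⟨z, hz⟩) y ∂q = ∫ y, (margLoss G Zsp p ℓ j f (Function.update z j (y j)) -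
      c f z) * scaledKernel h S K (S.restrict z - S.restrict y) ∂(law Zsp p) := by
    rw [hq, integral_map hπ.aemeasurable (hφm _).aestronglyMeasurable]
  rw [h2, h3] at h1
  exact h1

end deviation

/-! ### The risk bound -/

/-- The weights sum to one, so the error is `∑ (m i - c) k i / ∑ k i`, and the denominator is at
least `n η` for every sample. -/
theorem abs_weighted_mean_sub_le {D n : ℕ} (hn : 0 < n) {G : ADMG (Fin D)}
    {K : (j : Fin D) → (G.mp j → ℝ) → ℝ} {h : Fin D → ℝ} {data : Fin n → Fin D → ℝ} {j : Fin D}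
    {u : G.mp j → ℝ} {η : ℝ} (hη : 0 < η)
    (hker : ∀ i, η ≤ scaledKernel h (G.mp j) (K j) (u - (G.mp j).restrict (data i)))
    {m : Fin n → ℝ} {c Δ : ℝ}
    (hΔ : |(1 / (n : ℝ)) * ∑ i, (m i - c) *
      scaledKernel h (G.mp j) (K j) (u - (G.mp j).restrict (data i))| ≤ Δ) :
    |∑ i, weight G K h data j i u * m i - c| ≤ Δ / η := by
  have hn' : (0 : ℝ) < n := by exact_mod_cast hn
  set k : Fin n → ℝ := fun i => scaledKernel h (G.mp j) (K j) (u - (G.mp j).restrict (data i))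
    with hk
  have hsum : n * η ≤ ∑ i, k i := by
    simpa using Finset.card_nsmul_le_sum Finset.univ k η fun i _ => hker i
  have hpos : 0 < ∑ i, k i := lt_of_lt_of_le (by positivity) hsum
  have h1 : ∑ i, weight G K h data j i u * m i - c = (∑ i, (m i - c) * k i) / ∑ i, k i := by
    rw [eq_div_iff hpos.ne', sub_mul, Finset.sum_mul]
    simp only [sub_mul, Finset.sum_sub_distrib, ← Finset.mul_sum]
    congr 1
    refine Finset.sum_congr rfl fun i _ => ?_
    simp only [weight]
    rw [div_mul_eq_mul_div, div_mul_cancel₀ _ hpos.ne', mul_comm]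
  rw [abs_mul, abs_of_pos (by positivity), one_div, inv_mul_le_iff₀ hn'] at hΔ
  rw [h1, abs_div, abs_of_pos hpos, div_le_div_iff₀ hpos hη]
  have hΔ0 : 0 ≤ Δ := by
    by_contra hc
    nlinarith [abs_nonneg (∑ i, (m i - c) * k i)]
  calc |∑ i, (m i - c) * k i| * η ≤ n * Δ * η := by gcongr
    _ = Δ * (n * η) := by ring
    _ ≤ _ := by gcongr

theorem measureReal_preimage_pi {Ω X Y : Type*} [MeasurableSpace Ω] [MeasurableSpace X]
    [MeasurableSpace Y] {n : ℕ} {μ : Measure Ω} [IsProbabilityMeasure μ] {Z : Fin n → Ω → X}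
    (hZ : ∀ i, Measurable (Z i)) (hind : iIndepFun Z μ) {q : Measure X} (hq : ∀ i, μ.map (Z i) = q)
    {π : X → Y} (hπ : Measurable π) {S : Set (Fin n → Y)} (hS : MeasurableSet S) :
    μ.real ((fun ω i => π (Z i ω)) ⁻¹' S) = (Measure.pi fun _ : Fin n => q.map π).real S := by
  have h1 := (iIndepFun_iff_map_fun_eq_pi_map fun i => (hπ.comp (hZ i)).aemeasurable).mp
    (hind.comp (fun _ => π) fun _ => hπ)
  have h2 : ∀ i, μ.map (π ∘ Z i) = q.map π := fun i => by
    rw [← Measure.map_map hπ (hZ i), hq i]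
  simp only [h2] at h1
  rw [← h1, map_measureReal_apply (measurable_pi_iff.mpr fun i => hπ.comp (hZ i)) hS]
  rfl

theorem rademacher_nonneg {X : Type*} [MeasurableSpace X] (m : ℕ) (q : Measure X)
    (C : Set (X → ℝ)) : 0 ≤ rademacher m q C :=
  div_nonneg (Finset.sum_nonneg fun _ _ => ENNReal.toReal_nonneg) (by positivity)

theorem kernelInf_le_kernelSup {D : ℕ} {G : ADMG (Fin D)} {Zsp : Fin D → Set ℝ}
    {K : (j : Fin D) → (G.mp j → ℝ) → ℝ} {h : Fin D → ℝ} (hh : ∀ k, 0 < h k)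
    (hK : ∀ j u, 0 < K j u) (hKb : ∀ j, BddAbove (Set.range fun u => |K j u|))
    (hne : (space Zsp).Nonempty) (j : Fin D) :
    kernelInf Zsp h (G.mp j) (K j) ≤ kernelSup G K := by
  obtain ⟨z, hz⟩ := hne
  have hb := restrict_mem_box hz (G.mp j)
  have hdet := abs_pos.mpr (bandwidth_det_pos (S := G.mp j) hh).ne'
  refine (kernelInf_le hh (hK j) hb hb).trans ?_
  rw [scaledKernel, mul_inv_cancel_left₀ hdet.ne']
  exact (le_abs_self _).trans (le_kernelSup hKb j _)

/-- Subtracting the kernel-weighted mean centres the process, so the deviation bound is directly a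
bound on the empirical mean. -/
theorem integral_sub_const_mul_eq {X : Type*} [MeasurableSpace X] {q : Measure X}
    {b k : X → ℝ} (hbk : Integrable (fun x => b x * k x) q) (hk : Integrable k q)
    (h0 : ∫ x, k x ∂q ≠ 0) :
    ∫ x, (b x - (∫ x, b x * k x ∂q) / ∫ x, k x ∂q) * k x ∂q = 0 := by
  simp only [sub_mul]
  rw [integral_sub hbk (hk.const_mul _), integral_const_mul, div_mul_cancel₀ _ h0, sub_self]

/-- The denominator bias appears with coefficient one; `ρ = B_K / ε_K ≥ 1` enlarges it to the stated
constants. -/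
theorem bias_terms_le {B V C X τ J I ε ρ : ℝ} (hB : 0 ≤ B) (hε : 0 < ε) (hA : 0 ≤ C * X)
    (hτ : 0 ≤ τ) (hI : 0 ≤ I) (hρ : 1 ≤ ρ) :
    (B * (V * (C * X) + τ * J) + B * (C * X + τ * I)) / ε ≤
      B * (1 / ε * (V + ρ) * C * X) + B * (τ / ε * (J + ρ * I)) := by
  have h1 : C * X ≤ ρ * (C * X) := le_mul_of_one_le_left hA hρ
  have h2 : τ * I ≤ ρ * (τ * I) := le_mul_of_one_le_left (mul_nonneg hτ hI) hρ
  calc _ ≤ (B * (V * (C * X) + τ * J) + B * (ρ * (C * X) + ρ * (τ * I))) / ε := by gcongr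
    _ = _ := by field_simp; ring

/-- Here `d = |det H|`: the scaled kernel ranges between `κ / d` and `b / d` on the data space, and
dividing by the lower bound produces the factor `d` in front of the complexities. -/
theorem stochastic_terms_le {B b d κ M R₁ R₂ s s' : ℝ} (hB : 0 ≤ B) (hb : 0 ≤ b) (hd : 0 < d)
    (hκ : 0 < κ) (hM : 1 / κ ≤ M) (hR₁ : 0 ≤ R₁) (hR₂ : 0 ≤ R₂) (hs : 0 ≤ s) (hss : s ≤ s') :
    (2 * (R₁ + B * R₂) + B * (b / d) * s) / (κ / d) ≤
      2 * M * (d * R₁ + B * (d * R₂)) + B * b * M * s' := by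
  calc _ = 1 / κ * (2 * (d * R₁ + B * (d * R₂)) + B * b * s) := by field_simp
    _ ≤ M * (2 * (d * R₁ + B * (d * R₂)) + B * b * s') := by
        have : 0 ≤ M := (one_div_pos.mpr hκ).le.trans hM
        gcongr
    _ = _ := by ring

/-- The one-step error of coordinate `j`, uniform in `f` and `z`. The smoothed population mean `c`
separates it into a stochastic part, controlled on the event `E`, and a deterministic bias. -/
theorem exists_weighted_mean_deviation {D n : ℕ} (hn : 0 < n) {G : ADMG (Fin D)}
    {Zsp : Fin D → Set ℝ} (hZ : ∀ j, IsCompact (Zsp j))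
    {p : (Fin D → ℝ) → ℝ} (hp : Measurable p) (hp0 : ∀ z, 0 ≤ p z)
    (hpos : ∀ j, ∃ c > 0, ∀ z ∈ space Zsp, c ≤ marginal Zsp p (G.mp j) z)
    [IsProbabilityMeasure (law Zsp p)] {F : Type*} {ℓ : F → (Fin D → ℝ) → ℝ}
    (hℓ : ∀ f, Measurable (ℓ f)) (hℓ0 : ∀ f z, 0 ≤ ℓ f z)
    (hℓb : BddAbove (Set.range fun w : F × (Fin D → ℝ) => |ℓ w.1 w.2|))
    {β L : ℝ} (hβ : 1 < β) (hL : 0 < L) {h : Fin D → ℝ} (hh : ∀ k, 0 < h k)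
    {K : (j : Fin D) → (G.mp j → ℝ) → ℝ} (hKc : ∀ j, Continuous (K j)) (hK0 : ∀ j u, 0 < K j u)
    (hKb : ∀ j, BddAbove (Set.range fun u => |K j u|)) (j : Fin D)
    (hKo : IsKernelOfOrder ⌊β⌋₊ (K j)) (hKm : Integrable fun u => |K j u| * euclNorm u ^ β)
    {r : (G.mp j → ℝ) → ℝ} {q : ℝ → (G.mp j → ℝ) → ℝ}
    (hrm : ∀ z ∈ space Zsp, r ((G.mp j).restrict z) = marginal Zsp p (G.mp j) z)
    (hqm : ∀ z ∈ space Zsp,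
      q (z j) ((G.mp j).restrict z) = marginal Zsp p (insert j (G.mp j)) z)
    (hrh : r ∈ HolderClass β L) (hqh : ∀ x ∈ Zsp j, q x ∈ HolderClass β L)
    (hri : IntegrableOn r (box Zsp (G.mp j))ᶜ)
    (hqi : IntegrableOn (Function.uncurry q) (Zsp j ×ˢ (box Zsp (G.mp j))ᶜ))
    {δ : ℝ} (hδ : 0 < δ) (hδ1 : δ < 1) :
    ∃ E : Set (Fin n → ℝ × (G.mp j → ℝ)), MeasurableSet E ∧
      1 - δ ≤ (Measure.pi fun _ : Fin n =>
        (law Zsp p).map fun z => (z j, (G.mp j).restrict z)).real E ∧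
      ∀ data : Fin n → Fin D → ℝ, (∀ i, data i ∈ space Zsp) →
        (fun i => (data i j, (G.mp j).restrict (data i))) ∈ E → ∀ f, ∀ z ∈ space Zsp,
        |∑ a, weight G K h data j a ((G.mp j).restrict z) *
            margLoss G Zsp p ℓ j f (Function.update z j (data a j)) -
          (tailLoss G Zsp p (ℓ f) j z).toReal| ≤
        lossSup ℓ * (1 / densityInf Zsp p (G.mp j) *
            (volume.real (Zsp j) + kernelSup G K / kernelInf Zsp h (G.mp j) (K j)) *
            holderConst β L (K j) * bandwidthNorm h (G.mp j) ^ β) +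
          lossSup ℓ * (kernelTail Zsp h (G.mp j) (K j) / densityInf Zsp p (G.mp j) *
            ((∫ x in Zsp j, ∫ u in (box Zsp (G.mp j))ᶜ, |q x u|) +
              kernelSup G K / kernelInf Zsp h (G.mp j) (K j) *
                ∫ u in (box Zsp (G.mp j))ᶜ, |r u|)) +
          (2 * kernelConst G Zsp K h * (|(bandwidth h (G.mp j)).det| *
              rademacher n ((law Zsp p).map fun z => (z j, (G.mp j).restrict z))
                (tensor (lossClass G Zsp p ℓ j) (kernelClass Zsp h (G.mp j) (K j))) +
              lossSup ℓ * (|(bandwidth h (G.mp j)).det| *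
                rademacher n ((law Zsp p).map (G.mp j).restrict)
                  (kernelClass Zsp h (G.mp j) (K j)))) +
            lossSup ℓ * kernelSup G K * kernelConst G Zsp K h *
              √(Real.log (2 / δ) / (2 * n))) := by
  obtain ⟨z₀, hz₀⟩ : (space Zsp).Nonempty := (ae_law_mem_space hZ p).exists.imp fun _ => id
  have hne : (space Zsp).Nonempty := ⟨z₀, hz₀⟩
  have hpos' : ∀ j, ∀ z ∈ space Zsp, 0 < marginal Zsp p (G.mp j) z := fun j z hz => by
    obtain ⟨c, hc, hcm⟩ := hpos j
    exact hc.trans_le (hcm z hz)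
  obtain ⟨c₀, hc₀, hc₀m⟩ := hpos j
  have hB0 := lossSup_nonneg ℓ
  have hB := le_lossSup hℓb
  have hε := densityInf_pos hc₀ hc₀m hne
  have hκpos := kernelInf_pos (S := G.mp j) hh (hK0 j) (hKc j) hZ ⟨_, restrict_mem_box hz₀ _⟩
  have hκle := kernelInf_le_kernelSup hh hK0 hKb hne j
  have hdet := abs_pos.mpr (bandwidth_det_pos (S := G.mp j) hh).ne'
  have hj : j ∉ G.mp j := fun hc => lt_irrefl _ (G.mp_lt hc)
  have hsmooth := fun (f : F) (z : Fin D → ℝ) (hz : z ∈ space Zsp) =>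
    abs_smoothed_condMean_sub_le hp hp0 hZ hj hε (fun z hz => densityInf_le hc₀m hz) hh hβ hL
      (hKc j) (hK0 j) (le_kernelSup hKb j) hKo hKm hrm hqm hrh hqh hri hqi
      (b := fun x => margLoss G Zsp p ℓ j f (Function.update z j x))
      ((measurable_margLoss hp hp0 hℓ hℓ0 j f).comp (measurable_update z))
      (fun x => margLoss_nonneg hp hp0 hℓ hℓ0 _ _ _) hB0
      (fun x hx => margLoss_le hp hp0 hℓ hℓ0 hpos' hZ hB0 hB j f (update_mem_space hz hx)) hz
  set c : F → (Fin D → ℝ) → ℝ := fun f z =>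
    (∫ y, margLoss G Zsp p ℓ j f (Function.update z j (y j)) *
      scaledKernel h (G.mp j) (K j) ((G.mp j).restrict z - (G.mp j).restrict y) ∂(law Zsp p)) /
    ∫ y, scaledKernel h (G.mp j) (K j) ((G.mp j).restrict z - (G.mp j).restrict y) ∂(law Zsp p)
    with hc
  have hcB : ∀ f, ∀ z ∈ space Zsp, c f z ∈ Set.Icc 0 (lossSup ℓ) := fun f z hz => by
    obtain ⟨h1, h2, h3, -⟩ := hsmooth f z hz
    exact ⟨div_nonneg h2 h1.le, (div_le_iff₀ h1).mpr h3⟩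
  obtain ⟨E, hEm, hE, hdev⟩ := exists_condMean_deviation hn hp hp0 hℓ hℓ0 hpos' hZ hne hB0 hB hh j
    (hKc j) (hK0 j) (le_kernelSup hKb j) hcB hδ hδ1
  refine ⟨E, hEm, hE, fun data hdata hmem f z hz => ?_⟩
  obtain ⟨h1, h2, h3, h4⟩ := hsmooth f z hz
  have hdev' := hdev _ hmem (fun i => ⟨hdata i j trivial, restrict_mem_box (hdata i) _⟩) f z hz
  have hkm : Measurable fun y : Fin D → ℝ =>
      scaledKernel h (G.mp j) (K j) ((G.mp j).restrict z - (G.mp j).restrict y) :=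
    (continuous_scaledKernel (hKc j)).measurable.comp
      (measurable_const.sub (Finset.measurable_restrict (G.mp j)))
  have hki : Integrable (fun y : Fin D → ℝ =>
      scaledKernel h (G.mp j) (K j) ((G.mp j).restrict z - (G.mp j).restrict y)) (law Zsp p) :=
    .of_bound hkm.aestronglyMeasurable _
      (.of_forall fun y => scaledKernel_le hh (le_kernelSup hKb j) _)
  have hbki : Integrable (fun y : Fin D → ℝ =>
      margLoss G Zsp p ℓ j f (Function.update z j (y j)) *
      scaledKernel h (G.mp j) (K j) ((G.mp j).restrict z - (G.mp j).restrict y)) (law Zsp p) := by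
    refine hki.bdd_mul (c := lossSup ℓ) ((measurable_margLoss hp hp0 hℓ hℓ0 j f).comp
      ((measurable_update z).comp (measurable_pi_apply j))).aestronglyMeasurable ?_
    filter_upwards [ae_law_mem_space hZ p] with y hy
    rw [Real.norm_of_nonneg (margLoss_nonneg hp hp0 hℓ hℓ0 _ _ _)]
    exact margLoss_le hp hp0 hℓ hℓ0 hpos' hZ hB0 hB j f (update_mem_space hz (hy j trivial))
  -- By the choice of `c` the expectation vanishes, leaving the bare empirical mean.
  rw [integral_sub_const_mul_eq hbki hki h1.ne', sub_zero] at hdev'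
  have hstoch := abs_weighted_mean_sub_le hn (div_pos hκpos hdet)
    (fun i => (div_le_iff₀' hdet).mpr
      (kernelInf_le hh (hK0 j) (restrict_mem_box hz _) (restrict_mem_box (hdata i) _))) hdev'
  rw [← toReal_tailLoss_eq_div hp hp0 hℓ hℓ0 hpos' hZ hB j f hqm hz] at h4
  refine (abs_sub_le _ (c f z) _).trans ((add_le_add hstoch h4).trans ?_)
  rw [add_comm]
  have hτ := kernelTail_nonneg (Zsp := Zsp) (h := h) (S := G.mp j) (K := K j)
  have hA : 0 ≤ holderConst β L (K j) * bandwidthNorm h (G.mp j) ^ β :=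
    (abs_nonneg _).trans (kernel_bias hh hβ hL (hKc j) hKo hKm hrh 0).2
  have hI : 0 ≤ ∫ u in (box Zsp (G.mp j))ᶜ, |r u| := integral_nonneg fun _ => abs_nonneg _
  have hratio : 1 ≤ kernelSup G K / kernelInf Zsp h (G.mp j) (K j) := (one_le_div hκpos).mpr hκle
  have hR₁ := rademacher_nonneg n ((law Zsp p).map fun z => (z j, (G.mp j).restrict z))
    (tensor (lossClass G Zsp p ℓ j) (kernelClass Zsp h (G.mp j) (K j)))
  have hR₂ := rademacher_nonneg n ((law Zsp p).map (G.mp j).restrict)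
    (kernelClass Zsp h (G.mp j) (K j))
  have hCK := inv_kernelInf_le_kernelConst G Zsp K h j
  have hBK : 0 ≤ kernelSup G K := hκpos.le.trans hκle
  -- The one-sided tail for the supremum of absolute deviations already gives `log (1 / δ)`, which
  -- is relaxed to `log (2 / δ)`.
  have hlog : √(Real.log (1 / δ) / (2 * n)) ≤ √(Real.log (2 / δ) / (2 * n)) := by
    gcongr
    norm_num
  exact add_le_add (bias_terms_le hB0 hε hA hτ hI hratio)
    (stochastic_terms_le hB0 hBK hdet hκpos hCK hR₁ hR₂ (Real.sqrt_nonneg _) hlog)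

end ADMGAug

theorem theorem1
    {D n : ℕ} (hD : 0 < D) (hn : 0 < n)
    -- the graph, the coordinate spaces and the density
    (G : ADMG (Fin D)) (hG : G.Concordant)
    (Zsp : Fin D → Set ℝ) (hZsp : ∀ j, IsCompact (Zsp j))
    (p : (Fin D → ℝ) → ℝ) (hp_meas : Measurable p) (hp_nonneg : ∀ z, 0 ≤ p z)
    (hp_fact : Factorizes G Zsp p)
    (hp_pos : ∀ j, ∃ c > 0, ∀ z ∈ space Zsp, c ≤ marginal Zsp p (G.mp j) z)
    -- the hypothesis class and the loss
    {F : Type*} (ℓ : F → (Fin D → ℝ) → ℝ) (hℓ_meas : ∀ f, Measurable (ℓ f))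
    (hℓ_nonneg : ∀ f z, 0 ≤ ℓ f z)
    (hℓ_bdd : BddAbove (Set.range fun w : F × (Fin D → ℝ) => |ℓ w.1 w.2|))
    -- the smoothness parameters, the bandwidths and the kernels
    {β L : ℝ} (hβ : 1 < β) (hL : 0 < L)
    (h : Fin D → ℝ) (hh : ∀ k, 0 < h k)
    (K : (j : Fin D) → (G.mp j → ℝ) → ℝ) (hK_empty : ∀ j, G.mp j = ∅ → ∀ u, K j u = 1)
    (hK_cont : ∀ j, Continuous (K j)) (hK_pos : ∀ j u, 0 < K j u)
    (hK_bdd : ∀ j, BddAbove (Set.range fun u => |K j u|))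
    (hK_order : ∀ j, IsKernelOfOrder ⌊β⌋₊ (K j))
    (hK_moment : ∀ j, Integrable fun u => |K j u| * euclNorm u ^ β)
    -- the smooth extensions of the marginal densities
    (pext : (j : Fin D) → (G.mp j → ℝ) → ℝ) (qext : (j : Fin D) → ℝ → (G.mp j → ℝ) → ℝ)
    (hpext : ∀ j, ∀ z ∈ space Zsp, pext j ((G.mp j).restrict z) = marginal Zsp p (G.mp j) z)
    (hqext : ∀ j, ∀ z ∈ space Zsp,
      qext j (z j) ((G.mp j).restrict z) = marginal Zsp p (insert j (G.mp j)) z)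
    (hpext_holder : ∀ j, pext j ∈ HolderClass β L)
    (hqext_holder : ∀ j, ∀ x ∈ Zsp j, qext j x ∈ HolderClass β L)
    (hpext_int : ∀ j, IntegrableOn (pext j) (box Zsp (G.mp j))ᶜ)
    (hqext_int : ∀ j,
      IntegrableOn (Function.uncurry (qext j)) (Zsp j ×ˢ (box Zsp (G.mp j))ᶜ))
    -- the independent sample
    {Ω : Type*} [MeasurableSpace Ω] (μ : Measure Ω) [IsProbabilityMeasure μ]
    (Z : Fin n → Ω → Fin D → ℝ) (hZ_meas : ∀ i, Measurable (Z i))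
    (hZ_indep : iIndepFun Z μ) (hZ_law : ∀ i, μ.map (Z i) = law Zsp p)
    -- the confidence level
    (δ : ℝ) (hδ0 : 0 < δ) (hδ1 : δ < 1) :
    ∃ E : Set Ω, MeasurableSet E ∧ 1 - 2 * D * δ ≤ μ.real E ∧
      ∀ ω ∈ E, ∀ fhat fstar : F,
        IsMinOn (augRisk G K h ℓ fun i => Z i ω) Set.univ fhat →
        IsMinOn (risk Zsp p ℓ) Set.univ fstar →
        risk Zsp p ℓ fhat - risk Zsp p ℓ fstar ≤
          2 * (biasH G Zsp p ℓ K h β L + biasP G Zsp p ℓ K h pext qext)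
          + 4 * kernelConst G Zsp K h *
              (lossComplexity n G Zsp p ℓ K h + lossSup ℓ * kernelComplexity n G Zsp p K h)
          + 2 * D * lossSup ℓ * kernelSup G K * kernelConst G Zsp K h *
              √(Real.log (2 / δ) / (2 * n)) := by
  have : IsProbabilityMeasure (law Zsp p) := by
    rw [← hZ_law ⟨0, hn⟩]
    exact Measure.isProbabilityMeasure_map (hZ_meas _).aemeasurable
  have hspace : MeasurableSet (space Zsp) := measurableSet_space hZsp
  choose E hEm hE hdev using fun j => exists_weighted_mean_deviation hn hZsp hp_meas hp_nonneg
    hp_pos hℓ_meas hℓ_nonneg hℓ_bdd hβ hL hh hK_cont hK_pos hK_bdd j (hK_order j) (hK_moment j)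
    (hpext j) (hqext j) (hpext_holder j) (hqext_holder j) (hpext_int j) (hqext_int j) hδ0 hδ1
  set A : Fin D → Set Ω := fun j =>
    (fun ω i => (Z i ω j, (G.mp j).restrict (Z i ω))) ⁻¹' E j with hA
  -- The sample lies in the data space only almost surely; `A₀` makes this hold at every outcome
  -- considered.
  set A₀ : Set Ω := ⋂ i, Z i ⁻¹' space Zsp with hA₀
  have hπ : ∀ j, Measurable fun z : Fin D → ℝ => (z j, (G.mp j).restrict z) := fun j =>
    (measurable_pi_apply j).prodMk (Finset.measurable_restrict (G.mp j))
  have hAm : ∀ j, MeasurableSet (A j) := fun j =>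
    measurable_pi_iff.mpr (fun i => (hπ j).comp (hZ_meas i)) (hEm j)
  have hA₀m : MeasurableSet A₀ := MeasurableSet.iInter fun i => hZ_meas i hspace
  have hA₀ae : ∀ᵐ ω ∂μ, ω ∈ A₀ := by
    simp only [hA₀, Set.mem_iInter, ae_all_iff]
    intro i
    have := ae_law_mem_space hZsp p
    rw [← hZ_law i] at this
    exact ae_of_ae_map (hZ_meas i).aemeasurable this
  have hAc : ∀ j, μ.real (A j)ᶜ ≤ δ := fun j => by
    have := hE j
    rw [← measureReal_preimage_pi hZ_meas hZ_indep hZ_law (hπ j) (hEm j)] at this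
    rw [probReal_compl_eq_one_sub (hAm j)]
    linarith
  refine ⟨A₀ ∩ ⋂ j, A j, hA₀m.inter (MeasurableSet.iInter hAm), ?_, ?_⟩
  -- A union bound over one event per coordinate gives failure probability at most `D δ`, within the
  -- allowed `2 D δ`.
  · have h1 : μ.real (A₀ ∩ ⋂ j, A j)ᶜ ≤ D * δ := by
      have h0 : μ A₀ᶜ = 0 := hA₀ae
      have h0' : μ.real A₀ᶜ = 0 := by rw [measureReal_def, h0, ENNReal.toReal_zero]
      calc μ.real (A₀ ∩ ⋂ j, A j)ᶜ ≤ μ.real A₀ᶜ + μ.real (⋃ j, (A j)ᶜ) := by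
            rw [Set.compl_inter, ← Set.compl_iInter]
            exact measureReal_union_le _ _
        _ ≤ 0 + ∑ j, μ.real (A j)ᶜ := by
            rw [h0']
            gcongr
            exact measureReal_iUnion_fintype_le _
        _ ≤ 0 + ∑ _j : Fin D, δ := by gcongr with j; exact hAc j
        _ = D * δ := by simp
    rw [probReal_compl_eq_one_sub (hA₀m.inter (MeasurableSet.iInter hAm))] at h1
    have : 0 ≤ D * δ := by positivity
    linarith
  · intro ω hω fhat fstar hfhat _
    have hdata : ∀ i, Z i ω ∈ space Zsp := Set.mem_iInter.mp hω.1
    have hbound := fun f => abs_augRisk_sub_risk_le hn hp_meas hp_nonneg hp_fact hℓ_meas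
      hℓ_nonneg hh hK_pos hdata f fun j => hdev j (fun i => Z i ω) hdata
        (Set.mem_iInter.mp hω.2 j) f
    -- Both risks are within `e` of their augmented versions, and `fhat` has the smaller augmented
    -- risk, so the true risks differ by at most `2 e`. This doubling yields the factors `2`, `4`
    -- and `2 D` of the bound.
    have hexcess : ∀ {a a' b b' e : ℝ}, |a - b| ≤ e → |a' - b'| ≤ e → a ≤ a' → b - b' ≤ 2 * e :=
      fun h1 h2 h3 => by linarith [(abs_le.mp h1).1, (abs_le.mp h2).2]
    refine (hexcess (hbound fhat) (hbound fstar) (isMinOn_iff.mp hfhat fstar trivial)).trans_eq ?_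
    simp only [Finset.sum_add_distrib, ← Finset.mul_sum, Finset.sum_const, Finset.card_univ,
      Fintype.card_fin, nsmul_eq_mul, biasH, biasP, lossComplexity, kernelComplexity]
    ring
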